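/- **Setting.** Let $p_1,\dots,p_n\ge 0$ with $\sum_i p_i=1$ (or all $p_i=0$). Objects $1,\dots,n$ are initially listed in the order $1,2,\dots,n$ (identity permutation). Object $i$ is requested at the instants of a Poisson process of rate $p_i$, the $n$ processes being independent, and each requested object is instantaneously moved to the front of the list. For $t\ge 0$ let $R_t$ be the set of objects requested at least once in $[0,t)$, let $S^{(n)}(t)$ be the position in the list at time $t$ (just before any request at time $t$) of the first object requested in $[t,\infty)$ ($S^{(n)}(t):=0$ if there is none), and let $S^{(n)}_{\mathbf o}(t)$ be equal to $S^{(n)}(t)$ if that object is not in $R_t$ and to $0$ otherwise. For each $n\ge1$ let $\mathbf w^{(n)}=(w^{(n)}_1,\dots,w^{(n)}_n)$ be a random vector with nonnegative entries and, conditionally on $\mathbf w^{(n)}$, define $S^{(n)}$, $S^{(n)}_{\mathbf o}$, $R_t$ as above with $p_i=w^{(n)}_i/\sum_{j}w^{(n)}_j$ (where $0/0:=0$). Let $P$ be a Borel probability measure on $\mathbb R_+=[0,\infty)$. Condition LLN-$P$ means that $P$ has a finite first moment $\mu=\int xP(dx)\neq 0$ and that there are positive random variables $Z_n$ such that the empirical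 measures $\frac1n\sum_{i=1}^n\delta_{Z_nw^{(n)}_i}$ converge in law to $P$ (as random elements of the space of Borel probability measures on $\mathbb R_+$ with the weak topology) and the empirical means $\frac1n\sum_{i=1}^nZ_nw_i^{(n)}$ converge in law to $\mu$. Let $\phi(t)=\int_{\mathbb R_+}e^{-xt}P(dx)$, $t\ge0$ (with $\phi'(0)$ the right derivative at $0$). **Theorem.** For $\lambda\ge0$ and $t\ge0$ define $$B_n(t,\lambda):=\mathbb E\Bigl(e^{-\lambda S^{(n)}_{\mathbf o}(t)}\mathbf 1_{\{S^{(n)}_{\mathbf o}(t)>0\}}\Bigr)=\mathbb E\Bigl(e^{-\lambda S^{(n)}(t)}\mathbf 1_{\{S^{(n)}(t)>|R_t|\}}\Bigr)$$ (the two expressions being equal). Assume LLN-$P$. Then, for all $\lambda\ge 0$ and $t\ge0$, the limit $L(\mu,t,\lambda):=\lim_{n\to\infty}B_n(n\mu t,\lambda/n)$ exists in the following cases. (i) If $\mathbf w^{(n)}$ is exchangeable for each $n$, then $$L(\mu,t,\lambda)=\frac{|\phi'(t)|}{\mu}\int_0^1e^{-\lambda\phi(t)x}\,dx\;e^{-\lambda(1-\phi(t))},$$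 which for $\lambda>0$ equals $\dfrac{|\phi'(t)|}{\mu}\cdot\dfrac{e^{-\lambda(1-\phi(t))}-e^{-\lambda}}{\lambda\phi(t)}$. (ii) If $\mathbf w^{(n)}$ is a.s. decreasing (in the wide sense) for each $n$, then $$L(\mu,t,\lambda)=\frac1\mu\int_{[0,\infty)}xe^{-xt}\int_0^1\exp\Bigl\{-\lambda\Bigl(\int_{(x,\infty)}e^{-yt}P(dy)+u\,e^{-xt}P(\{x\})\Bigr)\Bigr\}\,du\,P(dx)\;e^{-\lambda(1-\phi(t))}.$$ In particular, if $P$ has no atom in $(0,\infty)$, $$L(\mu,t,\lambda)=\frac1\mu\int_{[0,\infty)}xe^{-xt}\exp\Bigl\{-\lambda\int_{(x,\infty)}e^{-yt}P(dy)\Bigr\}P(dx)\;e^{-\lambda(1-\phi(t))}.$$ (iii) If $\mathbf w^{(n)}$ is a.s. increasing (in the wide sense) for each $n$, then $$L(\mu,t,\lambda)=\frac1\mu\int_{[0,\infty)}xe^{-xt}\int_0^1\exp\Bigl\{-\lambda\Bigl(\int_{[0,x)}e^{-yt}P(dy)+u\,e^{-xt}P(\{x\})\Bigr)\Bigr\}\,du\,P(dx)\;e^{-\lambda(1-\phi(t))}.$$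 In particular, if $P$ has no atom in $(0,\infty)$, $$L(\mu,t,\lambda)=\frac1\mu\int_{[0,\infty)}xe^{-xt}\exp\Bigl\{-\lambda\int_{[0,x]}e^{-yt}P(dy)\Bigr\}P(dx)\;e^{-\lambda(1-\phi(t))}.$$ -/

import Mathlib

open MeasureTheory ProbabilityTheory Filter Topology
open scoped NNReal ENNReal BoundedContinuousFunction

noncomputable section

namespace MoveToFront

/-! ### The move-to-front list for deterministic request rates

The space `Fin n × ℕ → ℝ` carries i.i.d. standard exponential variables.  The variable with index
`(i, k)` drives the waiting time between the `k`-th and the `(k+1)`-st request of object `i`, so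
that the requests of the different objects follow independent Poisson processes. -/

/-- The popularities `p i = w i / ∑ j, w j` (with `0 / 0 = 0`). -/
def popularity {n : ℕ} (w : Fin n → ℝ≥0) (i : Fin n) : ℝ :=
  (w i : ℝ) / ∑ j, (w j : ℝ)

instance isProbabilityMeasure_expOne : IsProbabilityMeasure (expMeasure 1) :=
  isProbabilityMeasure_expMeasure one_pos

/-- The law of the family of i.i.d. standard exponential variables. -/
def clockLaw (n : ℕ) : Measure (Fin n × ℕ → ℝ) :=
  Measure.infinitePi (fun _ : Fin n × ℕ => expMeasure 1)

/-- The instant of the `(k+1)`-st request of object `i`, where the request instants of object `i`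
form a Poisson process of rate `p i`.  It is meaningful when `0 < p i`; objects with `p i = 0` are
never requested (see `requestsBefore` and `IsNextRequest`). -/
def requestTime {n : ℕ} (p : Fin n → ℝ) (ξ : Fin n × ℕ → ℝ) (a : Fin n × ℕ) : ℝ :=
  (∑ l ∈ Finset.range (a.2 + 1), ξ (a.1, l)) / p a.1

/-- The requests made in the time interval `[0, t)`; a request is a pair (object, number). -/
def requestsBefore {n : ℕ} (p : Fin n → ℝ) (ξ : Fin n × ℕ → ℝ) (t : ℝ) : Set (Fin n × ℕ) :=
  {a | 0 < p a.1 ∧ requestTime p ξ a < t}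

open Classical in
/-- The objects requested in `[0, t)`, in chronological order and with repetitions.  (The set of
requests in `[0, t)` is almost surely finite and its instants are almost surely distinct; on the
remaining null event the value is irrelevant.) -/
def requestSequence {n : ℕ} (p : Fin n → ℝ) (ξ : Fin n × ℕ → ℝ) (t : ℝ) : List (Fin n) :=
  if h : (requestsBefore p ξ t).Finite then
    (h.toFinset.toList.insertionSort
      (fun a b => requestTime p ξ a ≤ requestTime p ξ b)).map Prod.fst
  else []

/-- The move-to-front rule: the requested object is placed at the front of the list, the relative
order of the other objects is unchanged. -/
def moveToFront {n : ℕ} (L : List (Fin n)) (i : Fin n) : List (Fin n) :=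
  i :: L.erase i

/-- The list at time `t`, started from the identity ordering `0, 1, …, n - 1`. -/
def listAt {n : ℕ} (p : Fin n → ℝ) (ξ : Fin n × ℕ → ℝ) (t : ℝ) : List (Fin n) :=
  (requestSequence p ξ t).foldl moveToFront (List.finRange n)

/-- The position (in `{1, …, n}`) of object `i` in the list at time `t`. -/
def position {n : ℕ} (p : Fin n → ℝ) (ξ : Fin n × ℕ → ℝ) (t : ℝ) (i : Fin n) : ℕ :=
  (listAt p ξ t).idxOf i + 1

/-- Object `i` is the first object requested in `[t, ∞)`. -/
def IsNextRequest {n : ℕ} (p : Fin n → ℝ) (ξ : Fin n × ℕ → ℝ) (t : ℝ) (i : Fin n) : Prop :=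
  ∃ k : ℕ, 0 < p i ∧ t ≤ requestTime p ξ (i, k) ∧
    ∀ b : Fin n × ℕ, 0 < p b.1 → t ≤ requestTime p ξ b →
      requestTime p ξ (i, k) ≤ requestTime p ξ b

/-- `R_t`: the set of objects requested at least once in `[0, t)`. -/
def requestedSet {n : ℕ} (p : Fin n → ℝ) (ξ : Fin n × ℕ → ℝ) (t : ℝ) : Set (Fin n) :=
  {i | ∃ k : ℕ, (i, k) ∈ requestsBefore p ξ t}

open Classical in
/-- The search-cost at time `t`: the position, in the list at time `t`, of the first object
requested in `[t, ∞)`. -/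
def searchCost {n : ℕ} (p : Fin n → ℝ) (t : ℝ) (ξ : Fin n × ℕ → ℝ) : ℕ :=
  ∑ i, if IsNextRequest p ξ t i then position p ξ t i else 0

open Classical in
/-- The out-of-equilibrium part of the search-cost: the search-cost if the first object requested
in `[t, ∞)` has not been requested in `[0, t)`, and `0` otherwise. -/
def searchCostOut {n : ℕ} (p : Fin n → ℝ) (t : ℝ) (ξ : Fin n × ℕ → ℝ) : ℕ :=
  if ∃ i, IsNextRequest p ξ t i ∧ i ∉ requestedSet p ξ t then searchCost p t ξ else 0

/-! ### Random weights: conditionally on the weights, the list is the one above -/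

/-- `𝔼[exp(-l S_o(t)) 1_{S_o(t) > 0}]`, where, conditionally on the random weights `w`, the
variable `S_o(t)` is the out-of-equilibrium search-cost for the popularities defined by `w`. -/
def outTransform {Ω : Type*} [MeasurableSpace Ω] (μΩ : Measure Ω) {n : ℕ} (w : Ω → Fin n → ℝ≥0)
    (t l : ℝ) : ℝ :=
  ∫ ω, ∫ ξ, Set.indicator {ξ | 0 < searchCostOut (popularity (w ω)) t ξ}
    (fun ξ => Real.exp (-(l * (searchCostOut (popularity (w ω)) t ξ : ℝ)))) ξ ∂(clockLaw n) ∂μΩ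

/-- `𝔼[exp(-l S(t)) 1_{S(t) > |R_t|}]`. -/
def aboveTransform {Ω : Type*} [MeasurableSpace Ω] (μΩ : Measure Ω) {n : ℕ} (w : Ω → Fin n → ℝ≥0)
    (t l : ℝ) : ℝ :=
  ∫ ω, ∫ ξ, Set.indicator
    {ξ | (requestedSet (popularity (w ω)) ξ t).ncard < searchCost (popularity (w ω)) t ξ}
    (fun ξ => Real.exp (-(l * (searchCost (popularity (w ω)) t ξ : ℝ)))) ξ ∂(clockLaw n) ∂μΩ

/-! ### The law of large numbers condition -/

/-- The empirical measure `(1/n) ∑ i, δ_{x i}`, for `n ≥ 1`. -/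
def empirical (n : ℕ+) (x : Fin n → ℝ≥0) : ProbabilityMeasure ℝ≥0 :=
  ⟨((n : ℕ) : ℝ≥0∞)⁻¹ • ∑ i, Measure.dirac (x i), ⟨by
    have h0 : ((n : ℕ) : ℝ≥0∞) ≠ 0 := by exact_mod_cast n.ne_zero
    simp [ENNReal.inv_mul_cancel h0 (ENNReal.natCast_ne_top _)]⟩⟩

/-- The random elements `X n`, defined on possibly different probability spaces, converge in law
to the deterministic element `c`. -/
def ConvergesInLaw {Ω : ℕ+ → Type*} [∀ n, MeasurableSpace (Ω n)] (μΩ : ∀ n, Measure (Ω n))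
    {E : Type*} [TopologicalSpace E] (X : ∀ n, Ω n → E) (c : E) : Prop :=
  ∀ Ψ : E →ᵇ ℝ, Tendsto (fun n => ∫ ω, Ψ (X n ω) ∂(μΩ n)) atTop (𝓝 (Ψ c))

/-- The mean `∫ x P(dx)`. -/
def mean (P : ProbabilityMeasure ℝ≥0) : ℝ := ∫ x : ℝ≥0, (x : ℝ) ∂(P : Measure ℝ≥0)

/-- The Laplace transform `φ(t) = ∫ e^{-xt} P(dx)`. -/
def laplace (P : ProbabilityMeasure ℝ≥0) (t : ℝ) : ℝ :=
  ∫ x : ℝ≥0, Real.exp (-((x : ℝ) * t)) ∂(P : Measure ℝ≥0)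

/-- Condition LLN-`P` for the random vectors `w n`. -/
structure LLN {Ω : ℕ+ → Type*} [∀ n, MeasurableSpace (Ω n)] (μΩ : ∀ n, Measure (Ω n))
    (w : ∀ n : ℕ+, Ω n → Fin n → ℝ≥0) (P : ProbabilityMeasure ℝ≥0) : Prop where
  integrable : Integrable (fun x : ℝ≥0 => (x : ℝ)) (P : Measure ℝ≥0)
  mean_ne_zero : mean P ≠ 0
  exists_scaling : ∃ Z : ∀ n, Ω n → ℝ≥0,
    (∀ n, Measurable (Z n)) ∧ (∀ n, ∀ᵐ ω ∂(μΩ n), 0 < Z n ω) ∧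
    ConvergesInLaw μΩ (fun n ω => empirical n (fun i => Z n ω * w n ω i)) P ∧
    ConvergesInLaw μΩ (fun n ω => (∑ i, (Z n ω : ℝ) * (w n ω i : ℝ)) / ((n : ℕ) : ℝ)) (mean P)

/-- The random vector `w` is exchangeable. -/
def Exchangeable {Ω : Type*} [MeasurableSpace Ω] (μΩ : Measure Ω) {n : ℕ}
    (w : Ω → Fin n → ℝ≥0) : Prop :=
  ∀ σ : Equiv.Perm (Fin n), μΩ.map (fun ω i => w ω (σ i)) = μΩ.map w

end MoveToFront

end

/-! An object $i$ not yet requested at time $t$ stands behind exactly the objects $j$ that were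
requested or have $j<i$. On the event that $i$ is unrequested and is the next object requested, the
cost is therefore $\#\{j : j\in R_t \text{ or } j\le i\}$, and $e^{-lS}$ is a product over $j$.
Conditioning on the first request instant of $i$ makes the other clocks independent, and the absence
of renewals in a window is memoryless (`waitingLaw_noArrival`). Integrating gives the exact formula
`outFormula` for fixed popularities (`integral_out_eq_outFormula`).

At time $n\mu t$ and parameter $l/n$, each factor of the product is $1-(1-e^{-l/n})s$ with
$s\in[0,1]$, hence $e^{-ls/n}$ up to $l^2/n^2$. If the weights $y$ are scaled to have mean exactly
$\mu$, `outFormula` becomes, up to $l^2/n$, a factor tending to $e^{-l(1-\phi(t))}$ times $1/\mu$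
times `weightedAverage`. The latter is the average of $y_ie^{-y_it}e^{-lA_i}$, where $A_i$ is the
$1/n$-normalized sum of the $e^{-y_jt}$ over $j\le i$. Only this average depends on the order of the
weights. Its unbounded factor $y_i$ is truncated at no cost in the limit, because the means converge
to the mean of $P$ (`tendsto_weighted_average`).

For decreasing weights, $e^{-y_it}e^{-lA_i}/n$ is almost an increment of the primitive `cumExp`
along the $A_i$. Writing $\min(y_i,M)$ as an integral over levels $z<y_i$ and telescoping over the
initial segment $\{y_i>z\}$ leaves an integral of `cumExp` of empirical tails, which passes to the
limit. The same layer-cake argument on the limit side, with a chain rule for tails of measures with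
atoms (`setIntegral_stepAverage_tail`), identifies the answer; the inner integral over $u$ is the
smoothing of a jump at an atom. Increasing weights reduce to decreasing ones by reversing the order
and changing the sign of $l$.

For exchangeable weights the formula is first averaged over all permutations. A variance bound for
sampling without replacement shows that $A_i$ is close to $(i+1)/n$ times the full average (indices
from zero), so the sum factorizes into a mean and a Riemann sum.

All these limits are proved for deterministic arrays. `tendsto_integral_of_LLN` transfers them to
random weights: the functionals are bounded and scale invariant, and convergence in law to a
constant forces the empirical measure and mean to be close to their limits with high probability. -/

noncomputable section

namespace MoveToFront

/-! ### The list after a sequence of requests -/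

/-- Requested objects form a front block and the others keep their initial order behind it. The
order inside the block is left unspecified because only its support matters for the
out-of-equilibrium cost. -/
theorem foldl_moveToFront_eq_append {n : ℕ} {L : List (Fin n)} (hL : L.Nodup)
    (r : List (Fin n)) (hr : ∀ i ∈ r, i ∈ L) :
    ∃ A : List (Fin n), A.Nodup ∧ (∀ i, i ∈ A ↔ i ∈ r) ∧
      r.foldl moveToFront L = A ++ L.filter (fun i => i ∉ r) := by
  induction r using List.reverseRecOn with
  | nil => exact ⟨[], by simp⟩
  | append_singleton r j ih =>
    obtain ⟨A, hA, hmem, heq⟩ := ih (fun i hi => hr i (by simp [hi]))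
    refine ⟨j :: A.erase j, ?_, ?_, ?_⟩
    · exact List.nodup_cons.2 ⟨fun h => (hA.mem_erase_iff.1 h).1 rfl, hA.erase j⟩
    · intro i
      rw [List.mem_cons, hA.mem_erase_iff, hmem, List.mem_append, List.mem_singleton]
      tauto
    · rw [List.foldl_append, heq]
      simp only [List.foldl_cons, List.foldl_nil, moveToFront, List.cons_append]
      -- An object already in the block is erased there and the tail is unchanged; a new one is
      -- erased from the tail, which amounts to filtering it out.
      congr 1
      by_cases hj : j ∈ A
      · rw [List.erase_append_left _ hj]
        congr 1
        refine List.filter_congr fun i _ => ?_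
        have : j ∈ r := (hmem j).1 hj
        simp only [List.mem_append, List.mem_singleton, decide_eq_decide]
        constructor
        · rintro h (h' | rfl) <;> tauto
        · tauto
      · rw [List.erase_append_right _ hj, List.erase_of_not_mem hj,
          (hL.filter _).erase_eq_filter, List.filter_filter]
        congr 1
        refine List.filter_congr fun i _ => ?_
        rw [Bool.eq_iff_iff]
        simp [and_comm, not_or]

/-- The filtered list is strictly increasing, so the entries preceding `i` are the selected elements
smaller than `i`. -/
theorem idxOf_filter_finRange {n : ℕ} (s : Fin n → Prop) [DecidablePred s] (i : Fin n) (hi : s i) :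
    ((List.finRange n).filter (fun j => s j)).idxOf i
      = (Finset.univ.filter (fun j => j < i ∧ s j)).card := by
  have hsort : ((List.finRange n).filter (fun j => s j)).Pairwise (· < ·) :=
    (List.pairwise_lt_finRange n).filter _
  set L := (List.finRange n).filter (fun j => s j) with hL
  have hiL : i ∈ L := by simp [hL, hi]
  have hlt : L.idxOf i < L.length := List.idxOf_lt_length_iff.2 hiL
  have hnd : L.Nodup := (List.nodup_finRange n).filter _
  have : (Finset.univ.filter (fun j => j < i ∧ s j)) = (L.take (L.idxOf i)).toFinset := by
    ext j
    simp only [Finset.mem_filter, Finset.mem_univ, true_and, List.mem_toFinset]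
    constructor
    · rintro ⟨hji, hj⟩
      have hjL : j ∈ L := by simp [hL, hj]
      rw [List.mem_take_iff_getElem]
      have hjlt : L.idxOf j < L.length := List.idxOf_lt_length_iff.2 hjL
      refine ⟨L.idxOf j, lt_min ?_ hjlt, List.getElem_idxOf hjlt⟩
      by_contra hcon
      push Not at hcon
      rcases hcon.eq_or_lt with h | h
      · rw [List.idxOf_inj hiL] at h
        exact hji.ne h.symm
      · have := List.pairwise_iff_getElem.1 hsort _ _ hlt hjlt h
        rw [List.getElem_idxOf, List.getElem_idxOf] at this
        exact absurd this hji.le.not_gt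
    · intro hj
      rw [List.mem_take_iff_getElem] at hj
      obtain ⟨k, hk, rfl⟩ := hj
      have hk' := lt_min_iff.1 hk
      have := List.pairwise_iff_getElem.1 hsort _ _ hk'.2 hlt hk'.1
      rw [List.getElem_idxOf] at this
      refine ⟨this, ?_⟩
      have hm : ∀ j ∈ L, s j := fun j hj => by simpa [hL] using hj
      exact hm _ (List.getElem_mem _)
  rw [this, List.toFinset_card_of_nodup (hnd.sublist (List.take_sublist _ _)), List.length_take,
    min_eq_left hlt.le]

open Classical in
-- Ahead of an unrequested object stand the front block and the unrequested objects initially ahead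
-- of it; the `+ 1` is absorbed by `i` itself through `j ≤ i`.
theorem idxOf_foldl_moveToFront_of_notMem {n : ℕ} (r : List (Fin n)) (i : Fin n) (hi : i ∉ r) :
    (r.foldl moveToFront (List.finRange n)).idxOf i + 1
      = (Finset.univ.filter (fun j => j ∈ r ∨ j ≤ i)).card := by
  obtain ⟨A, hA, hmem, heq⟩ := foldl_moveToFront_eq_append (List.nodup_finRange n) r
    (fun i _ => List.mem_finRange i)
  rw [heq, List.idxOf_append_of_notMem (fun h => hi ((hmem i).1 h)),
    idxOf_filter_finRange (fun j => j ∉ r) i hi, ← List.toFinset_card_of_nodup hA]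
  have h1 : (Finset.univ.filter (fun j => j ∈ r ∨ j ≤ i))
      = insert i (A.toFinset ∪ Finset.univ.filter (fun j => j < i ∧ j ∉ r)) := by
    ext j
    simp only [Finset.mem_filter, Finset.mem_univ, true_and, Finset.mem_insert, Finset.mem_union,
      List.mem_toFinset, hmem, le_iff_lt_or_eq]
    tauto
  rw [h1, Finset.card_insert_of_notMem, Finset.card_union_of_disjoint]
  · rw [Finset.disjoint_left]
    intro j hj
    simp only [List.mem_toFinset, hmem] at hj
    simp [hj]
  · simp [hmem, hi]

theorem idxOf_foldl_moveToFront_of_mem {n : ℕ} (r : List (Fin n)) (i : Fin n) (hi : i ∈ r) :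
    (r.foldl moveToFront (List.finRange n)).idxOf i + 1 ≤ r.toFinset.card := by
  obtain ⟨A, hA, hmem, heq⟩ := foldl_moveToFront_eq_append (List.nodup_finRange n) r
    (fun i _ => List.mem_finRange i)
  have hiA := (hmem i).2 hi
  have : r.toFinset = A.toFinset := by ext j; simp [hmem]
  rw [heq, List.idxOf_append_of_mem hiA, this, List.toFinset_card_of_nodup hA]
  exact List.idxOf_lt_length_iff.2 hiA

/-! ### The position of an object -/

section position
variable {n : ℕ} {p : Fin n → ℝ} {ξ : Fin n × ℕ → ℝ} {t : ℝ}

theorem mem_requestSequence (h : (requestsBefore p ξ t).Finite) (i : Fin n) :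
    i ∈ requestSequence p ξ t ↔ i ∈ requestedSet p ξ t := by
  classical
  rw [requestSequence, dif_pos h]
  simp [requestedSet, List.mem_insertionSort]

open Classical in
theorem position_of_notMem (h : (requestsBefore p ξ t).Finite) {i : Fin n}
    (hi : i ∉ requestedSet p ξ t) :
    position p ξ t i = (Finset.univ.filter (fun j => j ∈ requestedSet p ξ t ∨ j ≤ i)).card := by
  have := idxOf_foldl_moveToFront_of_notMem (requestSequence p ξ t) i
    (by rwa [mem_requestSequence h])
  rw [position, listAt, this]
  simp only [mem_requestSequence h]

theorem position_le_of_mem (h : (requestsBefore p ξ t).Finite) {i : Fin n}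
    (hi : i ∈ requestedSet p ξ t) :
    position p ξ t i ≤ (requestedSet p ξ t).ncard := by
  classical
  have := idxOf_foldl_moveToFront_of_mem (requestSequence p ξ t) i
    (by rwa [mem_requestSequence h])
  refine this.trans_eq ?_
  rw [← Set.ncard_coe_finset]
  congr 1
  ext j
  simp [mem_requestSequence h]

theorem ncard_lt_position (h : (requestsBefore p ξ t).Finite) {i : Fin n}
    (hi : i ∉ requestedSet p ξ t) :
    (requestedSet p ξ t).ncard < position p ξ t i := by
  classical
  rw [position_of_notMem h hi, ← Set.ncard_coe_finset]
  refine Set.ncard_lt_ncard ?_ (Set.toFinite _)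
  rw [Set.ssubset_iff_of_subset (fun j hj => by simp [hj])]
  exact ⟨i, by simp, hi⟩

theorem searchCost_eq_position {i : Fin n} (hi : IsNextRequest p ξ t i)
    (huniq : ∀ j, IsNextRequest p ξ t j → j = i) :
    searchCost p t ξ = position p ξ t i := by
  classical
  rw [searchCost, Finset.sum_eq_single i]
  · simp [hi]
  · intro j _ hj
    rw [if_neg (fun h => hj (huniq j h))]
  · simp

end position

/-! ### The renewal process with exponential waiting times -/

theorem expMeasure_Iic {b : ℝ} (hb : 0 ≤ b) :
    expMeasure 1 (Set.Iic b) = ENNReal.ofReal (1 - Real.exp (-b)) := by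
  have := cdf_expMeasure_eq one_pos b
  rw [if_pos hb, one_mul, cdf_eq_real] at this
  rw [← this, measureReal_def, ENNReal.ofReal_toReal (measure_ne_top _ _)]

instance nullSingletonClass_expMeasure : NullSingletonClass (expMeasure 1) := by
  unfold expMeasure gammaMeasure
  infer_instance

theorem expMeasure_Ici {b : ℝ} (hb : 0 ≤ b) :
    expMeasure 1 (Set.Ici b) = ENNReal.ofReal (Real.exp (-b)) := by
  have h : expMeasure 1 (Set.Ioi b) = ENNReal.ofReal (Real.exp (-b)) := by
    rw [← Set.compl_Iic, prob_compl_eq_one_sub measurableSet_Iic, expMeasure_Iic hb,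
      ← ENNReal.ofReal_one, ← ENNReal.ofReal_sub _ (by simpa using hb)]
    congr 1; ring
  rw [← h]
  exact measure_congr Ioi_ae_eq_Ici.symm

theorem expMeasure_Iio_zero : expMeasure 1 (Set.Iio (0 : ℝ)) = 0 := by
  have := expMeasure_Iic le_rfl
  simp only [neg_zero, Real.exp_zero, sub_self, ENNReal.ofReal_zero] at this
  exact measure_mono_null Set.Iio_subset_Iic_self this

/-- The law of a sequence of i.i.d. standard exponential variables. -/
def waitingLaw : Measure (ℕ → ℝ) := Measure.infinitePi (fun _ : ℕ => expMeasure 1)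

instance : IsProbabilityMeasure waitingLaw := by unfold waitingLaw; infer_instance

/-- The sum of the first `k` waiting times. -/
def arrival (ξ : ℕ → ℝ) (k : ℕ) : ℝ := ∑ l ∈ Finset.range k, ξ l

@[fun_prop]
theorem measurable_arrival (k : ℕ) : Measurable (fun ξ : ℕ → ℝ => arrival ξ k) := by
  unfold arrival; fun_prop

theorem arrival_mono {ξ : ℕ → ℝ} (h : ∀ k, 0 ≤ ξ k) : Monotone (arrival ξ) :=
  monotone_nat_of_le_succ fun k => by
    simp only [arrival, Finset.sum_range_succ]; linarith [h k]

theorem ae_waitingLaw_nonneg : ∀ᵐ ξ ∂waitingLaw, ∀ k, 0 ≤ ξ k := by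
  rw [ae_all_iff]
  intro k
  have hm := measurePreserving_eval_infinitePi (fun _ : ℕ => expMeasure 1) k
  have h : ∀ᵐ x ∂(expMeasure 1), (0 : ℝ) ≤ x := by
    rw [ae_iff]
    simpa [Set.Iio] using expMeasure_Iio_zero
  exact hm.quasiMeasurePreserving.ae h

/-- A single waiting time larger than `|a|` suffices, and the first `m` waiting times all stay below
`|a|` with probability `r ^ m`, where `r < 1`. -/
theorem ae_exists_le_arrival (a : ℝ) : ∀ᵐ ξ ∂waitingLaw, ∃ k, a ≤ arrival ξ k := by
  set r : ℝ≥0∞ := expMeasure 1 (Set.Iic |a|) with hr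
  have hr1 : r < 1 := by
    rw [hr, expMeasure_Iic (abs_nonneg a)]
    refine ENNReal.ofReal_lt_one.2 ?_
    linarith [Real.exp_pos (-|a|)]
  have hbound : ∀ m : ℕ, waitingLaw {ξ | ∀ k, ξ k ≤ |a|} ≤ r ^ m := by
    intro m
    calc waitingLaw {ξ | ∀ k, ξ k ≤ |a|}
        ≤ waitingLaw (Set.pi (Finset.range m : Finset ℕ) (fun _ => Set.Iic |a|)) :=
          measure_mono fun ξ h k _ => h k
      _ = r ^ m := by
          rw [waitingLaw, Measure.infinitePi_pi]
          · simp [hr]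
          · exact fun _ _ => measurableSet_Iic
  have hz : waitingLaw {ξ | ∀ k, ξ k ≤ |a|} = 0 :=
    le_antisymm (ge_of_tendsto' (ENNReal.tendsto_pow_atTop_nhds_zero_of_lt_one hr1) hbound)
      bot_le
  have hz' : ∀ᵐ ξ ∂waitingLaw, ¬ ∀ k, ξ k ≤ |a| := by
    rw [ae_iff]; simpa using hz
  filter_upwards [hz', ae_waitingLaw_nonneg] with ξ h h0
  push Not at h
  obtain ⟨k, hk⟩ := h
  refine ⟨k + 1, ?_⟩
  have : 0 ≤ arrival ξ k := Finset.sum_nonneg fun l _ => h0 l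
  simp only [arrival, Finset.sum_range_succ] at this ⊢
  linarith [le_abs_self a]

theorem map_arrival_prod (k : ℕ) :
    waitingLaw.map (fun ξ => (arrival ξ k, ξ k))
      = (waitingLaw.map (fun ξ => arrival ξ k)).prod (expMeasure 1) := by
  have hI : iIndepFun (fun (k : ℕ) (ξ : ℕ → ℝ) => ξ k) waitingLaw :=
    iIndepFun_infinitePi (X := fun _ x => x) (fun _ => measurable_id)
  have h := hI.indepFun_finsetSum_of_notMem (fun i => measurable_pi_apply i)
    (s := Finset.range k) (i := k) (by simp)
  have h' : IndepFun (fun ξ : ℕ → ℝ => arrival ξ k) (fun ξ => ξ k) waitingLaw := by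
    convert h using 1
    ext ξ
    simp [arrival]
  rw [(indepFun_iff_map_prod_eq_prod_map_map (measurable_arrival k).aemeasurable
    (measurable_pi_apply k).aemeasurable).1 h']
  congr 1
  exact Measure.infinitePi_map_eval (fun _ : ℕ => expMeasure 1) k

/-- Memorylessness: given that the `k`-th partial sum is `s < a`, the next waiting time must exceed
`c - s`, with probability `exp (-(c - s))`. The ratio between `c = b` and `c = a` does not depend on
`s`. -/
theorem waitingLaw_crossing (k : ℕ) {a b : ℝ} (hab : a ≤ b) :
    waitingLaw {ξ | arrival ξ k < a ∧ b ≤ arrival ξ (k + 1)}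
      = ENNReal.ofReal (Real.exp (-(b - a)))
        * waitingLaw {ξ | arrival ξ k < a ∧ a ≤ arrival ξ (k + 1)} := by
  have key : ∀ c, waitingLaw {ξ | arrival ξ k < a ∧ c ≤ arrival ξ (k + 1)}
      = ∫⁻ s, expMeasure 1 {x | s < a ∧ c ≤ s + x} ∂(waitingLaw.map (fun ξ => arrival ξ k)) := by
    intro c
    have hms : MeasurableSet {q : ℝ × ℝ | q.1 < a ∧ c ≤ q.1 + q.2} := by measurability
    have : {ξ : ℕ → ℝ | arrival ξ k < a ∧ c ≤ arrival ξ (k + 1)}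
        = (fun ξ => (arrival ξ k, ξ k)) ⁻¹' {q : ℝ × ℝ | q.1 < a ∧ c ≤ q.1 + q.2} := by
      ext ξ; simp [arrival, Finset.sum_range_succ]
    rw [this, ← Measure.map_apply (by fun_prop) hms, map_arrival_prod, Measure.prod_apply hms]
    rfl
  rw [key, key, ← lintegral_const_mul' _ _ ENNReal.ofReal_ne_top]
  refine lintegral_congr fun s => ?_
  by_cases hs : s < a
  · have h : ∀ c, {x : ℝ | s < a ∧ c ≤ s + x} = Set.Ici (c - s) := by
      intro c; ext x; simp [hs, add_comm]
    rw [h, h, expMeasure_Ici (by linarith), expMeasure_Ici (by linarith),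
      ← ENNReal.ofReal_mul (Real.exp_nonneg _), ← Real.exp_add]
    congr 2; ring
  · simp [hs]

/-- The window is free of renewals exactly when the jump that crosses `a` also crosses `b`; the
series runs over the index of that jump. -/
theorem waitingLaw_noArrival_eq_tsum {a b : ℝ} (ha : 0 < a) (hab : a ≤ b) :
    waitingLaw {ξ | ∀ k, ¬ (a ≤ arrival ξ (k + 1) ∧ arrival ξ (k + 1) < b)}
      = ∑' k, waitingLaw {ξ | arrival ξ k < a ∧ b ≤ arrival ξ (k + 1)} := by
  rw [← measure_iUnion₀]
  · refine measure_congr ?_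
    filter_upwards [ae_waitingLaw_nonneg, ae_exists_le_arrival a] with ξ h0 hex
    have hmono := arrival_mono h0
    refine propext ?_
    change (∀ k, ¬ (a ≤ arrival ξ (k + 1) ∧ arrival ξ (k + 1) < b))
      ↔ ξ ∈ ⋃ k, {ξ | arrival ξ k < a ∧ b ≤ arrival ξ (k + 1)}
    simp only [Set.mem_iUnion, Set.mem_ofPred_eq]
    classical
    constructor
    · intro h
      -- The partial sum of index zero is `0`, so positivity of `a` guarantees a jump across `a`.
      have hpos : Nat.find hex ≠ 0 := by
        intro h0'
        have := Nat.find_spec hex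
        rw [h0'] at this
        simp only [arrival, Finset.range_zero, Finset.sum_empty] at this
        linarith
      obtain ⟨m, hm⟩ := Nat.exists_eq_succ_of_ne_zero hpos
      have h1 := Nat.find_spec hex
      rw [hm] at h1
      have h2 : ¬ a ≤ arrival ξ m := Nat.find_min hex (by omega)
      refine ⟨m, not_le.1 h2, ?_⟩
      by_contra hcon
      exact h m ⟨h1, not_le.1 hcon⟩
    · rintro ⟨k, hk1, hk2⟩ j ⟨hj1, hj2⟩
      rcases le_or_gt (j + 1) k with hjk | hjk
      · linarith [hmono hjk]
      · linarith [hmono (show k + 1 ≤ j + 1 by omega)]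
  · intro k j hkj
    have : ∀ k j : ℕ, k < j → ∀ ξ : ℕ → ℝ, (∀ k, 0 ≤ ξ k) →
        b ≤ arrival ξ (k + 1) → arrival ξ j < a → False := by
      intro k j hkj ξ h0 h1 h2
      linarith [arrival_mono h0 (show k + 1 ≤ j by omega)]
    change waitingLaw _ = 0
    rw [measure_eq_zero_iff_ae_notMem]
    filter_upwards [ae_waitingLaw_nonneg] with ξ h0 hξ
    rcases lt_or_gt_of_ne hkj with h | h
    · exact this k j h ξ h0 hξ.1.2 hξ.2.1
    · exact this j k h ξ h0 hξ.2.2 hξ.1.1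
  · intro k
    refine MeasurableSet.nullMeasurableSet ?_
    exact (measurableSet_lt (measurable_arrival _) measurable_const).inter
      (measurableSet_le measurable_const (measurable_arrival _))

theorem ae_le_waiting_iff {b : ℝ} :
    ∀ᵐ ξ ∂waitingLaw, (b ≤ ξ 0 ↔ ∀ k, b ≤ arrival ξ (k + 1)) := by
  filter_upwards [ae_waitingLaw_nonneg] with ξ h0
  have h1 : arrival ξ 1 = ξ 0 := by simp [arrival]
  exact ⟨fun h k => (h.trans h1.ge).trans (arrival_mono h0 (by omega)),
    fun h => (h 0).trans (by simp [h1])⟩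

theorem waitingLaw_waiting_ge {b : ℝ} (hb : 0 ≤ b) :
    waitingLaw {ξ | b ≤ ξ 0} = ENNReal.ofReal (Real.exp (-b)) := by
  rw [← expMeasure_Ici hb, ← Measure.infinitePi_map_eval (fun _ : ℕ => expMeasure 1) 0,
    Measure.map_apply (by fun_prop) measurableSet_Ici]
  rfl

/-- The probability that there is no renewal in `[a, b)`. -/
theorem waitingLaw_noArrival {a b : ℝ} (ha : 0 ≤ a) (hab : a ≤ b) :
    waitingLaw {ξ | ∀ k, ¬ (a ≤ arrival ξ (k + 1) ∧ arrival ξ (k + 1) < b)}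
      = ENNReal.ofReal (Real.exp (-(b - a))) := by
  -- At `a = 0` no partial sum lies below `a`, so the decomposition by the crossing jump is
  -- unavailable; the event then concerns only the first waiting time.
  rcases ha.eq_or_lt with rfl | ha
  · rw [sub_zero, ← waitingLaw_waiting_ge hab]
    refine measure_congr ?_
    filter_upwards [ae_waitingLaw_nonneg, ae_le_waiting_iff (b := b)] with ξ h0 h1
    refine propext (Iff.trans ?_ h1.symm)
    refine forall_congr' fun k => ?_
    have : 0 ≤ arrival ξ (k + 1) := Finset.sum_nonneg fun l _ => h0 l
    simp [this]
  · rw [waitingLaw_noArrival_eq_tsum ha hab]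
    simp_rw [waitingLaw_crossing _ hab]
    -- The remaining series is the same decomposition for the empty window `[a, a)`, whose
    -- probability is one.
    rw [ENNReal.tsum_mul_left, ← waitingLaw_noArrival_eq_tsum ha le_rfl]
    have : {ξ : ℕ → ℝ | ∀ k, ¬ (a ≤ arrival ξ (k + 1) ∧ arrival ξ (k + 1) < a)} = Set.univ := by
      ext ξ; simp
    rw [this, measure_univ, mul_one]

open Classical in
-- Almost surely the integrand is `c` on the event of an empty window plus `1 - c` on the event of
-- no arrival before `b`. Thus two probabilities suffice, without a joint law for the past and the
-- window.
theorem integral_noArrival {a b : ℝ} (ha : 0 ≤ a) (hab : a ≤ b) (c : ℝ) :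
    ∫ ξ, (if ∀ k, ¬ (a ≤ arrival ξ (k + 1) ∧ arrival ξ (k + 1) < b) then
        (if ∃ k, arrival ξ (k + 1) < a then c else 1) else 0) ∂waitingLaw
      = Real.exp (-(b - a)) * (c + (1 - c) * Real.exp (-a)) := by
  set N : Set (ℕ → ℝ) := {ξ | ∀ k, ¬ (a ≤ arrival ξ (k + 1) ∧ arrival ξ (k + 1) < b)} with hN
  have hNm : MeasurableSet N := by
    rw [hN, Set.ofPred_forall]
    refine MeasurableSet.iInter fun k => MeasurableSet.compl ?_
    exact (measurableSet_le measurable_const (measurable_arrival _)).inter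
      (measurableSet_lt (measurable_arrival _) measurable_const)
  set M : Set (ℕ → ℝ) := {ξ | b ≤ ξ 0} with hM
  have hMm : MeasurableSet M := measurableSet_le measurable_const (by fun_prop)
  have hae : (fun ξ : ℕ → ℝ => (if ∀ k, ¬ (a ≤ arrival ξ (k + 1) ∧ arrival ξ (k + 1) < b) then
        (if ∃ k, arrival ξ (k + 1) < a then c else 1) else 0)) =ᵐ[waitingLaw]
      fun ξ => N.indicator (fun _ => c) ξ + M.indicator (fun _ => 1 - c) ξ := by
    filter_upwards [ae_le_waiting_iff (b := b)] with ξ hb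
    by_cases hξ : ξ ∈ N
    · rw [if_pos (show ∀ k, ¬ (a ≤ arrival ξ (k + 1) ∧ arrival ξ (k + 1) < b) from hξ), Set.indicator_of_mem hξ]
      by_cases h : ξ ∈ M
      · rw [Set.indicator_of_mem h, if_neg]
        · ring
        · rintro ⟨k, hk⟩
          linarith [hb.1 h k]
      · rw [Set.indicator_of_notMem h, if_pos, add_zero]
        by_contra hcon
        push Not at hcon
        refine h (hb.2 fun k => ?_)
        by_contra hlt
        exact hξ k ⟨hcon k, not_le.1 hlt⟩
    · rw [if_neg (show ¬ ∀ k, ¬ (a ≤ arrival ξ (k + 1) ∧ arrival ξ (k + 1) < b) from hξ), Set.indicator_of_notMem hξ, Set.indicator_of_notMem, add_zero]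
      intro h
      exact hξ fun k hk => absurd (hb.1 h k) (not_le.2 hk.2)
  rw [integral_congr_ae hae, integral_add ((integrable_const _).indicator hNm)
    ((integrable_const _).indicator hMm), integral_indicator_const _ hNm,
    integral_indicator_const _ hMm, measureReal_def, measureReal_def,
    waitingLaw_noArrival ha hab, waitingLaw_waiting_ge (ha.trans hab),
    ENNReal.toReal_ofReal (Real.exp_nonneg _), ENNReal.toReal_ofReal (Real.exp_nonneg _)]
  have : Real.exp (-b) = Real.exp (-(b - a)) * Real.exp (-a) := by
    rw [← Real.exp_add]; congr 1; ring
  rw [this]; simp only [smul_eq_mul]; ring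

/-! ### The clocks of the different objects -/

theorem measurePreserving_curry_clockLaw (n : ℕ) :
    MeasurePreserving (MeasurableEquiv.curry (Fin n) ℕ ℝ) (clockLaw n)
      (Measure.pi (fun _ : Fin n => waitingLaw)) := by
  refine ⟨MeasurableEquiv.measurable _, ?_⟩
  rw [clockLaw, Measure.infinitePi_map_curry (fun (_ : Fin n) (_ : ℕ) => expMeasure 1),
    Measure.infinitePi_eq_pi]
  rfl

instance (n : ℕ) : IsProbabilityMeasure (clockLaw n) := by unfold clockLaw; infer_instance

theorem ae_clockLaw_of_ae_waitingLaw {n : ℕ} {Q : Fin n → (ℕ → ℝ) → Prop}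
    (h : ∀ i, ∀ᵐ η ∂waitingLaw, Q i η) :
    ∀ᵐ ξ ∂(clockLaw n), ∀ i, Q i (fun k => ξ (i, k)) := by
  rw [ae_all_iff]
  intro i
  have h1 := ((measurePreserving_eval (fun _ : Fin n => waitingLaw) i).comp
    (measurePreserving_curry_clockLaw n)).quasiMeasurePreserving.ae (h i)
  exact h1

theorem requestTime_eq {n : ℕ} (p : Fin n → ℝ) (ξ : Fin n × ℕ → ℝ) (i : Fin n) (k : ℕ) :
    requestTime p ξ (i, k) = arrival (fun l => ξ (i, l)) (k + 1) / p i := rfl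

theorem requestTime_mono {n : ℕ} {p : Fin n → ℝ} {ξ : Fin n × ℕ → ℝ} {i : Fin n} (hp : 0 < p i)
    (h0 : ∀ k, 0 ≤ ξ (i, k)) {k k' : ℕ} (hk : k ≤ k') :
    requestTime p ξ (i, k) ≤ requestTime p ξ (i, k') := by
  rw [requestTime_eq, requestTime_eq]
  exact div_le_div_of_nonneg_right (arrival_mono (ξ := fun l => ξ (i, l)) h0 (by omega)) hp.le

/-- Each clock passes `t * p i` after finitely many steps and is monotone, so the request numbers
are bounded uniformly over the finitely many objects. -/
theorem ae_finite_requestsBefore {n : ℕ} (p : Fin n → ℝ) (t : ℝ) :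
    ∀ᵐ ξ ∂(clockLaw n), (requestsBefore p ξ t).Finite := by
  filter_upwards [ae_clockLaw_of_ae_waitingLaw (n := n) (fun _ => ae_waitingLaw_nonneg),
    ae_clockLaw_of_ae_waitingLaw (n := n) (fun i => ae_exists_le_arrival (t * p i))] with ξ h0 hex
  choose K hK using hex
  refine ((Set.finite_univ.prod (Set.finite_Iio (Finset.univ.sup K)))).subset ?_
  rintro ⟨i, k⟩ ⟨hp, hlt⟩
  refine ⟨trivial, ?_⟩
  simp only at hp hlt
  rw [requestTime_eq, div_lt_iff₀ hp] at hlt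
  have : k < K i := by
    by_contra hcon
    have := arrival_mono (h0 i) (show K i ≤ k + 1 by omega)
    linarith [hK i]
  exact this.trans_le (Finset.le_sup (Finset.mem_univ i))

theorem waitingLaw_arrival_eq (k : ℕ) (c : ℝ) :
    waitingLaw {ξ | arrival ξ (k + 1) = c} = 0 := by
  have hms : MeasurableSet {q : ℝ × ℝ | q.1 + q.2 = c} :=
    measurableSet_eq_fun (by fun_prop) measurable_const
  have : {ξ : ℕ → ℝ | arrival ξ (k + 1) = c}
      = (fun ξ => (arrival ξ k, ξ k)) ⁻¹' {q : ℝ × ℝ | q.1 + q.2 = c} := by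
    ext ξ; simp [arrival, Finset.sum_range_succ]
  rw [this, ← Measure.map_apply ((measurable_arrival k).prodMk (measurable_pi_apply k)) hms,
    map_arrival_prod, Measure.measure_prod_null hms]
  refine Eventually.of_forall fun s => ?_
  have : Prod.mk s ⁻¹' {q : ℝ × ℝ | q.1 + q.2 = c} = {c - s} := by
    ext x; simp [eq_sub_iff_add_eq']
  simp [this]

/-- By independence one may freeze the clock of `j`; a tie then forces an arrival of `i` to take a
prescribed value, which has probability zero. -/
theorem ae_requestTime_ne {n : ℕ} (p : Fin n → ℝ) :
    ∀ᵐ ξ ∂(clockLaw n), ∀ i j : Fin n, i ≠ j → 0 < p i → ∀ k l,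
      requestTime p ξ (i, k) ≠ requestTime p ξ (j, l) := by
  simp only [ae_all_iff, eventually_imp_distrib_left]
  intro i j hij hp k l
  have hI : IndepFun (fun η : Fin n → ℕ → ℝ => η i) (fun η => η j)
      (Measure.pi (fun _ : Fin n => waitingLaw)) :=
    (iIndepFun_pi (μ := fun _ : Fin n => waitingLaw) (X := fun _ x => x)
      (fun _ => aemeasurable_id)).indepFun hij
  have hmap := (indepFun_iff_map_prod_eq_prod_map_map (measurable_pi_apply i).aemeasurable
    (measurable_pi_apply j).aemeasurable).1 hI
  rw [(measurePreserving_eval (fun _ : Fin n => waitingLaw) i).map_eq,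
    (measurePreserving_eval (fun _ : Fin n => waitingLaw) j).map_eq] at hmap
  have hms : MeasurableSet {q : (ℕ → ℝ) × (ℕ → ℝ) |
      arrival q.1 (k + 1) / p i = arrival q.2 (l + 1) / p j} :=
    measurableSet_eq_fun (((measurable_arrival _).comp measurable_fst).div_const _)
      (((measurable_arrival _).comp measurable_snd).div_const _)
  have hz : (waitingLaw.prod waitingLaw) {q : (ℕ → ℝ) × (ℕ → ℝ) |
      arrival q.1 (k + 1) / p i = arrival q.2 (l + 1) / p j} = 0 := by
    -- The swap puts the clock of `i` in the inner fibre: only `p i` is known to be nonzero and can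
    -- be cleared from the equation.
    rw [← Measure.prod_swap, Measure.map_apply measurable_swap hms,
      Measure.measure_prod_null (measurable_swap hms)]
    refine Eventually.of_forall fun y => ?_
    refine measure_mono_null ?_ (waitingLaw_arrival_eq k (arrival y (l + 1) / p j * p i))
    intro x hx
    have hx' : arrival x (k + 1) / p i = arrival y (l + 1) / p j := hx
    exact (div_eq_iff hp.ne').1 hx'
  rw [← hmap, Measure.map_apply
    ((measurable_pi_apply i).prodMk (measurable_pi_apply j)) hms] at hz
  have h2 : ∀ᵐ η ∂(Measure.pi (fun _ : Fin n => waitingLaw)),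
      arrival (η i) (k + 1) / p i ≠ arrival (η j) (l + 1) / p j := by
    rw [ae_iff]; simpa using hz
  exact (measurePreserving_curry_clockLaw n).quasiMeasurePreserving.ae h2

/-! ### The two expressions of the out-of-equilibrium cost -/

section transforms
variable {n : ℕ} {p : Fin n → ℝ} {ξ : Fin n × ℕ → ℝ} {t : ℝ}

theorem ae_nextRequest_unique (p : Fin n → ℝ) (t : ℝ) :
    ∀ᵐ ξ ∂(clockLaw n), ∀ i j, IsNextRequest p ξ t i → IsNextRequest p ξ t j → i = j := by
  filter_upwards [ae_requestTime_ne p] with ξ h i j ⟨k, hpi, hti, hi⟩ ⟨k', hpj, htj, hj⟩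
  by_contra hij
  exact h i j hij hpi k k' (le_antisymm (hi (j, k') hpj htj) (hj (i, k) hpi hti))

/-- Uniqueness of the next request leaves at most one nonzero term. Summing over candidates lets
each object be treated separately, with an exponent that splits over `j`. -/
theorem indicator_out_eq_sum
    (hfin : (requestsBefore p ξ t).Finite)
    (huniq : ∀ i j, IsNextRequest p ξ t i → IsNextRequest p ξ t j → i = j) (l : ℝ) :
    open Classical in
    Set.indicator {ξ | 0 < searchCostOut p t ξ}
      (fun ξ => Real.exp (-(l * (searchCostOut p t ξ : ℝ)))) ξ
    = ∑ i, if IsNextRequest p ξ t i ∧ i ∉ requestedSet p ξ t then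
        Real.exp (-(l * (Finset.univ.filter
          (fun j => j ∈ requestedSet p ξ t ∨ j ≤ i)).card)) else 0 := by
  classical
  by_cases hex : ∃ i, IsNextRequest p ξ t i ∧ i ∉ requestedSet p ξ t
  · obtain ⟨i, hi, hiR⟩ := hex
    have hs : searchCostOut p t ξ = position p ξ t i := by
      rw [searchCostOut, if_pos ⟨i, hi, hiR⟩, searchCost_eq_position hi fun j hj => huniq j i hj hi]
    have hpos : 0 < searchCostOut p t ξ := by rw [hs]; exact Nat.succ_pos _
    rw [Set.indicator_of_mem (show ξ ∈ {ξ | 0 < searchCostOut p t ξ} from hpos),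
      Finset.sum_eq_single i, if_pos ⟨hi, hiR⟩, hs, position_of_notMem hfin hiR]
    · intro j _ hj
      rw [if_neg fun h => hj (huniq j i h.1 hi)]
    · simp
  · have hs : searchCostOut p t ξ = 0 := by rw [searchCostOut, if_neg hex]
    rw [Set.indicator_of_notMem (show ξ ∉ {ξ | 0 < searchCostOut p t ξ} by simp [hs]),
      Finset.sum_eq_zero]
    intro i _
    rw [if_neg fun h => hex ⟨i, h⟩]

/-- Requested objects occupy positions at most `|R_t|` and unrequested ones come strictly later, so
exceeding `|R_t|` detects an unrequested target. If nothing is requested next, both costs vanish. -/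
theorem indicator_out_eq_above
    (hfin : (requestsBefore p ξ t).Finite)
    (huniq : ∀ i j, IsNextRequest p ξ t i → IsNextRequest p ξ t j → i = j) (l : ℝ) :
    Set.indicator {ξ | 0 < searchCostOut p t ξ}
      (fun ξ => Real.exp (-(l * (searchCostOut p t ξ : ℝ)))) ξ
    = Set.indicator {ξ | (requestedSet p ξ t).ncard < searchCost p t ξ}
      (fun ξ => Real.exp (-(l * (searchCost p t ξ : ℝ)))) ξ := by
  classical
  by_cases hnext : ∃ i, IsNextRequest p ξ t i
  · obtain ⟨i, hi⟩ := hnext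
    have hs := searchCost_eq_position hi fun j hj => huniq j i hj hi
    by_cases hiR : i ∈ requestedSet p ξ t
    · have hs0 : searchCostOut p t ξ = 0 := by
        rw [searchCostOut, if_neg]
        rintro ⟨j, hj, hjR⟩
        exact hjR (huniq j i hj hi ▸ hiR)
      rw [Set.indicator_of_notMem (show ξ ∉ {ξ | 0 < searchCostOut p t ξ} by simp [hs0]),
        Set.indicator_of_notMem]
      intro h
      have h1 : (requestedSet p ξ t).ncard < searchCost p t ξ := h
      have := position_le_of_mem hfin hiR
      omega
    · have hs1 : searchCostOut p t ξ = searchCost p t ξ := by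
        rw [searchCostOut, if_pos ⟨i, hi, hiR⟩]
      have h1 := ncard_lt_position hfin hiR
      rw [← hs] at h1
      rw [Set.indicator_of_mem (show ξ ∈ {ξ | 0 < searchCostOut p t ξ} from by
          show 0 < _; omega),
        Set.indicator_of_mem (show ξ ∈ {ξ | (requestedSet p ξ t).ncard < searchCost p t ξ}
          from h1), hs1]
  · have hs : searchCost p t ξ = 0 := by
      rw [searchCost, Finset.sum_eq_zero]
      intro i _
      rw [if_neg fun h => hnext ⟨i, h⟩]
    have hs0 : searchCostOut p t ξ = 0 := by
      rw [searchCostOut, hs]; simp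
    rw [Set.indicator_of_notMem (show ξ ∉ {ξ | 0 < searchCostOut p t ξ} by simp [hs0]),
      Set.indicator_of_notMem
        (show ξ ∉ {ξ | (requestedSet p ξ t).ncard < searchCost p t ξ} by simp [hs])]

end transforms

theorem outTransform_eq_aboveTransform {Ω : Type*} [MeasurableSpace Ω] (μΩ : Measure Ω) {n : ℕ}
    (w : Ω → Fin n → ℝ≥0) (t l : ℝ) :
    outTransform μΩ w t l = aboveTransform μΩ w t l := by
  refine integral_congr_ae (Eventually.of_forall fun ω => integral_congr_ae ?_)
  filter_upwards [ae_finite_requestsBefore (popularity (w ω)) t,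
    ae_nextRequest_unique (popularity (w ω)) t] with ξ hfin huniq
  exact indicator_out_eq_above hfin huniq l

/-! ### The explicit formula for fixed popularities -/

open Classical in
/-- `c` or `1`, according to whether there is an arrival before `a` or not, if there is no arrival
in `[a, b)`, and `0` otherwise. -/
def survivalWeight (a b c : ℝ) (η : ℕ → ℝ) : ℝ :=
  if ∀ k, ¬ (a ≤ arrival η (k + 1) ∧ arrival η (k + 1) < b) then
    (if ∃ k, arrival η (k + 1) < a then c else 1) else 0

theorem measurable_survivalWeight {X : Type*} [MeasurableSpace X] (a c : ℝ) {f : X → ℝ}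
    {g : X → ℕ → ℝ} (hf : Measurable f) (hg : Measurable g) :
    Measurable (fun x => survivalWeight a (f x) c (g x)) := by
  have hm : ∀ k, Measurable fun x => arrival (g x) (k + 1) :=
    fun k => (measurable_arrival _).comp hg
  refine Measurable.ite ?_ (Measurable.ite ?_ measurable_const measurable_const) measurable_const
  · rw [Set.ofPred_forall]
    exact MeasurableSet.iInter fun k => MeasurableSet.compl
      ((measurableSet_le measurable_const (hm k)).inter (measurableSet_lt (hm k) hf))
  · rw [Set.ofPred_exists]
    exact MeasurableSet.iUnion fun k => measurableSet_lt (hm k) measurable_const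

theorem survivalWeight_mem {a b c : ℝ} (hc : c ∈ Set.Icc (0 : ℝ) 1) (η : ℕ → ℝ) :
    survivalWeight a b c η ∈ Set.Icc (0 : ℝ) 1 := by
  unfold survivalWeight
  split_ifs
  · exact hc
  · simp
  · simp

/-- Meant for `κ = (1 - p i) / p i`, the total rate of the other objects relative to that of `i`;
then `1 / (1 + κ)` is `p i`. -/
theorem integral_expMeasure_tail {a κ : ℝ} (ha : 0 ≤ a) (hκ : 0 ≤ κ) :
    ∫ y, (if a ≤ y then Real.exp (-(κ * (y - a))) else 0) ∂(expMeasure 1)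
      = Real.exp (-a) / (1 + κ) := by
  have h1 : expMeasure 1 = volume.withDensity (exponentialPDF 1) := rfl
  have hm : Measurable (exponentialPDF 1) :=
    (measurable_exponentialPDFReal 1).ennreal_ofReal
  rw [h1, integral_withDensity_eq_integral_toReal_smul hm
    (Eventually.of_forall fun x => by simp [exponentialPDF])]
  have h2 : ∀ y, (exponentialPDF 1 y).toReal •
      (if a ≤ y then Real.exp (-(κ * (y - a))) else 0)
      = Set.indicator (Set.Ici a) (fun y => Real.exp (κ * a) * Real.exp (-(1 + κ) * y)) y := by
    intro y
    by_cases hy : a ≤ y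
    · rw [Set.indicator_of_mem (show y ∈ Set.Ici a from hy), if_pos hy,
        exponentialPDF_of_nonneg (ha.trans hy), ENNReal.toReal_ofReal (by positivity),
        smul_eq_mul, one_mul, one_mul, ← Real.exp_add, ← Real.exp_add]
      congr 1; ring
    · rw [Set.indicator_of_notMem (show y ∉ Set.Ici a from hy), if_neg hy, smul_zero]
  simp_rw [h2]
  rw [integral_indicator measurableSet_Ici, integral_const_mul, integral_Ici_eq_integral_Ioi,
    integral_exp_mul_Ioi (by linarith), neg_mul, neg_div_neg_eq, mul_div_assoc', ← Real.exp_add]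
  congr 2; ring

section formula
variable {m : ℕ} (p : Fin (m + 1) → ℝ) (t l : ℝ) (i : Fin (m + 1))

/-- The indicator of the event that object `i` is not requested before `t` and is requested next,
times a product over the other objects. -/
def nextWeight (q : (ℕ → ℝ) × (Fin m → ℕ → ℝ)) : ℝ :=
  (if p i * t ≤ q.1 0 then 1 else 0) * ∏ j : Fin m,
    survivalWeight (p (i.succAbove j) * t) (p (i.succAbove j) * (q.1 0 / p i))
      (if i.succAbove j ≤ i then 1 else Real.exp (-l)) (q.2 j)

variable {p t l i}

theorem measurable_nextWeight : Measurable (nextWeight p t l i) := by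
  refine Measurable.mul (Measurable.ite (measurableSet_le measurable_const (by fun_prop))
    measurable_const measurable_const) (Finset.measurable_prod _ fun j _ => ?_)
  exact measurable_survivalWeight _ _ (by fun_prop) (by fun_prop)

theorem nextWeight_mem (hl : 0 ≤ l) (q : (ℕ → ℝ) × (Fin m → ℕ → ℝ)) :
    nextWeight p t l i q ∈ Set.Icc (0 : ℝ) 1 := by
  have h : ∀ j : Fin m, survivalWeight (p (i.succAbove j) * t) (p (i.succAbove j) * (q.1 0 / p i))
      (if i.succAbove j ≤ i then 1 else Real.exp (-l)) (q.2 j) ∈ Set.Icc (0 : ℝ) 1 := by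
    intro j
    refine survivalWeight_mem ?_ _
    split_ifs
    · simp
    · exact ⟨Real.exp_nonneg _, Real.exp_le_one_iff.2 (by linarith)⟩
  have h1 : (if p i * t ≤ q.1 0 then (1 : ℝ) else 0) ∈ Set.Icc (0 : ℝ) 1 := by
    split_ifs <;> simp
  unfold nextWeight
  exact ⟨mul_nonneg h1.1 (Finset.prod_nonneg fun j _ => (h j).1),
    mul_le_one₀ h1.2 (Finset.prod_nonneg fun j _ => (h j).1)
      (Finset.prod_le_one (fun j _ => (h j).1) fun j _ => (h j).2)⟩

theorem integrable_nextWeight (hl : 0 ≤ l) :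
    Integrable (nextWeight p t l i)
      (waitingLaw.prod (Measure.pi fun _ : Fin m => waitingLaw)) := by
  refine Integrable.of_bound measurable_nextWeight.aestronglyMeasurable 1
    (Eventually.of_forall fun q => ?_)
  have := nextWeight_mem (p := p) (t := t) (i := i) hl q
  rw [Real.norm_eq_abs, abs_of_nonneg this.1]
  exact this.2

/-- Fix the first request instant `T = x / p i` of object `i`. The other clocks are independent, and
their empty windows from `t` to `T` contribute `exp (-(1 - p i) * (T - t))`; the remaining product
is free of `T`, so only one exponential integral is left. -/
theorem integral_nextWeight (hp : ∀ j, 0 ≤ p j) (hsum : ∑ j, p j = 1) (hi : 0 < p i)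
    (ht : 0 ≤ t) (hl : 0 ≤ l) :
    ∫ q, nextWeight p t l i q ∂(waitingLaw.prod (Measure.pi fun _ : Fin m => waitingLaw))
      = p i * Real.exp (-(p i * t)) * ∏ j : Fin m,
        ((if i.succAbove j ≤ i then 1 else Real.exp (-l))
          + (1 - (if i.succAbove j ≤ i then 1 else Real.exp (-l)))
            * Real.exp (-(p (i.succAbove j) * t))) := by
  set c : Fin m → ℝ := fun j => if i.succAbove j ≤ i then 1 else Real.exp (-l) with hc
  set r : Fin m → ℝ := fun j => p (i.succAbove j) with hr
  have hsr : ∑ j, r j = 1 - p i := by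
    rw [← hsum, Fin.sum_univ_succAbove _ i]; ring
  rw [integral_prod _ (integrable_nextWeight hl)]
  have h1 : ∀ x : ℕ → ℝ, ∫ y, nextWeight p t l i (x, y) ∂(Measure.pi fun _ : Fin m => waitingLaw)
      = (if p i * t ≤ x 0 then Real.exp (-((1 - p i) / p i * (x 0 - p i * t))) else 0)
        * ∏ j, (c j + (1 - c j) * Real.exp (-(r j * t))) := by
    intro x
    refine (integral_const_mul (if p i * t ≤ x 0 then (1 : ℝ) else 0) _).trans ?_
    rw [integral_fintype_prod_eq_prod (μ := fun _ => waitingLaw)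
      (f := fun j y => survivalWeight (r j * t) (r j * (x 0 / p i)) (c j) y)]
    by_cases hx : p i * t ≤ x 0
    · have htx : t ≤ x 0 / p i := by rwa [le_div_iff₀ hi, mul_comm]
      rw [if_pos hx, if_pos hx, one_mul]
      have h2 : ∀ j, ∫ y, survivalWeight (r j * t) (r j * (x 0 / p i)) (c j) y ∂waitingLaw
          = Real.exp (-(r j * (x 0 / p i) - r j * t)) * (c j + (1 - c j) * Real.exp (-(r j * t))) :=
        fun j => integral_noArrival (mul_nonneg (hp _) ht) (mul_le_mul_of_nonneg_left htx (hp _)) _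
      simp_rw [h2]
      rw [Finset.prod_mul_distrib, ← Real.exp_sum]
      congr 2
      rw [Finset.sum_neg_distrib, Finset.sum_sub_distrib, ← Finset.sum_mul, ← Finset.sum_mul, hsr]
      field_simp
    · rw [if_neg hx, if_neg hx, zero_mul, zero_mul]
  simp_rw [h1]
  rw [integral_mul_const]
  congr 1
  have hm : Measurable fun y : ℝ =>
      if p i * t ≤ y then Real.exp (-((1 - p i) / p i * (y - p i * t))) else 0 :=
    Measurable.ite (measurableSet_le measurable_const measurable_id) (by fun_prop)
      measurable_const
  have hmap := Measure.infinitePi_map_eval (fun _ : ℕ => expMeasure 1) 0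
  have h3 := integral_map (μ := waitingLaw) (φ := fun x : ℕ → ℝ => x 0)
    (measurable_pi_apply 0).aemeasurable (hm.aestronglyMeasurable)
  have hple : p i ≤ 1 := by rw [← hsum]; exact Finset.single_le_sum (fun j _ => hp j) (Finset.mem_univ i)
  rw [← h3]
  unfold waitingLaw
  rw [hmap, integral_expMeasure_tail (mul_nonneg hi.le ht)
    (div_nonneg (by linarith) hi.le)]
  field_simp
  ring

open Classical in
-- The discount `exp (-l)` is certain for `j ≤ i` and is pulled out as a constant; for `j > i` it is
-- paid only if `j` was requested before `t`, which is what `survivalWeight` records.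
theorem next_term_eq (hp : ∀ j, 0 ≤ p j) (hi : 0 < p i) {ξ : Fin (m + 1) × ℕ → ℝ}
    (h0 : ∀ j k, 0 ≤ ξ (j, k)) :
    (if IsNextRequest p ξ t i ∧ i ∉ requestedSet p ξ t then
        Real.exp (-(l * (Finset.univ.filter
          (fun j => j ∈ requestedSet p ξ t ∨ j ≤ i)).card)) else 0)
      = (Real.exp (-l) * ∏ j : Fin m, if i.succAbove j ≤ i then Real.exp (-l) else 1)
        * nextWeight p t l i (fun k => ξ (i, k), fun j k => ξ (i.succAbove j, k)) := by
  have hT0 : requestTime p ξ (i, 0) = ξ (i, 0) / p i := by simp [requestTime]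
  have harr : ∀ j, 0 < p j → ∀ k s, (arrival (fun l => ξ (j, l)) (k + 1) < p j * s
      ↔ requestTime p ξ (j, k) < s) := by
    intro j hj k s
    rw [requestTime_eq, div_lt_iff₀ hj, mul_comm]
  have hnn : ∀ j k, 0 ≤ arrival (fun l => ξ (j, l)) (k + 1) :=
    fun j k => Finset.sum_nonneg fun l _ => h0 j l
  by_cases hnext : IsNextRequest p ξ t i ∧ i ∉ requestedSet p ξ t
  · rw [if_pos hnext]
    obtain ⟨⟨k₀, -, htk, hmin⟩, hiR⟩ := hnext
    have hi0 : t ≤ ξ (i, 0) / p i := by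
      by_contra hcon
      exact hiR ⟨0, hi, by rw [hT0]; exact not_le.1 hcon⟩
    have hcard : Real.exp (-(l * (Finset.univ.filter
          (fun j => j ∈ requestedSet p ξ t ∨ j ≤ i)).card))
        = ∏ j, if j ∈ requestedSet p ξ t ∨ j ≤ i then Real.exp (-l) else 1 := by
      rw [Finset.prod_ite, Finset.prod_const, Finset.prod_const_one, mul_one, ← Real.exp_nat_mul]
      congr 1; ring
    rw [hcard, Fin.prod_univ_succAbove _ i, if_pos (Or.inr le_rfl), nextWeight,
      if_pos (by rwa [le_div_iff₀ hi, mul_comm] at hi0), one_mul, mul_assoc,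
      ← Finset.prod_mul_distrib]
    congr 1
    refine Finset.prod_congr rfl fun j _ => ?_
    set j' := i.succAbove j
    have hno : ∀ k, ¬ (p j' * t ≤ arrival (fun l => ξ (j', l)) (k + 1) ∧
        arrival (fun l => ξ (j', l)) (k + 1) < p j' * (ξ (i, 0) / p i)) := by
      rintro k ⟨hk1, hk2⟩
      -- For an object of rate zero the rescaled window is `[0, 0)`, whereas the other objects are
      -- compared through actual request times.
      rcases (hp j').eq_or_lt with hz | hj
      · rw [← hz, zero_mul] at hk2
        linarith [hnn j' k]
      · have h1 : t ≤ requestTime p ξ (j', k) := by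
          rw [requestTime_eq, le_div_iff₀ hj, mul_comm]; exact hk1
        have h2 := hmin (j', k) hj h1
        have h3 := requestTime_mono (p := p) hi (h0 i) (Nat.zero_le k₀)
        rw [harr j' hj, ← hT0] at hk2
        linarith
    have hR : (∃ k, arrival (fun l => ξ (j', l)) (k + 1) < p j' * t) ↔ j' ∈ requestedSet p ξ t := by
      refine exists_congr fun k => ?_
      rcases (hp j').eq_or_lt with hz | hj
      · rw [← hz, zero_mul]
        exact ⟨fun h => absurd (hnn j' k) (not_le.2 h), fun h => absurd h.1 (by simp [← hz])⟩
      · rw [harr j' hj]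
        exact ⟨fun h => ⟨hj, h⟩, fun h => h.2⟩
    rw [survivalWeight, if_pos hno]
    by_cases h1 : j' ∈ requestedSet p ξ t
    · rw [if_pos (hR.2 h1), if_pos (Or.inl h1)]
      by_cases h2 : j' ≤ i <;> simp [h2]
    · rw [if_neg fun h => h1 (hR.1 h)]
      by_cases h2 : j' ≤ i <;> simp [h1, h2]
  · rw [if_neg hnext, eq_comm]
    refine mul_eq_zero_of_right _ ?_
    rw [nextWeight]
    by_cases hi0 : p i * t ≤ ξ (i, 0)
    · refine mul_eq_zero_of_right _ ?_
      have hti : t ≤ requestTime p ξ (i, 0) := by rw [hT0, le_div_iff₀ hi, mul_comm]; exact hi0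
      have hiR : i ∉ requestedSet p ξ t := by
        rintro ⟨k, -, hk⟩
        have h3 := requestTime_mono (p := p) hi (h0 i) (Nat.zero_le k)
        have hk' : requestTime p ξ (i, k) < t := hk
        linarith
      have hnn' : ¬ IsNextRequest p ξ t i := fun h => hnext ⟨h, hiR⟩
      -- If `i` is unrequested but not next, some request falls between `t` and its first request.
      -- It belongs to another object, whose survival factor is then zero.
      have : ∃ b : Fin (m + 1) × ℕ, 0 < p b.1 ∧ t ≤ requestTime p ξ b ∧
          requestTime p ξ b < requestTime p ξ (i, 0) := by
        by_contra hcon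
        push Not at hcon
        exact hnn' ⟨0, hi, hti, hcon⟩
      obtain ⟨⟨j', k⟩, hj, hb1, hb2⟩ := this
      simp only at hj
      have hne : j' ≠ i := by
        rintro rfl
        exact absurd (requestTime_mono (p := p) hi (h0 j') (Nat.zero_le k)) (not_le.2 hb2)
      obtain ⟨j, rfl⟩ := Fin.exists_succAbove_eq hne
      refine Finset.prod_eq_zero (Finset.mem_univ j) ?_
      rw [survivalWeight, if_neg]
      intro h
      refine h k ⟨?_, ?_⟩
      · rw [requestTime_eq, le_div_iff₀ hj, mul_comm] at hb1
        exact hb1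
      · rw [harr _ hj, ← hT0]
        exact hb2
    · simp [hi0]

end formula

/-- The transform of the out-of-equilibrium search-cost for fixed popularities. -/
def outFormula {n : ℕ} (p : Fin n → ℝ) (t l : ℝ) : ℝ :=
  ∑ i, p i * Real.exp (-(p i * t)) *
    ∏ j, if j ≤ i then Real.exp (-l) else Real.exp (-l) + (1 - Real.exp (-l)) * Real.exp (-(p j * t))

open Classical in
theorem integral_next_term {n : ℕ} {p : Fin n → ℝ} (hp : ∀ j, 0 ≤ p j)
    (hsum : ∑ j, p j = 1 ∨ ∀ j, p j = 0) {t l : ℝ} (ht : 0 ≤ t) (hl : 0 ≤ l) (i : Fin n) :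
    Integrable (fun ξ => if IsNextRequest p ξ t i ∧ i ∉ requestedSet p ξ t then
        Real.exp (-(l * (Finset.univ.filter
          (fun j => j ∈ requestedSet p ξ t ∨ j ≤ i)).card)) else 0) (clockLaw n) ∧
    ∫ ξ, (if IsNextRequest p ξ t i ∧ i ∉ requestedSet p ξ t then
        Real.exp (-(l * (Finset.univ.filter
          (fun j => j ∈ requestedSet p ξ t ∨ j ≤ i)).card)) else 0) ∂(clockLaw n)
      = p i * Real.exp (-(p i * t)) * ∏ j, if j ≤ i then Real.exp (-l)
          else Real.exp (-l) + (1 - Real.exp (-l)) * Real.exp (-(p j * t)) := by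
  -- Both sides vanish when `p i = 0`, which also disposes of identically zero popularities.
  rcases (hp i).eq_or_lt with hz | hi
  · have : ∀ ξ, ¬ (IsNextRequest p ξ t i ∧ i ∉ requestedSet p ξ t) := by
      rintro ξ ⟨⟨k, hk, -⟩, -⟩
      exact hk.ne hz
    simp [this, ← hz]
  replace hsum : ∑ j, p j = 1 := hsum.resolve_right fun h => hi.ne' (h i)
  obtain ⟨m, rfl⟩ : ∃ m, n = m + 1 := ⟨n - 1, by have := i.pos; omega⟩
  set C := Real.exp (-l) * ∏ j : Fin m, if i.succAbove j ≤ i then Real.exp (-l) else 1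
  -- This separates the clock of `i` from the family of the other clocks, independent of it.
  have hmp := (measurePreserving_piFinSuccAbove (fun _ : Fin (m + 1) => waitingLaw) i).comp
    (measurePreserving_curry_clockLaw (m + 1))
  have hae : (fun ξ => if IsNextRequest p ξ t i ∧ i ∉ requestedSet p ξ t then
        Real.exp (-(l * (Finset.univ.filter
          (fun j => j ∈ requestedSet p ξ t ∨ j ≤ i)).card)) else 0) =ᵐ[clockLaw (m + 1)]
      fun ξ => C * nextWeight p t l i ((MeasurableEquiv.piFinSuccAbove (fun _ => ℕ → ℝ) i ∘
        MeasurableEquiv.curry (Fin (m + 1)) ℕ ℝ) ξ) := by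
    filter_upwards [ae_clockLaw_of_ae_waitingLaw (n := m + 1) (fun _ => ae_waitingLaw_nonneg)]
      with ξ h0
    rw [next_term_eq hp hi h0]
    rfl
  constructor
  · exact ((hmp.integrable_comp_of_integrable (integrable_nextWeight hl)).const_mul C).congr
      hae.symm
  · rw [integral_congr_ae hae, integral_const_mul, ← integral_map hmp.measurable.aemeasurable
      measurable_nextWeight.aestronglyMeasurable, hmp.map_eq,
      integral_nextWeight hp hsum hi ht hl, Fin.prod_univ_succAbove _ i, if_pos le_rfl]
    have : ∀ j : Fin m, (if i.succAbove j ≤ i then Real.exp (-l)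
        else Real.exp (-l) + (1 - Real.exp (-l)) * Real.exp (-(p (i.succAbove j) * t)))
        = (if i.succAbove j ≤ i then Real.exp (-l) else 1) *
        ((if i.succAbove j ≤ i then 1 else Real.exp (-l))
          + (1 - (if i.succAbove j ≤ i then 1 else Real.exp (-l)))
            * Real.exp (-(p (i.succAbove j) * t))) := by
      intro j; split_ifs <;> ring
    simp_rw [this]
    rw [Finset.prod_mul_distrib]
    ring

theorem integral_out_eq_outFormula {n : ℕ} {p : Fin n → ℝ} (hp : ∀ j, 0 ≤ p j)
    (hsum : ∑ j, p j = 1 ∨ ∀ j, p j = 0) {t l : ℝ} (ht : 0 ≤ t) (hl : 0 ≤ l) :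
    ∫ ξ, Set.indicator {ξ | 0 < searchCostOut p t ξ}
      (fun ξ => Real.exp (-(l * (searchCostOut p t ξ : ℝ)))) ξ ∂(clockLaw n)
      = outFormula p t l := by
  classical
  have hae := (ae_finite_requestsBefore p t).and (ae_nextRequest_unique p t)
  rw [integral_congr_ae (hae.mono fun ξ h => indicator_out_eq_sum h.1 h.2 l),
    integral_finsetSum _ fun i _ => (integral_next_term hp hsum ht hl i).1]
  exact Finset.sum_congr rfl fun i _ => (integral_next_term hp hsum ht hl i).2

theorem popularity_nonneg {n : ℕ} (w : Fin n → ℝ≥0) (j : Fin n) : 0 ≤ popularity w j := by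
  unfold popularity; positivity

theorem sum_popularity {n : ℕ} {w : Fin n → ℝ≥0} (h : ∑ j, (w j : ℝ) ≠ 0) :
    ∑ j, popularity w j = 1 := by
  unfold popularity
  rw [← Finset.sum_div, div_self h]

theorem outTransform_eq {Ω : Type*} [MeasurableSpace Ω] (μΩ : Measure Ω) {n : ℕ}
    (w : Ω → Fin n → ℝ≥0) {t l : ℝ} (ht : 0 ≤ t) (hl : 0 ≤ l) :
    outTransform μΩ w t l = ∫ ω, outFormula (popularity (w ω)) t l ∂μΩ := by
  refine integral_congr_ae (Eventually.of_forall fun ω =>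
    integral_out_eq_outFormula (popularity_nonneg _) ?_ ht hl)
  by_cases h : ∑ j, (w ω j : ℝ) = 0
  · exact Or.inr fun j => by simp [popularity, h]
  · exact Or.inl (sum_popularity h)

/-! ### Empirical measures -/

theorem integral_empirical (n : ℕ+) (x : Fin n → ℝ≥0) (f : ℝ≥0 → ℝ) :
    ∫ s, f s ∂(empirical n x : Measure ℝ≥0) = (∑ i, f (x i)) / ((n : ℕ) : ℝ) := by
  change ∫ s, f s ∂(((n : ℕ) : ℝ≥0∞)⁻¹ • ∑ i, Measure.dirac (x i)) = _
  rw [integral_smul_measure, integral_finsetSum_measure fun i _ => integrable_dirac (by simp)]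
  simp [integral_dirac, div_eq_inv_mul]

section sequences
variable {P : ProbabilityMeasure ℝ≥0} {N : ℕ → ℕ+} {y : ∀ k, Fin (N k) → ℝ≥0}

theorem tendsto_average (hE : Tendsto (fun k => empirical (N k) (y k)) atTop (𝓝 P))
    {f : ℝ≥0 → ℝ} (hf : Continuous f) {K : ℝ} (hK : ∀ x, |f x| ≤ K) :
    Tendsto (fun k => (∑ i, f (y k i)) / ((N k : ℕ) : ℝ)) atTop
      (𝓝 (∫ x, f x ∂(P : Measure ℝ≥0))) := by
  have := (ProbabilityMeasure.tendsto_iff_forall_integral_tendsto.1 hE)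
    (BoundedContinuousFunction.ofNormedAddCommGroup f hf K hK)
  simpa [integral_empirical] using this

theorem tendsto_average_truncated (hE : Tendsto (fun k => empirical (N k) (y k)) atTop (𝓝 P))
    (M : ℝ≥0) {f : ℝ≥0 → ℝ} (hf : Continuous f) {K : ℝ} (hK : ∀ x, |f x| ≤ K) :
    Tendsto (fun k => (∑ i, min (y k i : ℝ) M * f (y k i)) / ((N k : ℕ) : ℝ)) atTop
      (𝓝 (∫ x, min (x : ℝ) M * f x ∂(P : Measure ℝ≥0))) := by
  refine tendsto_average hE (f := fun x => min (x : ℝ) M * f x) (by fun_prop) (K := M * K)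
    fun x => ?_
  rw [abs_mul, abs_of_nonneg (by positivity)]
  exact mul_le_mul (min_le_right _ _) (hK x) (abs_nonneg _) M.2

theorem integrable_truncated (hint : Integrable (fun x : ℝ≥0 => (x : ℝ)) (P : Measure ℝ≥0))
    (M : ℝ≥0) {ψ : ℝ≥0 → ℝ} (hψm : AEStronglyMeasurable ψ (P : Measure ℝ≥0)) {K : ℝ}
    (hψ : ∀ x, |ψ x| ≤ K) :
    Integrable (fun x : ℝ≥0 => min (x : ℝ) M * ψ x) (P : Measure ℝ≥0) :=
  Integrable.mul_bdd (c := K)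
    (hint.mono' (by fun_prop) (Eventually.of_forall fun x => by
      rw [Real.norm_eq_abs, abs_of_nonneg (by positivity)]; exact min_le_left _ _))
    hψm (Eventually.of_forall hψ)

theorem tendsto_integral_truncated
    (hint : Integrable (fun x : ℝ≥0 => (x : ℝ)) (P : Measure ℝ≥0)) :
    Tendsto (fun M : ℕ => ∫ x : ℝ≥0, min (x : ℝ) (M : ℝ≥0) ∂(P : Measure ℝ≥0)) atTop
      (𝓝 (mean P)) := by
  refine tendsto_integral_of_dominated_convergence (fun x : ℝ≥0 => (x : ℝ))
    (fun M => by fun_prop) hint (fun M => Eventually.of_forall fun x => ?_)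
    (Eventually.of_forall fun x => ?_)
  · rw [Real.norm_eq_abs, abs_of_nonneg (by positivity)]; exact min_le_left _ _
  · refine tendsto_const_nhds.congr' ?_
    filter_upwards [eventually_ge_atTop ⌈x⌉₊] with M hM
    rw [min_eq_left]
    exact_mod_cast (Nat.le_ceil x).trans (by exact_mod_cast hM)

/-- Averages with unbounded weights `y k i` can be computed by truncation, because the averages of
the weights converge to the mean of the limit. -/
theorem tendsto_weighted_average
    (hint : Integrable (fun x : ℝ≥0 => (x : ℝ)) (P : Measure ℝ≥0))
    (hsum : ∀ k, ∑ i, (y k i : ℝ) = ((N k : ℕ) : ℝ) * mean P)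
    (hE : Tendsto (fun k => empirical (N k) (y k)) atTop (𝓝 P))
    {a : ∀ k, Fin (N k) → ℝ} {K : ℝ} (ha : ∀ k i, |a k i| ≤ K)
    {ψ : ℝ≥0 → ℝ} (hψm : AEStronglyMeasurable ψ (P : Measure ℝ≥0)) (hψ : ∀ x, |ψ x| ≤ K)
    (h : ∀ M : ℝ≥0, Tendsto (fun k => (∑ i, min (y k i : ℝ) M * a k i) / ((N k : ℕ) : ℝ)) atTop
      (𝓝 (∫ x, min (x : ℝ) M * ψ x ∂(P : Measure ℝ≥0)))) :
    Tendsto (fun k => (∑ i, (y k i : ℝ) * a k i) / ((N k : ℕ) : ℝ)) atTop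
      (𝓝 (∫ x, (x : ℝ) * ψ x ∂(P : Measure ℝ≥0))) := by
  have hK : 0 ≤ K := (abs_nonneg _).trans (hψ 0)
  rw [Metric.tendsto_nhds]
  intro ε hε
  -- Chosen so that `K * δ < ε / 3`; the `+ 1` covers `K = 0`.
  set δ := ε / (3 * (K + 1)) with hδ
  have hδ0 : 0 < δ := by positivity
  obtain ⟨M, hM⟩ := ((tendsto_order.1 (tendsto_integral_truncated hint)).1 (mean P - δ)
    (by linarith)).exists
  have hmin : Integrable (fun x : ℝ≥0 => min (x : ℝ) ((M : ℝ≥0) : ℝ)) (P : Measure ℝ≥0) := by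
    simpa using integrable_truncated hint (M : ℝ≥0) (ψ := fun _ => 1)
      aestronglyMeasurable_const (K := 1) (by simp)
  have h1 := tendsto_average_truncated hE (M : ℝ≥0) (f := fun _ => 1) continuous_const (K := 1)
    (by simp)
  simp only [mul_one] at h1
  have h2 := (tendsto_order.1 h1).1 (mean P - δ) hM
  have h3 := Metric.tendsto_nhds.1 (h M) (ε / 3) (by positivity)
  have hP : |∫ x, (x : ℝ) * ψ x ∂(P : Measure ℝ≥0)
      - ∫ x, min (x : ℝ) (M : ℝ≥0) * ψ x ∂(P : Measure ℝ≥0)| ≤ K * δ := by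
    rw [← Real.norm_eq_abs, ← integral_sub (hint.mul_bdd hψm (Eventually.of_forall hψ))
      (integrable_truncated hint _ hψm hψ)]
    calc _ ≤ ∫ x : ℝ≥0, K * ((x : ℝ) - min (x : ℝ) (M : ℝ≥0)) ∂(P : Measure ℝ≥0) := by
          refine norm_integral_le_of_norm_le ((hint.sub hmin).const_mul K)
            (Eventually.of_forall fun x => ?_)
          rw [← sub_mul, norm_mul, mul_comm, Real.norm_eq_abs, Real.norm_eq_abs,
            abs_of_nonneg (sub_nonneg.2 (min_le_left _ _))]
          exact mul_le_mul_of_nonneg_right (hψ x) (sub_nonneg.2 (min_le_left _ _))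
      _ = K * (mean P - ∫ x : ℝ≥0, min (x : ℝ) (M : ℝ≥0) ∂(P : Measure ℝ≥0)) := by
          rw [integral_const_mul, integral_sub hint hmin]; rfl
      _ ≤ K * δ := by gcongr; linarith
  filter_upwards [h2, h3] with k hk2 hk3
  have hn : (0 : ℝ) < ((N k : ℕ) : ℝ) := by exact_mod_cast (N k).pos
  -- The truncated-off mass is the exact mean minus the truncated average. The latter converges
  -- weakly to a value above `mean P - δ`, which replaces uniform integrability.
  have hk : |(∑ i, (y k i : ℝ) * a k i) / ((N k : ℕ) : ℝ)
      - (∑ i, min (y k i : ℝ) (M : ℝ≥0) * a k i) / ((N k : ℕ) : ℝ)| ≤ K * δ := by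
    rw [← sub_div, ← Finset.sum_sub_distrib, abs_div, abs_of_pos hn, div_le_iff₀ hn]
    calc _ ≤ ∑ i, |(y k i : ℝ) * a k i - min (y k i : ℝ) (M : ℝ≥0) * a k i| :=
          Finset.abs_sum_le_sum_abs _ _
      _ ≤ ∑ i, K * ((y k i : ℝ) - min (y k i : ℝ) (M : ℝ≥0)) := by
          refine Finset.sum_le_sum fun i _ => ?_
          rw [← sub_mul, abs_mul, mul_comm, abs_of_nonneg (sub_nonneg.2 (min_le_left _ _))]
          exact mul_le_mul_of_nonneg_right (ha k i) (sub_nonneg.2 (min_le_left _ _))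
      _ = K * (((N k : ℕ) : ℝ) * mean P - ∑ i, min (y k i : ℝ) (M : ℝ≥0)) := by
          rw [← Finset.mul_sum, Finset.sum_sub_distrib, hsum]
      _ ≤ K * δ * ((N k : ℕ) : ℝ) := by
          rw [mul_assoc]
          refine mul_le_mul_of_nonneg_left ?_ hK
          rw [lt_div_iff₀ hn] at hk2
          linarith
  have hKδ : K * δ < ε / 3 := by
    rw [hδ, ← mul_div_assoc, div_lt_iff₀ (by positivity)]
    nlinarith
  rw [Real.dist_eq] at hk3 ⊢
  have := abs_sub_le ((∑ i, (y k i : ℝ) * a k i) / ((N k : ℕ) : ℝ))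
    ((∑ i, min (y k i : ℝ) (M : ℝ≥0) * a k i) / ((N k : ℕ) : ℝ))
    (∫ x, (x : ℝ) * ψ x ∂(P : Measure ℝ≥0))
  have h5 := abs_sub_le ((∑ i, min (y k i : ℝ) (M : ℝ≥0) * a k i) / ((N k : ℕ) : ℝ))
    (∫ x, min (x : ℝ) (M : ℝ≥0) * ψ x ∂(P : Measure ℝ≥0))
    (∫ x, (x : ℝ) * ψ x ∂(P : Measure ℝ≥0))
  rw [abs_sub_comm (∫ x, min (x : ℝ) (M : ℝ≥0) * ψ x ∂(P : Measure ℝ≥0))] at h5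
  linarith

theorem exp_neg_mul_mem {t : ℝ} (ht : 0 ≤ t) (x : ℝ≥0) :
    Real.exp (-((x : ℝ) * t)) ∈ Set.Icc (0 : ℝ) 1 :=
  ⟨Real.exp_nonneg _, Real.exp_le_one_iff.2 (by have := mul_nonneg x.2 ht; simpa using this)⟩

theorem abs_exp_neg_mul_le {t : ℝ} (ht : 0 ≤ t) (x : ℝ≥0) : |Real.exp (-((x : ℝ) * t))| ≤ 1 := by
  rw [abs_of_nonneg (Real.exp_nonneg _)]; exact (exp_neg_mul_mem ht x).2

theorem tendsto_average_exp (hE : Tendsto (fun k => empirical (N k) (y k)) atTop (𝓝 P)) {t : ℝ}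
    (ht : 0 ≤ t) :
    Tendsto (fun k => (∑ i, Real.exp (-((y k i : ℝ) * t))) / ((N k : ℕ) : ℝ)) atTop
      (𝓝 (laplace P t)) :=
  tendsto_average hE (f := fun x => Real.exp (-((x : ℝ) * t))) (by fun_prop)
    (abs_exp_neg_mul_le ht)

theorem tendsto_average_indicator_Ioi
    (hE : Tendsto (fun k => empirical (N k) (y k)) atTop (𝓝 P)) {z : ℝ≥0}
    (hz : (P : Measure ℝ≥0) {z} = 0) :
    Tendsto (fun k => (∑ i, if z < y k i then (1 : ℝ) else 0) / ((N k : ℕ) : ℝ)) atTop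
      (𝓝 ((P : Measure ℝ≥0).real (Set.Ioi z))) := by
  have hfr : frontier (Set.Ioi z) ⊆ {z} := by
    rw [isOpen_Ioi.frontier_eq]
    rintro x ⟨hx1, hx2⟩
    have h1 : x ∈ Set.Ici z := closure_minimal Set.Ioi_subset_Ici_self isClosed_Ici hx1
    exact Set.mem_singleton_iff.2 (le_antisymm (not_lt.1 hx2) h1)
  have h := ProbabilityMeasure.tendsto_measure_of_null_frontier_of_tendsto' hE
    (E := Set.Ioi z) (measure_mono_null hfr hz)
  have h' := (ENNReal.tendsto_toReal (measure_ne_top _ _)).comp h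
  refine h'.congr fun k => ?_
  have := integral_empirical (N k) (y k) (Set.indicator (Set.Ioi z) fun _ => 1)
  rw [integral_indicator_const _ measurableSet_Ioi, smul_eq_mul, mul_one] at this
  simpa [Set.indicator, measureReal_def] using this

/-- The cut-off exponential is a multiple of the indicator of `(z, ∞)` plus a bounded continuous
function vanishing up to `z`; only the indicator needs `z` not to be an atom. -/
theorem tendsto_average_exp_Ioi
    (hE : Tendsto (fun k => empirical (N k) (y k)) atTop (𝓝 P)) {t : ℝ} (ht : 0 ≤ t) {z : ℝ≥0}
    (hz : (P : Measure ℝ≥0) {z} = 0) :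
    Tendsto (fun k => (∑ i, if z < y k i then Real.exp (-((y k i : ℝ) * t)) else 0)
        / ((N k : ℕ) : ℝ)) atTop
      (𝓝 (∫ x in Set.Ioi z, Real.exp (-((x : ℝ) * t)) ∂(P : Measure ℝ≥0))) := by
  set f : ℝ≥0 → ℝ := fun x => Real.exp (-(((max x z : ℝ≥0) : ℝ) * t)) - Real.exp (-((z : ℝ) * t))
    with hf
  have hfc : Continuous f := by fun_prop
  have hfb : ∀ x, |f x| ≤ 1 := fun x => by
    have h1 := exp_neg_mul_mem ht (max x z)
    have h2 := exp_neg_mul_mem ht z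
    rw [abs_le]; constructor <;> simp only [hf] <;> linarith [h1.1, h1.2, h2.1, h2.2]
  have hdec : ∀ x : ℝ≥0, (if z < x then Real.exp (-((x : ℝ) * t)) else 0)
      = Real.exp (-((z : ℝ) * t)) * (if z < x then 1 else 0) + f x := by
    intro x
    by_cases h : z < x
    · simp only [hf, if_pos h, max_eq_left h.le]; ring
    · simp only [hf, if_neg h, max_eq_right (not_lt.1 h)]; ring
  have hlim := ((tendsto_average_indicator_Ioi hE hz).const_mul (Real.exp (-((z : ℝ) * t)))).add
    (tendsto_average hE hfc hfb)
  have hP : ∫ x in Set.Ioi z, Real.exp (-((x : ℝ) * t)) ∂(P : Measure ℝ≥0)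
      = Real.exp (-((z : ℝ) * t)) * (P : Measure ℝ≥0).real (Set.Ioi z)
        + ∫ x, f x ∂(P : Measure ℝ≥0) := by
    have h1 : ∀ x, Set.indicator (Set.Ioi z) (fun x : ℝ≥0 => Real.exp (-((x : ℝ) * t))) x
        = Set.indicator (Set.Ioi z) (fun _ => Real.exp (-((z : ℝ) * t))) x + f x := by
      intro x
      have := hdec x
      simp only [Set.indicator_apply, Set.mem_Ioi]
      rw [this]; split_ifs <;> simp
    rw [← integral_indicator measurableSet_Ioi]
    simp_rw [h1]
    rw [integral_add ((integrable_const _).indicator measurableSet_Ioi)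
      (Integrable.of_bound hfc.aestronglyMeasurable 1 (Eventually.of_forall hfb)),
      integral_indicator_const _ measurableSet_Ioi, smul_eq_mul, mul_comm]
  rw [hP]
  refine hlim.congr fun k => ?_
  simp_rw [hdec]
  rw [Finset.sum_add_distrib, add_div, ← Finset.mul_sum, mul_div_assoc]

end sequences

/-! ### A chain rule for the tail function of a measure with atoms -/

/-- The primitive of `s ↦ e^{-l s}` which vanishes at `0`. -/
def cumExp (l c : ℝ) : ℝ := ∫ s in (0 : ℝ)..c, Real.exp (-(l * s))

/-- The mean value of `s ↦ e^{-l s}` on the interval `[a, a + b]`. -/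
def stepAverage (l a b : ℝ) : ℝ := ∫ u in (0 : ℝ)..1, Real.exp (-(l * (a + u * b)))

theorem intervalIntegrable_exp (l a b : ℝ) :
    IntervalIntegrable (fun s => Real.exp (-(l * s))) volume a b :=
  Continuous.intervalIntegrable (by fun_prop) _ _

theorem cumExp_sub (l a b : ℝ) :
    cumExp l b - cumExp l a = ∫ s in a..b, Real.exp (-(l * s)) :=
  intervalIntegral.integral_interval_sub_left (intervalIntegrable_exp _ _ _)
    (intervalIntegrable_exp _ _ _)

@[fun_prop]
theorem continuous_cumExp (l : ℝ) : Continuous (cumExp l) :=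
  intervalIntegral.continuous_primitive (fun _ _ => intervalIntegrable_exp _ _ _) 0

/-- The substitution `s = a + u * b` makes `stepAverage` the difference quotient of `cumExp` across
a jump of size `b`; at `b = 0` it is the derivative. -/
theorem mul_stepAverage (l a b : ℝ) :
    b * stepAverage l a b = cumExp l (a + b) - cumExp l a := by
  have := intervalIntegral.mul_integral_comp_add_mul
    (f := fun s => Real.exp (-(l * s))) (a := 0) (b := 1) b a
  rw [cumExp_sub, stepAverage]
  simp only [mul_zero, add_zero, mul_one] at this
  rw [← this]
  congr 2; ext u; congr 3; ring

theorem continuous_stepAverage (l : ℝ) :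
    Continuous (fun q : ℝ × ℝ => stepAverage l q.1 q.2) := by
  unfold stepAverage
  exact intervalIntegral.continuous_parametric_intervalIntegral_of_continuous' (by fun_prop) 0 1

theorem exp_neg_mul_le_exp_abs {l c : ℝ} (h0 : 0 ≤ c) (h1 : c ≤ 1) :
    Real.exp (-(l * c)) ≤ Real.exp |l| := by
  refine Real.exp_le_exp.2 ?_
  calc -(l * c) ≤ |l * c| := neg_le_abs _
    _ = |l| * c := by rw [abs_mul, abs_of_nonneg h0]
    _ ≤ |l| := mul_le_of_le_one_right (abs_nonneg l) h1

theorem abs_stepAverage_le {l a b : ℝ} (ha : 0 ≤ a) (hb : 0 ≤ b) (hab : a + b ≤ 1) :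
    |stepAverage l a b| ≤ Real.exp |l| := by
  have := intervalIntegral.norm_integral_le_of_norm_le_const (a := (0 : ℝ)) (b := 1)
    (f := fun u => Real.exp (-(l * (a + u * b)))) (C := Real.exp |l|) fun u hu => by
      rw [Set.uIoc_of_le zero_le_one] at hu
      rw [Real.norm_eq_abs, abs_of_nonneg (Real.exp_nonneg _)]
      have := mul_nonneg hu.1.le hb
      have := mul_le_of_le_one_left hb hu.2
      exact exp_neg_mul_le_exp_abs (by linarith) (by linarith)
  simpa [stepAverage] using this

theorem abs_cumExp_le {l c : ℝ} (h0 : 0 ≤ c) (h1 : c ≤ 1) : |cumExp l c| ≤ Real.exp |l| := by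
  have h := mul_stepAverage l 0 c
  have hz : cumExp l 0 = 0 := by simp [cumExp]
  rw [zero_add, hz, sub_zero] at h
  rw [← h, abs_mul, abs_of_nonneg h0]
  exact (mul_le_of_le_one_left (abs_nonneg _) h1).trans
    (abs_stepAverage_le le_rfl h0 (by linarith))

/-! ### Tail functions of a finite measure, grids and the layer-cake formula -/

section chain
variable (ν : Measure ℝ≥0) [IsFiniteMeasure ν]

theorem tendsto_real_Ioi {r : ℕ → ℝ≥0} {x : ℝ≥0} (hr : Tendsto r atTop (𝓝 x))
    (hx : ∀ m, x ≤ r m) :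
    Tendsto (fun m => ν.real (Set.Ioi (r m))) atTop (𝓝 (ν.real (Set.Ioi x))) := by
  simp_rw [← integral_indicator_one (μ := ν) measurableSet_Ioi]
  refine tendsto_integral_of_dominated_convergence (fun _ => 1)
    (fun m => (aestronglyMeasurable_one.indicator measurableSet_Ioi)) (integrable_const _)
    (fun m => Eventually.of_forall fun y => ?_) (Eventually.of_forall fun y => ?_)
  · simp only [Set.indicator_apply]; split_ifs <;> simp
  · refine tendsto_const_nhds.congr' ?_
    by_cases hy : x < y
    · filter_upwards [hr.eventually_lt_const hy] with m hm
      simp [hy, hm]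
    · filter_upwards with m
      simp [hy, ((not_lt.1 hy).trans (hx m)).not_gt]

/-- Approaching `x` strictly from below keeps the mass of `x` in the tail; this is the source of the
jump term in the chain rule. -/
theorem tendsto_real_Ioi_left {r : ℕ → ℝ≥0} {x : ℝ≥0} (hr : Tendsto r atTop (𝓝 x))
    (hx : ∀ m, r m < x) :
    Tendsto (fun m => ν.real (Set.Ioi (r m))) atTop (𝓝 (ν.real (Set.Ici x))) := by
  simp_rw [← integral_indicator_one (μ := ν) measurableSet_Ioi]
  rw [← integral_indicator_one (μ := ν) measurableSet_Ici]
  refine tendsto_integral_of_dominated_convergence (fun _ => 1)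
    (fun m => (aestronglyMeasurable_one.indicator measurableSet_Ioi)) (integrable_const _)
    (fun m => Eventually.of_forall fun y => ?_) (Eventually.of_forall fun y => ?_)
  · simp only [Set.indicator_apply]; split_ifs <;> simp
  · refine tendsto_const_nhds.congr' ?_
    by_cases hy : x ≤ y
    · filter_upwards with m
      simp [hy, (hx m).trans_le hy]
    · filter_upwards [hr.eventually_const_lt (not_le.1 hy)] with m hm
      simp [hy, hm.le]

theorem antitone_real_Ioi : Antitone fun x : ℝ≥0 => ν.real (Set.Ioi x) :=
  fun _ _ h => measureReal_mono (Set.Ioi_subset_Ioi h)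

theorem real_Ici_eq (x : ℝ≥0) : ν.real (Set.Ici x) = ν.real (Set.Ioi x) + ν.real {x} := by
  rw [← Set.Ioi_union_left, measureReal_union (by simp) (measurableSet_singleton x)]

theorem real_Ioc_eq {a b : ℝ≥0} (h : a ≤ b) :
    ν.real (Set.Ioc a b) = ν.real (Set.Ioi a) - ν.real (Set.Ioi b) := by
  rw [← Set.Ioc_union_Ioi_eq_Ioi h, measureReal_union
    ((Set.Ioc_disjoint_Ioi le_rfl)) measurableSet_Ioi]
  ring

variable {ν}

/-- The mass of a point is a difference of two antitone functions of the point, hence measurable. -/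
theorem measurable_stepAverage_tail (l : ℝ) :
    Measurable fun x : ℝ≥0 => stepAverage l (ν.real (Set.Ioi x)) (ν.real {x}) := by
  have h1 := (antitone_real_Ioi ν).measurable
  have h2 : Measurable fun x : ℝ≥0 => ν.real (Set.Ici x) :=
    Antitone.measurable fun _ _ h => measureReal_mono (Set.Ici_subset_Ici.2 h)
  have h3 : (fun x : ℝ≥0 => ν.real {x}) = fun x => ν.real (Set.Ici x) - ν.real (Set.Ioi x) := by
    ext x; rw [real_Ici_eq]; ring
  have h4 : Measurable fun x : ℝ≥0 => ν.real {x} := by rw [h3]; exact h2.sub h1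
  exact (continuous_stepAverage l).measurable.comp (h1.prodMk h4)

theorem abs_stepAverage_tail_le (hν : ν.real Set.univ ≤ 1) (l : ℝ) (x : ℝ≥0) :
    |stepAverage l (ν.real (Set.Ioi x)) (ν.real {x})| ≤ Real.exp |l| :=
  abs_stepAverage_le measureReal_nonneg measureReal_nonneg
    (by rw [← real_Ici_eq]; exact (measureReal_mono (Set.subset_univ _)).trans hν)

/-- The grid of mesh `1 / (m + 1)` started at `z`. -/
def grid (z : ℝ≥0) (m k : ℕ) : ℝ≥0 := z + k / (m + 1)

/-- The index of the cell of the grid which contains `x`. -/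
def gridIndex (z : ℝ≥0) (m : ℕ) (x : ℝ≥0) : ℕ := ⌈(x - z) * (m + 1)⌉₊ - 1

theorem grid_mono (z : ℝ≥0) (m : ℕ) : Monotone (grid z m) := fun a b h => by
  unfold grid; gcongr

theorem grid_step (z : ℝ≥0) (m k : ℕ) : grid z m (k + 1) = grid z m k + 1 / (m + 1) := by
  unfold grid; push_cast; rw [add_div, add_assoc]

theorem mem_Ioc_grid_iff {z : ℝ≥0} {m k : ℕ} {x : ℝ≥0} (hx : z < x) :
    x ∈ Set.Ioc (grid z m k) (grid z m (k + 1)) ↔ gridIndex z m x = k := by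
  have hpos : 0 < (x - z) * (m + 1) := mul_pos (tsub_pos_of_lt hx) (by positivity)
  -- Positivity makes the truncated subtraction in `gridIndex` a genuine one.
  have hc : 0 < ⌈(x - z) * ((m : ℝ≥0) + 1)⌉₊ := Nat.ceil_pos.2 hpos
  have hm : (0 : ℝ≥0) < m + 1 := by positivity
  have h1 : gridIndex z m x = k ↔ ⌈(x - z) * ((m : ℝ≥0) + 1)⌉₊ = k + 1 := by
    unfold gridIndex; omega
  rw [h1, Nat.ceil_eq_iff (Nat.succ_ne_zero k), Nat.succ_sub_one, Nat.succ_eq_add_one, Set.mem_Ioc, grid, grid,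
    ← lt_tsub_iff_left, div_lt_iff₀ hm, ← tsub_le_iff_left, le_div_iff₀ hm]

theorem tendsto_grid_gridIndex {z x : ℝ≥0} (hx : z < x) :
    Tendsto (fun m => grid z m (gridIndex z m x)) atTop (𝓝 x) ∧
    Tendsto (fun m => grid z m (gridIndex z m x + 1)) atTop (𝓝 x) := by
  have hmem : ∀ m, x ∈ Set.Ioc (grid z m (gridIndex z m x)) (grid z m (gridIndex z m x + 1)) :=
    fun m => (mem_Ioc_grid_iff hx).2 rfl
  have h0 : Tendsto (fun m : ℕ => (1 : ℝ≥0) / (m + 1)) atTop (𝓝 0) :=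
    tendsto_one_div_add_atTop_nhds_zero_nat
  have h1 : Tendsto (fun m => grid z m (gridIndex z m x)) atTop (𝓝 x) := by
    have hs : Tendsto (fun m : ℕ => x - (1 : ℝ≥0) / (m + 1)) atTop (𝓝 x) := by
      simpa using (tendsto_const_nhds (x := x)).sub h0
    refine tendsto_of_tendsto_of_tendsto_of_le_of_le hs tendsto_const_nhds (fun m => ?_)
      fun m => (hmem m).1.le
    have := (hmem m).2
    rw [grid_step] at this
    exact tsub_le_iff_right.2 this
  refine ⟨h1, ?_⟩
  simp_rw [grid_step]
  simpa using h1.add h0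

theorem measurable_gridIndex (z : ℝ≥0) (m : ℕ) : Measurable (gridIndex z m) := by
  have h : Measurable fun x : ℝ≥0 => ⌈(x - z) * ((m : ℝ≥0) + 1)⌉₊ :=
    Nat.measurable_ceil.comp (by fun_prop)
  exact (measurable_from_top (f := fun k : ℕ => k - 1)).comp h

theorem iUnion_Ioc_grid (z : ℝ≥0) (m : ℕ) :
    ⋃ k, Set.Ioc (grid z m k) (grid z m (k + 1)) = Set.Ioi z := by
  ext x
  rw [Set.mem_iUnion]
  constructor
  · rintro ⟨k, hk⟩
    refine lt_of_le_of_lt ?_ hk.1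
    unfold grid; exact le_self_add
  · intro hx
    exact ⟨_, (mem_Ioc_grid_iff hx).2 rfl⟩

theorem tendsto_grid_atTop (z : ℝ≥0) (m : ℕ) : Tendsto (grid z m) atTop atTop := by
  have h : Tendsto (fun k : ℕ => (k : ℝ≥0) / ((m : ℝ≥0) + 1)) atTop atTop :=
    tendsto_natCast_atTop_atTop.atTop_div_const (by positivity)
  exact tendsto_atTop_mono (fun k => by unfold grid; exact le_add_self) h

theorem tendsto_real_Ioi_atTop {r : ℕ → ℝ≥0} (hr : Tendsto r atTop atTop) :
    Tendsto (fun m => ν.real (Set.Ioi (r m))) atTop (𝓝 0) := by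
  simp_rw [← integral_indicator_one (μ := ν) measurableSet_Ioi]
  rw [← integral_zero ℝ≥0 ℝ (μ := ν)]
  refine tendsto_integral_of_dominated_convergence (fun _ => 1)
    (fun m => (aestronglyMeasurable_one.indicator measurableSet_Ioi)) (integrable_const _)
    (fun m => Eventually.of_forall fun y => ?_) (Eventually.of_forall fun y => ?_)
  · simp only [Set.indicator_apply]; split_ifs <;> simp
  · refine tendsto_const_nhds.congr' ?_
    filter_upwards [hr.eventually_ge_atTop y] with m hm
    simp [hm]

/-- On a cell the integrand is constant, and by `mul_stepAverage` its integral is an increment of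
`cumExp` along the tail. The increments telescope, the tail at infinity being zero. Measurability
and the bound serve the dominated convergence that refines the grid. -/
theorem setIntegral_stepAverage_grid (hν : ν.real Set.univ ≤ 1) (l : ℝ) (z : ℝ≥0) (m : ℕ) :
    AEStronglyMeasurable (fun x => stepAverage l (ν.real (Set.Ioi (grid z m (gridIndex z m x + 1))))
      (ν.real (Set.Ioc (grid z m (gridIndex z m x)) (grid z m (gridIndex z m x + 1))))) ν ∧
    (∀ x, |stepAverage l (ν.real (Set.Ioi (grid z m (gridIndex z m x + 1))))
      (ν.real (Set.Ioc (grid z m (gridIndex z m x)) (grid z m (gridIndex z m x + 1))))|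
        ≤ Real.exp |l|) ∧
    ∫ x in Set.Ioi z, stepAverage l (ν.real (Set.Ioi (grid z m (gridIndex z m x + 1))))
      (ν.real (Set.Ioc (grid z m (gridIndex z m x)) (grid z m (gridIndex z m x + 1)))) ∂ν
      = cumExp l (ν.real (Set.Ioi z)) := by
  set G : ℕ → ℝ := fun k => stepAverage l (ν.real (Set.Ioi (grid z m (k + 1))))
    (ν.real (Set.Ioc (grid z m k) (grid z m (k + 1)))) with hG
  change AEStronglyMeasurable (fun x => G (gridIndex z m x)) ν ∧
    (∀ x, |G (gridIndex z m x)| ≤ _) ∧ ∫ x in Set.Ioi z, G (gridIndex z m x) ∂ν = _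
  have hmeas : AEStronglyMeasurable (fun x => G (gridIndex z m x)) ν :=
    ((measurable_from_top (f := G)).comp (measurable_gridIndex z m)).aestronglyMeasurable
  have hbd : ∀ k, |G k| ≤ Real.exp |l| := fun k => by
    refine abs_stepAverage_le measureReal_nonneg measureReal_nonneg ?_
    rw [real_Ioc_eq ν (grid_mono z m k.le_succ), add_sub_cancel]
    exact (measureReal_mono (Set.subset_univ _)).trans hν
  refine ⟨hmeas, fun x => hbd _, ?_⟩
  have hint : Integrable (fun x => G (gridIndex z m x)) ν :=
    Integrable.of_bound hmeas _ (Eventually.of_forall fun x => hbd _)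
  have hs := hasSum_integral_iUnion (μ := ν) (f := fun x => G (gridIndex z m x))
    (s := fun k => Set.Ioc (grid z m k) (grid z m (k + 1)))
    (fun k => measurableSet_Ioc) (grid_mono z m).pairwise_disjoint_on_Ioc_succ
    hint.integrableOn
  rw [iUnion_Ioc_grid] at hs
  have hterm : ∀ k, ∫ x in Set.Ioc (grid z m k) (grid z m (k + 1)), G (gridIndex z m x) ∂ν
      = cumExp l (ν.real (Set.Ioi (grid z m k)))
        - cumExp l (ν.real (Set.Ioi (grid z m (k + 1)))) := by
    intro k
    have h1 : ∀ x ∈ Set.Ioc (grid z m k) (grid z m (k + 1)), G (gridIndex z m x) = G k := by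
      intro x hx
      have hz : z < x := lt_of_le_of_lt (by unfold grid; exact le_self_add) hx.1
      rw [(mem_Ioc_grid_iff hz).1 hx]
    rw [setIntegral_congr_fun measurableSet_Ioc h1, setIntegral_const, smul_eq_mul, hG,
      mul_stepAverage, real_Ioc_eq ν (grid_mono z m k.le_succ), add_sub_cancel]
  simp_rw [hterm] at hs
  have h1 := hs.tendsto_sum_nat
  simp_rw [Finset.sum_range_sub'] at h1
  have hz : cumExp l 0 = 0 := by simp [cumExp]
  have h2 : Tendsto (fun k => cumExp l (ν.real (Set.Ioi (grid z m 0)))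
      - cumExp l (ν.real (Set.Ioi (grid z m k)))) atTop
      (𝓝 (cumExp l (ν.real (Set.Ioi (grid z m 0))) - cumExp l 0)) :=
    tendsto_const_nhds.sub (((continuous_cumExp l).tendsto 0).comp
      (tendsto_real_Ioi_atTop (tendsto_grid_atTop z m)))
  rw [tendsto_nhds_unique h1 h2, hz, sub_zero]
  simp [grid]

/-- The chain rule for the primitive `cumExp l` along the tail function of `ν`. -/
theorem setIntegral_stepAverage_tail (hν : ν.real Set.univ ≤ 1) (l : ℝ) (z : ℝ≥0) :
    ∫ x in Set.Ioi z, stepAverage l (ν.real (Set.Ioi x)) (ν.real {x}) ∂ν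
      = cumExp l (ν.real (Set.Ioi z)) := by
  have hlim : Tendsto (fun m => ∫ x in Set.Ioi z,
      stepAverage l (ν.real (Set.Ioi (grid z m (gridIndex z m x + 1))))
      (ν.real (Set.Ioc (grid z m (gridIndex z m x)) (grid z m (gridIndex z m x + 1)))) ∂ν) atTop
      (𝓝 (∫ x in Set.Ioi z, stepAverage l (ν.real (Set.Ioi x)) (ν.real {x}) ∂ν)) := by
    refine tendsto_integral_of_dominated_convergence (fun _ => Real.exp |l|)
      (fun m => (setIntegral_stepAverage_grid hν l z m).1.restrict) (integrable_const _)
      (fun m => Eventually.of_forall (setIntegral_stepAverage_grid hν l z m).2.1) ?_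
    refine (ae_restrict_iff' measurableSet_Ioi).2 (Eventually.of_forall fun x hx => ?_)
    have hmem : ∀ m, x ∈ Set.Ioc (grid z m (gridIndex z m x)) (grid z m (gridIndex z m x + 1)) :=
      fun m => (mem_Ioc_grid_iff hx).2 rfl
    -- Right endpoints are at least `x` and left endpoints are below it, so the mass of the cell
    -- tends to that of the point `x`.
    have h1 := tendsto_real_Ioi ν (tendsto_grid_gridIndex hx).2 fun m => (hmem m).2
    have h2 := tendsto_real_Ioi_left ν (tendsto_grid_gridIndex hx).1 fun m => (hmem m).1
    have h3 := h2.sub h1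
    rw [real_Ici_eq, add_sub_cancel_left] at h3
    simp_rw [← real_Ioc_eq ν (grid_mono z _ (Nat.le_succ _))] at h3
    exact ((continuous_stepAverage l).tendsto _).comp (h1.prodMk_nhds h3)
  simp_rw [fun m => (setIntegral_stepAverage_grid hν l z m).2.2] at hlim
  exact tendsto_nhds_unique hlim tendsto_const_nhds

theorem integral_ite_lt {x M : ℝ} (hx : 0 ≤ x) (hM : 0 ≤ M) :
    ∫ z in (0 : ℝ)..M, (if z < x then (1 : ℝ) else 0) = min x M := by
  have h1 : (fun z : ℝ => if z < x then (1 : ℝ) else 0) = Set.indicator (Set.Iio x) fun _ => 1 := by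
    ext z; simp [Set.indicator_apply]
  rw [intervalIntegral.integral_of_le hM, h1, setIntegral_indicator measurableSet_Iio,
    setIntegral_const, smul_eq_mul, mul_one]
  have h2 : volume.real (Set.Ioc 0 M ∩ Set.Iio x) = volume.real (Set.Ioc 0 M ∩ Set.Iic x) :=
    measureReal_congr ((ae_eq_refl _).inter Iio_ae_eq_Iic)
  rw [h2, Set.Ioc_inter_Iic, Real.volume_real_Ioc_of_le (le_inf hM hx), sub_zero, min_comm]

/-- Layer cake for `min x M`, Fubini, and the chain rule at each level. The right side depends
continuously on the tails, so it can be reached as a limit although the integrand on the left jumps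
at atoms. -/
theorem integral_truncated_stepAverage (hν : ν.real Set.univ ≤ 1) (l : ℝ) (M : ℝ≥0) :
    ∫ x : ℝ≥0, min (x : ℝ) M * stepAverage l (ν.real (Set.Ioi x)) (ν.real {x}) ∂ν
      = ∫ z in (0 : ℝ)..M, cumExp l (ν.real (Set.Ioi z.toNNReal)) := by
  set ψ : ℝ≥0 → ℝ := fun x => stepAverage l (ν.real (Set.Ioi x)) (ν.real {x}) with hψ
  have hψm : Measurable ψ := measurable_stepAverage_tail l
  have hψb : ∀ x, |ψ x| ≤ Real.exp |l| := abs_stepAverage_tail_le hν l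
  have h1 : ∀ x : ℝ≥0, min (x : ℝ) M * ψ x
      = ∫ z in Set.Ioc (0 : ℝ) M, (if z < (x : ℝ) then (1 : ℝ) else 0) * ψ x := by
    intro x
    rw [← integral_ite_lt x.coe_nonneg M.coe_nonneg, intervalIntegral.integral_of_le M.coe_nonneg, integral_mul_const]
  refine (integral_congr_ae (Eventually.of_forall h1)).trans ?_
  rw [integral_integral_swap, intervalIntegral.integral_of_le M.coe_nonneg]
  · refine setIntegral_congr_fun measurableSet_Ioc fun z hz => ?_
    rw [← setIntegral_stepAverage_tail hν l, ← integral_indicator measurableSet_Ioi]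
    refine integral_congr_ae (Eventually.of_forall fun x => ?_)
    have : z.toNNReal < x ↔ z < (x : ℝ) := Real.toNNReal_lt_iff_lt_coe hz.1.le
    by_cases h : z < (x : ℝ)
    · simp [this, h, hψ]
    · simp [this, h]
  · refine Integrable.of_bound (C := Real.exp |l|) (Measurable.aestronglyMeasurable ?_)
      (Eventually.of_forall fun q => ?_)
    · refine Measurable.mul (Measurable.ite ?_ measurable_const measurable_const)
        (hψm.comp measurable_fst)
      exact measurableSet_lt measurable_snd (by fun_prop)
    · simp only [Function.uncurry]
      split_ifs
      · simpa using hψb q.1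
      · simp [Real.exp_nonneg]

end chain

/-! ### Decreasing weights: convergence of the weighted averages -/

/-- The measure `e^{-xt} P(dx)`. -/
def tilted (P : ProbabilityMeasure ℝ≥0) (t : ℝ) : Measure ℝ≥0 :=
  (P : Measure ℝ≥0).withDensity fun x => ENNReal.ofReal (Real.exp (-((x : ℝ) * t)))

section tilted
variable (P : ProbabilityMeasure ℝ≥0) {t : ℝ}

theorem integrable_exp (ht : 0 ≤ t) :
    Integrable (fun x : ℝ≥0 => Real.exp (-((x : ℝ) * t))) (P : Measure ℝ≥0) :=
  Integrable.of_bound (by fun_prop) 1 (Eventually.of_forall (abs_exp_neg_mul_le ht))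

theorem isFiniteMeasure_tilted (ht : 0 ≤ t) : IsFiniteMeasure (tilted P t) :=
  isFiniteMeasure_withDensity_ofReal (integrable_exp P ht).2

theorem real_tilted (ht : 0 ≤ t) {s : Set ℝ≥0} (hs : MeasurableSet s) :
    (tilted P t).real s = ∫ x in s, Real.exp (-((x : ℝ) * t)) ∂(P : Measure ℝ≥0) := by
  rw [measureReal_def, tilted, withDensity_apply _ hs,
    ← ofReal_integral_eq_lintegral_ofReal (integrable_exp P ht).integrableOn
      (Eventually.of_forall fun x => Real.exp_nonneg _),
    ENNReal.toReal_ofReal (integral_nonneg fun x => Real.exp_nonneg _)]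

theorem real_tilted_singleton (ht : 0 ≤ t) (x : ℝ≥0) :
    (tilted P t).real {x} = Real.exp (-((x : ℝ) * t)) * (P : Measure ℝ≥0).real {x} := by
  rw [real_tilted P ht (measurableSet_singleton x), integral_singleton, smul_eq_mul, mul_comm]

theorem real_tilted_univ (ht : 0 ≤ t) : (tilted P t).real Set.univ = laplace P t := by
  rw [real_tilted P ht MeasurableSet.univ, setIntegral_univ]; rfl

theorem laplace_le_one (ht : 0 ≤ t) : laplace P t ≤ 1 := by
  have := integral_mono (integrable_exp P ht) (integrable_const (1 : ℝ))
    fun x => (exp_neg_mul_mem ht x).2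
  simpa [laplace] using this

theorem integral_tilted (f : ℝ≥0 → ℝ) :
    ∫ x, f x ∂(tilted P t) = ∫ x, Real.exp (-((x : ℝ) * t)) * f x ∂(P : Measure ℝ≥0) := by
  rw [tilted, integral_withDensity_eq_integral_toReal_smul (by fun_prop)
    (Eventually.of_forall fun x => ENNReal.ofReal_lt_top)]
  simp [ENNReal.toReal_ofReal (Real.exp_nonneg _)]

end tilted

/-! ### Partial sums along the ordering and their discrete chain rule -/

section partialSums
variable {n : ℕ} (q : Fin n → ℝ)

/-- The average over `Fin n` of `q`, restricted to the indices smaller than `r`. -/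
def partialAverage (r : ℕ) : ℝ := (∑ j : Fin n, if (j : ℕ) < r then q j else 0) / (n : ℝ)

theorem partialAverage_zero : partialAverage q 0 = 0 := by simp [partialAverage]

theorem partialAverage_succ (i : Fin n) :
    partialAverage q (i + 1) = partialAverage q i + q i / n := by
  unfold partialAverage
  rw [← add_div]
  congr 1
  have : q i = ∑ j, if j = i then q j else 0 := by simp
  rw [this, ← Finset.sum_add_distrib]
  refine Finset.sum_congr rfl fun j _ => ?_
  rcases lt_trichotomy j i with h | h | h
  · simp [h, h.ne, h.le]
  · simp [h]
  · simp [h.not_gt, h.not_ge, h.ne']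

variable {q}

theorem partialAverage_mem (hq : ∀ j, q j ∈ Set.Icc (0 : ℝ) 1) (r : ℕ) :
    partialAverage q r ∈ Set.Icc (0 : ℝ) 1 := by
  unfold partialAverage
  refine ⟨div_nonneg (Finset.sum_nonneg fun j _ => ?_) n.cast_nonneg,
    div_le_one_of_le₀ ?_ n.cast_nonneg⟩
  · split_ifs
    exacts [(hq j).1, le_rfl]
  · calc _ ≤ ∑ _j : Fin n, (1 : ℝ) := Finset.sum_le_sum fun j _ => by
          split_ifs
          exacts [(hq j).2, zero_le_one]
      _ = n := by simp

theorem sum_increments (F : ℕ → ℝ) {r : ℕ} (hr : r ≤ n) :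
    ∑ i : Fin n, (if (i : ℕ) < r then F (i + 1) - F i else 0) = F r - F 0 := by
  rw [Fin.sum_univ_eq_sum_range (fun i => if i < r then F (i + 1) - F i else 0) n,
    ← Finset.sum_filter]
  have : (Finset.range n).filter (· < r) = Finset.range r := by
    ext i; simp; omega
  rw [this, Finset.sum_range_sub]

/-- Superlevel sets of a decreasing vector are initial segments; this is what monotonicity of the
weights provides. -/
theorem exists_lt_iff_of_antitone {y : Fin n → ℝ≥0} (hy : Antitone y) (z : ℝ≥0) :
    ∃ r ≤ n, ∀ i : Fin n, z < y i ↔ (i : ℕ) < r := by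
  classical
  by_cases h : ∃ r, ∃ hr : r < n, ¬ z < y ⟨r, hr⟩
  · obtain ⟨hr, hz⟩ := Nat.find_spec h
    refine ⟨Nat.find h, hr.le, fun i => ⟨fun hi => ?_, fun hi => ?_⟩⟩
    · by_contra hcon
      exact hz (hi.trans_le (hy (show (⟨Nat.find h, hr⟩ : Fin n) ≤ i from not_lt.1 hcon)))
    · by_contra hcon
      exact Nat.find_min h hi ⟨i.2, hcon⟩
  · push Not at h
    exact ⟨n, le_rfl, fun i => ⟨fun _ => i.2, fun _ => h i i.2⟩⟩

/-- Discrete counterpart of `integral_truncated_stepAverage`: at each level the increments run over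
an initial segment and telescope. -/
theorem sum_truncated_increments {y : Fin n → ℝ≥0}
    (hy : Antitone y) (l : ℝ) (M : ℝ≥0) :
    ∑ i : Fin n, min (y i : ℝ) M *
        (cumExp l (partialAverage q (i + 1)) - cumExp l (partialAverage q i))
      = ∫ z in (0 : ℝ)..M, cumExp l ((∑ i, if z.toNNReal < y i then q i else 0) / n) := by
  have h1 : ∀ i, min (y i : ℝ) M *
      (cumExp l (partialAverage q (i + 1)) - cumExp l (partialAverage q i))
      = ∫ z in (0 : ℝ)..M, (if z < (y i : ℝ) then (1 : ℝ) else 0) *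
        (cumExp l (partialAverage q (i + 1)) - cumExp l (partialAverage q i)) := by
    intro i
    rw [intervalIntegral.integral_mul_const, integral_ite_lt (y i).coe_nonneg M.coe_nonneg]
  simp_rw [h1]
  rw [← intervalIntegral.integral_finsetSum]
  · refine intervalIntegral.integral_congr fun z hz => ?_
    rw [Set.uIcc_of_le M.coe_nonneg] at hz
    obtain ⟨r, hr, hiff⟩ := exists_lt_iff_of_antitone hy z.toNNReal
    have hiff' : ∀ i, z < (y i : ℝ) ↔ (i : ℕ) < r := fun i => by
      rw [← hiff, Real.toNNReal_lt_iff_lt_coe hz.1]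
    simp_rw [hiff, hiff', ite_mul, one_mul, zero_mul]
    rw [sum_increments (fun k => cumExp l (partialAverage q k)) hr, partialAverage_zero]
    simp [cumExp, partialAverage]
  · intro i _
    refine IntervalIntegrable.mul_const ?_ _
    rw [intervalIntegrable_iff]
    have : IsFiniteMeasure (volume.restrict (Set.uIoc (0 : ℝ) M)) :=
      ⟨by rw [Measure.restrict_apply_univ, Real.volume_uIoc]; exact ENNReal.ofReal_lt_top⟩
    refine Integrable.of_bound (C := 1) (Measurable.aestronglyMeasurable ?_)
      (Eventually.of_forall fun z => ?_)
    · exact Measurable.ite (measurableSet_lt measurable_id measurable_const)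
        measurable_const measurable_const
    · split_ifs <;> simp

/-- A right-endpoint rectangle is compared with an integral over an interval of length at most `1 /
n`, the integrand having Lipschitz constant `|l| * exp |l|`. Both signs of `l` are needed, as
reversing the order turns `l` into `-l`. -/
theorem abs_increment_sub_le (hq : ∀ j, q j ∈ Set.Icc (0 : ℝ) 1) (l : ℝ) (i : Fin n) :
    |q i * Real.exp (-(l * partialAverage q (i + 1))) / n
      - (cumExp l (partialAverage q (i + 1)) - cumExp l (partialAverage q i))|
      ≤ |l| * Real.exp |l| / n ^ 2 := by
  have hn : (0 : ℝ) < n := by exact_mod_cast i.pos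
  set a := partialAverage q i with ha
  set b := partialAverage q (i + 1) with hb
  have hba : b = a + q i / n := partialAverage_succ q i
  have ha' := partialAverage_mem hq i
  have hb' := partialAverage_mem hq (i + 1)
  have hd0 : 0 ≤ q i / n := div_nonneg (hq i).1 hn.le
  have hd1 : q i / n ≤ 1 / n := div_le_div_of_nonneg_right (hq i).2 hn.le
  have hab : a ≤ b := by linarith
  have h1 : q i * Real.exp (-(l * b)) / n = ∫ _s in a..b, Real.exp (-(l * b)) := by
    rw [intervalIntegral.integral_const, smul_eq_mul, hba]; ring
  rw [cumExp_sub, h1, ← intervalIntegral.integral_sub (by simp) (intervalIntegrable_exp _ _ _)]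
  have h2 := intervalIntegral.norm_integral_le_of_norm_le_const (a := a) (b := b)
    (f := fun s => Real.exp (-(l * b)) - Real.exp (-(l * s))) (C := |l| * Real.exp |l| * (1 / n))
    fun s hs => by
      rw [Set.uIoc_of_le hab] at hs
      have hs0 : 0 ≤ s := ha'.1.trans hs.1.le
      have hs1 : s ≤ 1 := hs.2.trans hb'.2
      have h3 := Convex.norm_image_sub_le_of_norm_deriv_le (𝕜 := ℝ) (s := Set.Icc (0 : ℝ) 1)
        (f := fun s => Real.exp (-(l * s))) (C := |l| * Real.exp |l|) (x := s) (y := b)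
        (fun x _ => by fun_prop) (fun x hx => by
          have hdv : HasDerivAt (fun s => Real.exp (-(l * s))) (Real.exp (-(l * x)) * (-(l * 1))) x :=
            (((hasDerivAt_id x).const_mul l).neg).exp
          rw [hdv.deriv, norm_mul, mul_comm, Real.norm_eq_abs, Real.norm_eq_abs, mul_one, abs_neg,
            abs_of_nonneg (Real.exp_nonneg _)]
          exact mul_le_mul_of_nonneg_left (exp_neg_mul_le_exp_abs hx.1 hx.2) (abs_nonneg l))
        (convex_Icc 0 1) ⟨hs0, hs1⟩ hb'
      refine h3.trans (mul_le_mul_of_nonneg_left ?_ (by positivity))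
      rw [Real.norm_eq_abs, abs_of_nonneg (by linarith [hs.2])]
      linarith [hs.1]
  rw [Real.norm_eq_abs] at h2
  refine h2.trans ?_
  rw [abs_of_nonneg (show 0 ≤ b - a by linarith)]
  have h4 : b - a ≤ 1 / n := by linarith
  calc |l| * Real.exp |l| * (1 / n) * (b - a) ≤ |l| * Real.exp |l| * (1 / n) * (1 / n) := by gcongr
    _ = _ := by ring

end partialSums

/-- Atoms are countable, so almost every level of the layer cake is a continuity point of the tail.
-/
theorem ae_measure_singleton_toNNReal_eq_zero (P : ProbabilityMeasure ℝ≥0) :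
    ∀ᵐ z : ℝ, 0 ≤ z → (P : Measure ℝ≥0) {z.toNNReal} = 0 := by
  have hc : Set.Countable {x : ℝ≥0 | 0 < (P : Measure ℝ≥0) {x}} :=
    Measure.countable_meas_pos_of_disjoint_iUnion (fun x => measurableSet_singleton x)
      (fun x y hxy => by simpa using hxy)
  have h0 := (hc.image (fun x : ℝ≥0 => (x : ℝ))).measure_zero volume
  rw [measure_eq_zero_iff_ae_notMem] at h0
  filter_upwards [h0] with z hz hz0
  by_contra hcon
  exact hz ⟨z.toNNReal, pos_iff_ne_zero.2 hcon, Real.coe_toNNReal z hz0⟩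

section sequences
variable {P : ProbabilityMeasure ℝ≥0} {N : ℕ → ℕ+} {y : ∀ k, Fin (N k) → ℝ≥0}

theorem tendsto_natCast_atTop (hN : Tendsto N atTop atTop) :
    Tendsto (fun k => ((N k : ℕ) : ℝ)) atTop atTop := by
  refine tendsto_natCast_atTop_atTop.comp ?_
  refine tendsto_atTop.2 fun b => ?_
  filter_upwards [hN.eventually_ge_atTop b.succPNat] with k hk
  have h : ((b.succPNat : ℕ+) : ℕ) ≤ N k := hk
  rw [Nat.succPNat_coe] at h
  omega

/-- After truncation at `M` the sum is, up to `O(1 / n)`, a sum of increments of `cumExp`, that is,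
an integral over levels of `cumExp` of empirical tails. These converge at almost every level, and
`integral_truncated_stepAverage` identifies the limit. -/
theorem tendsto_antitone_average (hN : Tendsto N atTop atTop)
    (hint : Integrable (fun x : ℝ≥0 => (x : ℝ)) (P : Measure ℝ≥0))
    (hsum : ∀ k, ∑ i, (y k i : ℝ) = ((N k : ℕ) : ℝ) * mean P)
    (hE : Tendsto (fun k => empirical (N k) (y k)) atTop (𝓝 P))
    (hy : ∀ k, Antitone (y k)) {t : ℝ} (ht : 0 ≤ t) (l : ℝ) :
    Tendsto (fun k => (∑ i, (y k i : ℝ) * (Real.exp (-((y k i : ℝ) * t)) *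
        Real.exp (-(l * partialAverage (fun j => Real.exp (-((y k j : ℝ) * t))) (i + 1)))))
        / ((N k : ℕ) : ℝ)) atTop
      (𝓝 (∫ x : ℝ≥0, (x : ℝ) * (Real.exp (-((x : ℝ) * t)) *
        stepAverage l ((tilted P t).real (Set.Ioi x)) ((tilted P t).real {x}))
        ∂(P : Measure ℝ≥0))) := by
  have := isFiniteMeasure_tilted P ht
  have hν : (tilted P t).real Set.univ ≤ 1 := by
    rw [real_tilted_univ P ht]; exact laplace_le_one P ht
  have hq : ∀ k (j : Fin (N k)), Real.exp (-((y k j : ℝ) * t)) ∈ Set.Icc (0 : ℝ) 1 :=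
    fun k j => exp_neg_mul_mem ht _
  have hψm : Measurable fun x : ℝ≥0 => Real.exp (-((x : ℝ) * t)) *
      stepAverage l ((tilted P t).real (Set.Ioi x)) ((tilted P t).real {x}) :=
    Measurable.mul (by fun_prop) (measurable_stepAverage_tail l)
  refine tendsto_weighted_average hint hsum hE (K := Real.exp |l|) (fun k i => ?_)
    hψm.aestronglyMeasurable (fun x => ?_) fun M => ?_
  · have h1 := partialAverage_mem (hq k) (i + 1)
    rw [abs_mul, abs_of_nonneg (hq k i).1, abs_of_nonneg (Real.exp_nonneg _)]
    exact (mul_le_of_le_one_left (Real.exp_nonneg _) (hq k i).2).trans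
      (exp_neg_mul_le_exp_abs h1.1 h1.2)
  · rw [abs_mul, abs_of_nonneg (Real.exp_nonneg _)]
    exact (mul_le_of_le_one_left (abs_nonneg _) (exp_neg_mul_mem ht x).2).trans
      (abs_stepAverage_tail_le hν l x)
  · have hlimit : ∫ x : ℝ≥0, min (x : ℝ) M * (Real.exp (-((x : ℝ) * t)) *
          stepAverage l ((tilted P t).real (Set.Ioi x)) ((tilted P t).real {x}))
          ∂(P : Measure ℝ≥0)
        = ∫ z in (0 : ℝ)..M, cumExp l ((tilted P t).real (Set.Ioi z.toNNReal)) := by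
      rw [← integral_truncated_stepAverage hν, integral_tilted]
      refine integral_congr_ae (Eventually.of_forall fun x => ?_)
      simp only; ring
    rw [hlimit]
    have hmain : Tendsto (fun k => ∫ z in (0 : ℝ)..M, cumExp l
        ((∑ i, if z.toNNReal < y k i then Real.exp (-((y k i : ℝ) * t)) else 0)
          / ((N k : ℕ) : ℝ))) atTop
        (𝓝 (∫ z in (0 : ℝ)..M, cumExp l ((tilted P t).real (Set.Ioi z.toNNReal)))) := by
      refine intervalIntegral.tendsto_integral_filter_of_dominated_convergence
        (fun _ => Real.exp |l|) (Eventually.of_forall fun k => ?_)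
        (Eventually.of_forall fun k => Eventually.of_forall fun z _ => ?_) (by simp) ?_
      · refine ((continuous_cumExp l).measurable.comp (Measurable.div_const
          (Finset.measurable_sum _ fun i _ => ?_) _)).aestronglyMeasurable
        exact Measurable.ite (measurableSet_lt measurable_real_toNNReal measurable_const)
          measurable_const measurable_const
      · obtain ⟨r, hr, hiff⟩ := exists_lt_iff_of_antitone (hy k) z.toNNReal
        simp_rw [hiff]
        have h1 := partialAverage_mem (hq k) r
        unfold partialAverage at h1
        exact abs_cumExp_le h1.1 h1.2
      · filter_upwards [ae_measure_singleton_toNNReal_eq_zero P] with z hz hzM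
        rw [Set.uIoc_of_le M.coe_nonneg] at hzM
        rw [real_tilted P ht measurableSet_Ioi]
        exact ((continuous_cumExp l).tendsto _).comp
          (tendsto_average_exp_Ioi hE ht (hz hzM.1.le))
    have herr : Tendsto (fun k => (M : ℝ) * (|l| * Real.exp |l|) / ((N k : ℕ) : ℝ)) atTop (𝓝 0) :=
      tendsto_const_nhds.div_atTop (tendsto_natCast_atTop hN)
    refine tendsto_of_tendsto_of_dist hmain (squeeze_zero (fun _ => dist_nonneg) (fun k => ?_) herr)
    have hn : (0 : ℝ) < ((N k : ℕ) : ℝ) := by exact_mod_cast (N k).pos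
    rw [← sum_truncated_increments (hy k), dist_comm, Real.dist_eq, Finset.sum_div,
      ← Finset.sum_sub_distrib]
    refine (Finset.abs_sum_le_sum_abs _ _).trans ?_
    calc _ ≤ ∑ _i : Fin (N k), (M : ℝ) * (|l| * Real.exp |l| / ((N k : ℕ) : ℝ) ^ 2) := by
          refine Finset.sum_le_sum fun i _ => ?_
          rw [mul_div_assoc, ← mul_sub, abs_mul, abs_of_nonneg (by positivity)]
          exact mul_le_mul (min_le_right _ _) (abs_increment_sub_le (hq k) l i) (abs_nonneg _)
            M.coe_nonneg
      _ = _ := by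
          rw [Finset.sum_const, Finset.card_univ, Fintype.card_fin, nsmul_eq_mul]
          field_simp

end sequences

/-! ### Approximation of the explicit formula -/

theorem abs_prod_sub_prod_le {ι : Type*} (s : Finset ι) {u v : ι → ℝ}
    (hu : ∀ i, u i ∈ Set.Icc (0 : ℝ) 1) (hv : ∀ i, v i ∈ Set.Icc (0 : ℝ) 1) :
    |∏ i ∈ s, u i - ∏ i ∈ s, v i| ≤ ∑ i ∈ s, |u i - v i| := by
  classical
  induction s using Finset.induction_on with
  | empty => simp
  | insert a s ha ih =>
    rw [Finset.prod_insert ha, Finset.prod_insert ha, Finset.sum_insert ha]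
    have hP : |∏ i ∈ s, v i| ≤ 1 := by
      rw [abs_of_nonneg (Finset.prod_nonneg fun i _ => (hv i).1)]
      exact Finset.prod_le_one (fun i _ => (hv i).1) fun i _ => (hv i).2
    have hua : |u a| ≤ 1 := by rw [abs_of_nonneg (hu a).1]; exact (hu a).2
    calc |u a * ∏ i ∈ s, u i - v a * ∏ i ∈ s, v i|
        = |(u a - v a) * ∏ i ∈ s, v i + u a * (∏ i ∈ s, u i - ∏ i ∈ s, v i)| := by congr 1; ring
      _ ≤ |u a - v a| * |∏ i ∈ s, v i| + |u a| * |∏ i ∈ s, u i - ∏ i ∈ s, v i| := by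
          rw [← abs_mul, ← abs_mul]; exact abs_add_le _ _
      _ ≤ |u a - v a| + ∑ i ∈ s, |u i - v i| :=
          add_le_add (mul_le_of_le_one_right (abs_nonneg _) hP)
            ((mul_le_of_le_one_left (abs_nonneg _) hua).trans ih)

theorem exp_neg_le_quadratic {x : ℝ} (hx : 0 ≤ x) : Real.exp (-x) ≤ 1 - x + x ^ 2 := by
  have h1 : 1 + x ≤ Real.exp x := by linarith [Real.add_one_le_exp x]
  have h2 : Real.exp (-x) ≤ 1 / (1 + x) := by
    rw [Real.exp_neg, ← one_div]
    exact one_div_le_one_div_of_le (by linarith) h1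
  refine h2.trans ?_
  rw [div_le_iff₀ (by linarith)]
  -- Here `(1 - x + x ^ 2) * (1 + x) = 1 + x ^ 3`.
  nlinarith [pow_nonneg hx 3]

/-- Both quantities lie between `1 - a * s` and `1 - a * s + a ^ 2`. -/
theorem abs_factor_sub_le {a s : ℝ} (ha : 0 ≤ a) (hs : s ∈ Set.Icc (0 : ℝ) 1) :
    |(1 - (1 - Real.exp (-a)) * s) - Real.exp (-(a * s))| ≤ a ^ 2 := by
  have h1 := exp_neg_le_quadratic ha
  have h2 := Real.add_one_le_exp (-a)
  have h3 := exp_neg_le_quadratic (mul_nonneg ha hs.1)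
  have h4 := Real.add_one_le_exp (-(a * s))
  have h5 : (a * s) ^ 2 ≤ a ^ 2 := by
    rw [mul_pow]; exact mul_le_of_le_one_right (sq_nonneg a) (pow_le_one₀ hs.1 hs.2)
  rw [abs_le]
  constructor
  · nlinarith [mul_nonneg (sub_nonneg.2 h2) hs.1, hs.1, hs.2]
  · nlinarith [mul_le_mul_of_nonneg_right h1 hs.1, hs.1, hs.2,
      mul_le_of_le_one_right (sq_nonneg a) hs.2]

/-- Each of the `n` factors is replaced by an exponential at cost `(l / n) ^ 2`, and the outer sum
is weighted by probabilities, so the total error is `l ^ 2 / n`. -/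
theorem abs_outFormula_sub_le {n : ℕ} {p : Fin n → ℝ} (hp : ∀ i, 0 ≤ p i) (hsum : ∑ i, p i = 1)
    {T l : ℝ} (hT : 0 ≤ T) (hl : 0 ≤ l) :
    |outFormula p T (l / n) -
      Real.exp (-(l * (1 - (∑ j, Real.exp (-(p j * T))) / n))) *
        ∑ i, p i * (Real.exp (-(p i * T)) *
          Real.exp (-(l * partialAverage (fun j => Real.exp (-(p j * T))) (i + 1))))|
      ≤ l ^ 2 / n := by
  have hn : (0 : ℝ) < n := by
    rcases Nat.eq_zero_or_pos n with rfl | h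
    · simp at hsum
    · exact_mod_cast h
  set q : Fin n → ℝ := fun j => Real.exp (-(p j * T)) with hq
  have hq01 : ∀ j, q j ∈ Set.Icc (0 : ℝ) 1 := fun j =>
    ⟨Real.exp_nonneg _, Real.exp_le_one_iff.2 (by have := mul_nonneg (hp j) hT; linarith)⟩
  set a := l / n with ha
  have ha0 : 0 ≤ a := div_nonneg hl hn.le
  set s : Fin n → Fin n → ℝ := fun i j => 1 - if j ≤ i then 0 else q j with hs
  have hs01 : ∀ i j, s i j ∈ Set.Icc (0 : ℝ) 1 := fun i j => by
    simp only [hs]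
    split_ifs
    · simp
    · constructor <;> linarith [(hq01 j).1, (hq01 j).2]
  have hprodv : ∀ i, ∏ j, Real.exp (-(a * s i j))
      = Real.exp (-(l * (1 - (∑ j, q j) / n))) * Real.exp (-(l * partialAverage q (i + 1))) := by
    intro i
    rw [← Real.exp_sum, ← Real.exp_add]
    congr 1
    rw [Finset.sum_neg_distrib, ← Finset.mul_sum, ← neg_add, ← mul_add]
    -- The prefix stops at `i + 1` because the condition `j ≤ i` includes `i` itself.
    have h1 : ∑ j, s i j = n - ((∑ j, q j) - ∑ j : Fin n, if (j : ℕ) < i + 1 then q j else 0) := by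
      have h2 : ∀ j : Fin n, s i j = 1 - (q j - if (j : ℕ) < i + 1 then q j else 0) := by
        intro j
        have h : j ≤ i ↔ (j : ℕ) < i + 1 := by rw [Fin.le_def]; omega
        simp only [hs, h]
        split_ifs <;> ring
      simp_rw [h2]
      rw [Finset.sum_sub_distrib, Finset.sum_sub_distrib]
      simp
    rw [h1, partialAverage, ha]
    field_simp
    ring
  have hterm : ∀ i, |(∏ j, if j ≤ i then Real.exp (-a) else Real.exp (-a) + (1 - Real.exp (-a)) * q j)
      - Real.exp (-(l * (1 - (∑ j, q j) / n))) * Real.exp (-(l * partialAverage q (i + 1)))|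
      ≤ l ^ 2 / n := by
    intro i
    rw [← hprodv i]
    have hu : ∀ j, (if j ≤ i then Real.exp (-a) else Real.exp (-a) + (1 - Real.exp (-a)) * q j)
        = 1 - (1 - Real.exp (-a)) * s i j := by
      intro j; simp only [hs]; split_ifs <;> ring
    simp_rw [hu]
    have he1 : Real.exp (-a) ≤ 1 := Real.exp_le_one_iff.2 (by linarith)
    refine (abs_prod_sub_prod_le Finset.univ (fun j => ?_) fun j => ?_).trans ?_
    · have h1 := mul_nonneg (sub_nonneg.2 he1) (hs01 i j).1
      have h2 := mul_le_of_le_one_right (sub_nonneg.2 he1) (hs01 i j).2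
      constructor <;> linarith [Real.exp_nonneg (-a)]
    · exact ⟨Real.exp_nonneg _, Real.exp_le_one_iff.2 (by
        have := mul_nonneg ha0 (hs01 i j).1; linarith)⟩
    · calc _ ≤ ∑ _j : Fin n, a ^ 2 :=
            Finset.sum_le_sum fun j _ => abs_factor_sub_le ha0 (hs01 i j)
        _ = l ^ 2 / n := by
            rw [Finset.sum_const, Finset.card_univ, Fintype.card_fin, nsmul_eq_mul, ha]
            field_simp
  have hform : outFormula p T a = ∑ i, p i * q i *
      ∏ j, if j ≤ i then Real.exp (-a) else Real.exp (-a) + (1 - Real.exp (-a)) * q j := rfl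
  rw [hform, Finset.mul_sum, ← Finset.sum_sub_distrib]
  refine (Finset.abs_sum_le_sum_abs _ _).trans ?_
  calc _ ≤ ∑ i, p i * (l ^ 2 / n) := by
        refine Finset.sum_le_sum fun i _ => ?_
        have : p i * q i * (∏ j, if j ≤ i then Real.exp (-a)
              else Real.exp (-a) + (1 - Real.exp (-a)) * q j)
            - Real.exp (-(l * (1 - (∑ j, q j) / n))) *
              (p i * (q i * Real.exp (-(l * partialAverage q (i + 1)))))
            = p i * (q i * ((∏ j, if j ≤ i then Real.exp (-a)
              else Real.exp (-a) + (1 - Real.exp (-a)) * q j) -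
              Real.exp (-(l * (1 - (∑ j, q j) / n))) *
                Real.exp (-(l * partialAverage q (i + 1))))) := by ring
        change |p i * q i * _ - _| ≤ _
        rw [this, abs_mul, abs_mul, abs_of_nonneg (hp i), abs_of_nonneg (hq01 i).1]
        exact mul_le_mul_of_nonneg_left
          ((mul_le_of_le_one_left (abs_nonneg _) (hq01 i).2).trans (hterm i)) (hp i)
    _ = l ^ 2 / n := by rw [← Finset.sum_mul, hsum, one_mul]

/-- The weighted average which governs the limit of the explicit formula. -/
def weightedAverage {n : ℕ} (y : Fin n → ℝ≥0) (t l : ℝ) : ℝ :=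
  (∑ i, (y i : ℝ) * (Real.exp (-((y i : ℝ) * t)) *
    Real.exp (-(l * partialAverage (fun j => Real.exp (-((y j : ℝ) * t))) (i + 1))))) / (n : ℝ)

theorem abs_outFormula_popularity_sub_le {n : ℕ+} {y : Fin n → ℝ≥0} {μ : ℝ} (hμ : 0 < μ)
    (hsum : ∑ i, (y i : ℝ) = ((n : ℕ) : ℝ) * μ) {t l : ℝ} (ht : 0 ≤ t) (hl : 0 ≤ l) :
    |outFormula (popularity y) ((n : ℕ) * μ * t) (l / (n : ℕ)) -
      Real.exp (-(l * (1 - (∑ j, Real.exp (-((y j : ℝ) * t))) / ((n : ℕ) : ℝ)))) *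
        (1 / μ * weightedAverage y t l)| ≤ l ^ 2 / ((n : ℕ) : ℝ) := by
  have hn : (0 : ℝ) < ((n : ℕ) : ℝ) := by exact_mod_cast n.pos
  have hT : 0 ≤ ((n : ℕ) : ℝ) * μ * t := by positivity
  have h := abs_outFormula_sub_le (popularity_nonneg y)
    (sum_popularity (by rw [hsum]; positivity)) hT hl
  have hpT : ∀ i, popularity y i * (((n : ℕ) : ℝ) * μ * t) = y i * t := fun i => by
    rw [popularity, hsum]; field_simp
  simp_rw [hpT] at h
  convert h using 4
  rw [weightedAverage, Finset.sum_div, Finset.mul_sum]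
  refine Finset.sum_congr rfl fun i _ => ?_
  rw [popularity, hsum]; field_simp

/-! ### Reduction to the weighted average, and its limit for increasing weights -/

section sequences
variable {P : ProbabilityMeasure ℝ≥0} {N : ℕ → ℕ+} {y : ∀ k, Fin (N k) → ℝ≥0}

theorem tendsto_outFormula_of_weightedAverage (hμ : 0 < mean P) (hN : Tendsto N atTop atTop)
    (hsum : ∀ k, ∑ i, (y k i : ℝ) = ((N k : ℕ) : ℝ) * mean P)
    (hE : Tendsto (fun k => empirical (N k) (y k)) atTop (𝓝 P)) {t l : ℝ} (ht : 0 ≤ t)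
    (hl : 0 ≤ l) {J : ℝ} (hJ : Tendsto (fun k => weightedAverage (y k) t l) atTop (𝓝 J)) :
    Tendsto (fun k => outFormula (popularity (y k)) ((N k : ℕ) * mean P * t) (l / (N k : ℕ))) atTop
      (𝓝 (1 / mean P * J * Real.exp (-(l * (1 - laplace P t))))) := by
  have h1 : Tendsto (fun k => Real.exp (-(l * (1 - (∑ j, Real.exp (-((y k j : ℝ) * t)))
      / ((N k : ℕ) : ℝ)))) * (1 / mean P * weightedAverage (y k) t l)) atTop
      (𝓝 (Real.exp (-(l * (1 - laplace P t))) * (1 / mean P * J))) :=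
    Tendsto.mul ((Real.continuous_exp.tendsto _).comp
      ((tendsto_const_nhds.sub (tendsto_average_exp hE ht)).const_mul l).neg) (hJ.const_mul _)
  rw [mul_comm (Real.exp _)] at h1
  have herr : Tendsto (fun k => l ^ 2 / ((N k : ℕ) : ℝ)) atTop (𝓝 0) :=
    tendsto_const_nhds.div_atTop (tendsto_natCast_atTop hN)
  refine tendsto_of_tendsto_of_dist h1 (squeeze_zero (fun _ => dist_nonneg) (fun k => ?_) herr)
  rw [dist_comm, Real.dist_eq]
  exact abs_outFormula_popularity_sub_le hμ (hsum k) ht hl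

/-! ### Increasing weights -/

/-- Reversal sends the prefix that includes the current index to the complement of a prefix that
excludes it, hence `i + 1` on one side and `i` on the other. -/
theorem partialAverage_rev {n : ℕ} (q : Fin n → ℝ) (i : Fin n) :
    partialAverage q ((Fin.rev i : Fin n) + 1)
      = (∑ j, q j) / n - partialAverage (fun j => q (Fin.rev j)) i := by
  unfold partialAverage
  rw [← sub_div]
  congr 1
  rw [← Equiv.sum_comp Fin.revPerm, ← Equiv.sum_comp Fin.revPerm q, ← Finset.sum_sub_distrib]
  refine Finset.sum_congr rfl fun j _ => ?_
  simp only [Fin.revPerm_apply, Fin.val_rev]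
  by_cases h : (j : ℕ) < i
  · rw [if_pos h, if_neg (by omega), sub_self]
  · rw [if_neg h, if_pos (by omega), sub_zero]

/-- Complementing the prefix flips the sign of `l` and produces the constant factor. The mismatch
between prefixes `i` and `i + 1` is a single term of size at most `1 / n`. -/
theorem abs_weightedAverage_rev_sub_le {n : ℕ+} {y : Fin n → ℝ≥0} {μ : ℝ}
    (hsum : ∑ i, (y i : ℝ) = ((n : ℕ) : ℝ) * μ) {t l : ℝ} (ht : 0 ≤ t) (hl : 0 ≤ l) :
    |weightedAverage y t l - Real.exp (-(l * ((∑ j, Real.exp (-((y j : ℝ) * t))) / ((n : ℕ) : ℝ)))) *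
      weightedAverage (fun i => y (Fin.rev i)) t (-l)| ≤ μ * Real.exp l * l / ((n : ℕ) : ℝ) := by
  have hn : (0 : ℝ) < ((n : ℕ) : ℝ) := by exact_mod_cast n.pos
  set q : Fin n → ℝ := fun j => Real.exp (-((y j : ℝ) * t)) with hq
  set q' : Fin n → ℝ := fun j => q (Fin.rev j) with hq'
  have hq01 : ∀ j, q j ∈ Set.Icc (0 : ℝ) 1 := fun j => exp_neg_mul_mem ht _
  set C := (∑ j, q j) / ((n : ℕ) : ℝ) with hC
  have hC0 : 0 ≤ C := div_nonneg (Finset.sum_nonneg fun j _ => (hq01 j).1) hn.le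
  have hw : weightedAverage y t l = (∑ i, (y (Fin.rev i) : ℝ) * (q' i *
      (Real.exp (-(l * C)) * Real.exp (-((-l) * partialAverage q' (i + 1))) *
        Real.exp (-(l * (q' i / (n : ℕ))))))) / ((n : ℕ) : ℝ) := by
    unfold weightedAverage
    rw [← Equiv.sum_comp Fin.revPerm]
    congr 1
    refine Finset.sum_congr rfl fun i _ => ?_
    have hexp : Real.exp (-(l * (C - partialAverage q' i)))
        = Real.exp (-(l * C)) * Real.exp (-((-l) * partialAverage q' (i + 1))) *
          Real.exp (-(l * (q' i / (n : ℕ)))) := by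
      rw [← Real.exp_add, ← Real.exp_add, partialAverage_succ]
      congr 1; ring
    rw [Fin.revPerm_apply, partialAverage_rev]
    exact congrArg (fun z => (y (Fin.rev i) : ℝ) * (q' i * z)) hexp
  have hsum' : ∑ i, (y (Fin.rev i) : ℝ) = ((n : ℕ) : ℝ) * μ := by
    rw [← hsum]; exact Equiv.sum_comp Fin.revPerm fun i => (y i : ℝ)
  rw [hw, weightedAverage, ← mul_div_assoc (Real.exp (-(l * C))), ← sub_div, abs_div, abs_of_pos hn,
    div_le_div_iff_of_pos_right hn, Finset.mul_sum, ← Finset.sum_sub_distrib]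
  refine (Finset.abs_sum_le_sum_abs _ _).trans ?_
  calc _ ≤ ∑ i, (y (Fin.rev i) : ℝ) * (Real.exp l * (l / ((n : ℕ) : ℝ))) := by
        refine Finset.sum_le_sum fun i _ => ?_
        have h1 := partialAverage_mem (q := q') (fun j => hq01 _) (i + 1)
        have h2 : Real.exp (-((-l) * partialAverage q' (i + 1))) ≤ Real.exp l := by
          have := exp_neg_mul_le_exp_abs (l := -l) h1.1 h1.2
          rwa [abs_neg, abs_of_nonneg hl] at this
        have h3 : Real.exp (-(l * C)) ≤ 1 :=
          Real.exp_le_one_iff.2 (by have := mul_nonneg hl hC0; linarith)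
        have h4 : |Real.exp (-(l * (q' i / (n : ℕ)))) - 1| ≤ l / ((n : ℕ) : ℝ) := by
          have h5 : 0 ≤ l * (q' i / (n : ℕ)) := mul_nonneg hl (div_nonneg (hq01 _).1 hn.le)
          have h6 : l * (q' i / (n : ℕ)) ≤ l * (1 / (n : ℕ)) :=
            mul_le_mul_of_nonneg_left (div_le_div_of_nonneg_right (hq01 _).2 hn.le) hl
          have h7 := Real.add_one_le_exp (-(l * (q' i / (n : ℕ))))
          have h8 : Real.exp (-(l * (q' i / (n : ℕ)))) ≤ 1 := Real.exp_le_one_iff.2 (by linarith)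
          rw [abs_of_nonpos (by linarith)]
          rw [mul_one_div] at h6
          linarith
        have h9 : (y (Fin.rev i) : ℝ) * (q' i *
            (Real.exp (-(l * C)) * Real.exp (-((-l) * partialAverage q' (i + 1))) *
              Real.exp (-(l * (q' i / (n : ℕ))))))
            - Real.exp (-(l * C)) * ((y (Fin.rev i) : ℝ) * (q' i *
              Real.exp (-((-l) * partialAverage q' (i + 1)))))
            = (y (Fin.rev i) : ℝ) * (q' i * Real.exp (-(l * C)) *
              (Real.exp (-((-l) * partialAverage q' (i + 1))) *
                (Real.exp (-(l * (q' i / (n : ℕ)))) - 1))) := by ring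
        change |_ - Real.exp (-(l * C)) * ((y (Fin.rev i) : ℝ) * (q' i *
              Real.exp (-((-l) * partialAverage q' (i + 1)))))| ≤ _
        rw [h9, abs_mul, abs_of_nonneg (NNReal.coe_nonneg _)]
        refine mul_le_mul_of_nonneg_left ?_ (NNReal.coe_nonneg _)
        rw [abs_mul, abs_mul, abs_mul, abs_of_nonneg (hq01 _).1, Real.abs_exp, Real.abs_exp]
        calc _ ≤ 1 * (Real.exp (-((-l) * partialAverage q' (i + 1))) *
              |Real.exp (-(l * (q' i / (n : ℕ)))) - 1|) :=
              mul_le_mul_of_nonneg_right (mul_le_one₀ (hq01 _).2 (Real.exp_nonneg _) h3)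
                (by positivity)
          _ ≤ _ := by rw [one_mul]; gcongr
    _ = _ := by rw [← Finset.sum_mul, hsum']; field_simp

theorem empirical_comp_perm {n : ℕ+} (y : Fin n → ℝ≥0) (σ : Equiv.Perm (Fin n)) :
    empirical n (fun i => y (σ i)) = empirical n y := by
  refine Subtype.ext ?_
  change ((n : ℕ) : ℝ≥0∞)⁻¹ • ∑ i, Measure.dirac (y (σ i))
    = ((n : ℕ) : ℝ≥0∞)⁻¹ • ∑ i, Measure.dirac (y i)
  rw [Equiv.sum_comp σ fun i => Measure.dirac (y i)]

theorem tendsto_weightedAverage_antitone (hN : Tendsto N atTop atTop)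
    (hint : Integrable (fun x : ℝ≥0 => (x : ℝ)) (P : Measure ℝ≥0))
    (hsum : ∀ k, ∑ i, (y k i : ℝ) = ((N k : ℕ) : ℝ) * mean P)
    (hE : Tendsto (fun k => empirical (N k) (y k)) atTop (𝓝 P))
    (hy : ∀ k, Antitone (y k)) {t : ℝ} (ht : 0 ≤ t) (l : ℝ) :
    Tendsto (fun k => weightedAverage (y k) t l) atTop
      (𝓝 (∫ x : ℝ≥0, (x : ℝ) * (Real.exp (-((x : ℝ) * t)) *
        stepAverage l ((tilted P t).real (Set.Ioi x)) ((tilted P t).real {x}))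
        ∂(P : Measure ℝ≥0))) :=
  tendsto_antitone_average hN hint hsum hE hy ht l

/-- Substitute `1 - u` for `u` and write `a + (1 - u) * b = (a + b + c) - (c + u * b)`. With `a`,
`b`, `c` the masses below, at and above a point, this is the limiting form of the reversal. -/
theorem stepAverage_reflect (l a b c : ℝ) :
    stepAverage l a b = Real.exp (-(l * (a + b + c))) * stepAverage (-l) c b := by
  unfold stepAverage
  have := intervalIntegral.integral_comp_sub_left (a := (0 : ℝ)) (b := 1)
    (fun u => Real.exp (-(l * (a + u * b)))) 1
  rw [sub_self, sub_zero] at this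
  rw [← this, ← intervalIntegral.integral_const_mul]
  congr 1
  ext u
  rw [← Real.exp_add]
  congr 1; ring

theorem tendsto_weightedAverage_monotone (hN : Tendsto N atTop atTop)
    (hint : Integrable (fun x : ℝ≥0 => (x : ℝ)) (P : Measure ℝ≥0))
    (hsum : ∀ k, ∑ i, (y k i : ℝ) = ((N k : ℕ) : ℝ) * mean P)
    (hE : Tendsto (fun k => empirical (N k) (y k)) atTop (𝓝 P))
    (hy : ∀ k, Monotone (y k)) {t l : ℝ} (ht : 0 ≤ t) (hl : 0 ≤ l) :
    Tendsto (fun k => weightedAverage (y k) t l) atTop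
      (𝓝 (∫ x : ℝ≥0, (x : ℝ) * (Real.exp (-((x : ℝ) * t)) *
        stepAverage l ((tilted P t).real (Set.Iio x)) ((tilted P t).real {x}))
        ∂(P : Measure ℝ≥0))) := by
  have hν := isFiniteMeasure_tilted P ht
  have h1 := tendsto_weightedAverage_antitone (y := fun k i => y k (Fin.rev i)) hN hint
    (fun k => by rw [← hsum k]; exact Equiv.sum_comp Fin.revPerm fun i => (y k i : ℝ))
    (hE.congr fun k => (empirical_comp_perm (y k) Fin.revPerm).symm)
    (fun k i j hij => hy k (Fin.rev_le_rev.2 hij)) ht (-l)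
  have h2 := ((Real.continuous_exp.tendsto _).comp
    ((tendsto_average_exp hE ht).const_mul l).neg).mul h1
  have hJ : Real.exp (-(l * laplace P t)) * ∫ x : ℝ≥0, (x : ℝ) * (Real.exp (-((x : ℝ) * t)) *
        stepAverage (-l) ((tilted P t).real (Set.Ioi x)) ((tilted P t).real {x}))
        ∂(P : Measure ℝ≥0)
      = ∫ x : ℝ≥0, (x : ℝ) * (Real.exp (-((x : ℝ) * t)) *
        stepAverage l ((tilted P t).real (Set.Iio x)) ((tilted P t).real {x}))
        ∂(P : Measure ℝ≥0) := by
    rw [← integral_const_mul]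
    refine integral_congr_ae (Eventually.of_forall fun x => ?_)
    have h3 : laplace P t = (tilted P t).real (Set.Iio x) + (tilted P t).real {x}
        + (tilted P t).real (Set.Ioi x) := by
      rw [add_assoc, add_comm _ ((tilted P t).real (Set.Ioi x)), ← real_Ici_eq,
        ← real_tilted_univ P ht, ← measureReal_union _ measurableSet_Ici, Set.Iio_union_Ici]
      exact (Set.disjoint_left.2 fun a h1 h2 => not_lt.2 (show x ≤ a from h2) (show a < x from h1))
    simp only
    rw [stepAverage_reflect l _ _ ((tilted P t).real (Set.Ioi x)), h3]
    ring
  rw [hJ] at h2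
  have herr : Tendsto (fun k => mean P * Real.exp l * l / ((N k : ℕ) : ℝ)) atTop (𝓝 0) :=
    tendsto_const_nhds.div_atTop (tendsto_natCast_atTop hN)
  refine tendsto_of_tendsto_of_dist h2 (squeeze_zero (fun _ => dist_nonneg) (fun k => ?_) herr)
  rw [dist_comm, Real.dist_eq]
  exact abs_weightedAverage_rev_sub_le (hsum k) ht hl

end sequences

/-! ### Averages over permutations -/

section permAverage
variable {n : ℕ}

/-- The average of `f` over the permutations of `Fin n`. -/
def permAverage (f : Equiv.Perm (Fin n) → ℝ) : ℝ :=
  (∑ σ, f σ) / (Fintype.card (Equiv.Perm (Fin n)) : ℝ)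

theorem card_perm_pos : (0 : ℝ) < (Fintype.card (Equiv.Perm (Fin n)) : ℝ) := by
  exact_mod_cast Fintype.card_pos

theorem permAverage_const (c : ℝ) : permAverage (fun _ : Equiv.Perm (Fin n) => c) = c := by
  rw [permAverage, Finset.sum_const, Finset.card_univ, nsmul_eq_mul,
    mul_div_cancel_left₀ _ card_perm_pos.ne']

theorem permAverage_mono {f g : Equiv.Perm (Fin n) → ℝ} (h : ∀ σ, f σ ≤ g σ) :
    permAverage f ≤ permAverage g :=
  div_le_div_of_nonneg_right (Finset.sum_le_sum fun σ _ => h σ) card_perm_pos.le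

theorem permAverage_add (f g : Equiv.Perm (Fin n) → ℝ) :
    permAverage (fun σ => f σ + g σ) = permAverage f + permAverage g := by
  unfold permAverage; rw [Finset.sum_add_distrib, add_div]

theorem permAverage_sub (f g : Equiv.Perm (Fin n) → ℝ) :
    permAverage (fun σ => f σ - g σ) = permAverage f - permAverage g := by
  unfold permAverage; rw [Finset.sum_sub_distrib, sub_div]

theorem permAverage_const_mul (c : ℝ) (f : Equiv.Perm (Fin n) → ℝ) :
    permAverage (fun σ => c * f σ) = c * permAverage f := by
  unfold permAverage; rw [← Finset.mul_sum, mul_div_assoc]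

theorem permAverage_div (c : ℝ) (f : Equiv.Perm (Fin n) → ℝ) :
    permAverage (fun σ => f σ / c) = permAverage f / c := by
  unfold permAverage; rw [← Finset.sum_div, div_right_comm]

theorem permAverage_sum {ι : Type*} (s : Finset ι) (f : ι → Equiv.Perm (Fin n) → ℝ) :
    permAverage (fun σ => ∑ i ∈ s, f i σ) = ∑ i ∈ s, permAverage (f i) := by
  unfold permAverage; rw [Finset.sum_comm, Finset.sum_div]

theorem abs_permAverage_le (f : Equiv.Perm (Fin n) → ℝ) :
    |permAverage f| ≤ permAverage fun σ => |f σ| := by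
  unfold permAverage
  rw [abs_div, abs_of_pos card_perm_pos]
  exact div_le_div_of_nonneg_right (Finset.abs_sum_le_sum_abs _ _) card_perm_pos.le

theorem abs_permAverage_le_of_forall {f : Equiv.Perm (Fin n) → ℝ} {c : ℝ} (h : ∀ σ, |f σ| ≤ c) :
    |permAverage f| ≤ c :=
  (abs_permAverage_le f).trans ((permAverage_mono h).trans_eq (permAverage_const c))

theorem permAverage_comp_mul (f : Equiv.Perm (Fin n) → ℝ) (τ : Equiv.Perm (Fin n)) :
    permAverage (fun σ => f (σ * τ)) = permAverage f := by
  unfold permAverage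
  rw [← Equiv.sum_comp (Equiv.mulRight τ) f]
  rfl

/-- Transpositions show that the average does not depend on `i`, and the sum over `i` is the same
for every permutation. -/
theorem permAverage_apply (g : Fin n → ℝ) (i : Fin n) :
    permAverage (fun σ => g (σ i)) = (∑ j, g j) / n := by
  have hn : (n : ℝ) ≠ 0 := by have := i.pos; positivity
  have h1 : ∀ j, permAverage (fun σ => g (σ j)) = permAverage (fun σ => g (σ i)) := by
    intro j
    rw [← permAverage_comp_mul _ (Equiv.swap i j)]
    simp
  rw [eq_div_iff hn]
  have h2 : ∑ j : Fin n, permAverage (fun σ => g (σ j)) = ∑ j, g j := by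
    rw [← permAverage_sum]
    have : ∀ σ : Equiv.Perm (Fin n), ∑ j, g (σ j) = ∑ j, g j := fun σ => Equiv.sum_comp σ g
    simp_rw [this]
    exact permAverage_const _
  simp_rw [h1] at h2
  rw [← h2]
  simp [mul_comm]

theorem permAverage_pair (q : Fin n → ℝ) {j k j' k' : Fin n} (h : j ≠ k) (h' : j' ≠ k') :
    permAverage (fun σ => q (σ j) * q (σ k)) = permAverage (fun σ => q (σ j') * q (σ k')) := by
  -- Two-transitivity: first send `j` to `j'`, then move the image of `k` to `k'` by a transposition
  -- fixing `j'`.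
  set τ : Equiv.Perm (Fin n) := Equiv.swap k' (Equiv.swap j j' k) * Equiv.swap j j' with hτ
  have hj : τ j = j' := by
    rw [hτ, Equiv.Perm.mul_apply, Equiv.swap_apply_left]
    refine Equiv.swap_apply_of_ne_of_ne h' fun hc => h ?_
    have := congrArg (Equiv.swap j j') hc
    simpa using this
  have hk : τ k = k' := by
    rw [hτ, Equiv.Perm.mul_apply, Equiv.swap_apply_right]
  rw [← permAverage_comp_mul (fun σ => q (σ j) * q (σ k)) 1,
    ← permAverage_comp_mul (fun σ => q (σ j') * q (σ k')) 1,
    ← permAverage_comp_mul (fun σ => q ((σ * 1) j) * q ((σ * 1) k)) τ]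
  simp [hj, hk]

/-- All mixed moments share a value `c ≥ 0`. As the coefficients sum to zero, `c` contributes
nothing to the full double sum, and only `n` diagonal corrections, each at most one, remain. -/
theorem permAverage_sq_le {q a : Fin n → ℝ} (hq : ∀ j, q j ∈ Set.Icc (0 : ℝ) 1)
    (ha : ∀ j, |a j| ≤ 1) (hsum : ∑ j, a j = 0) :
    permAverage (fun σ => (∑ j, a j * q (σ j)) ^ 2) ≤ n := by
  obtain ⟨c, hc0, hc⟩ : ∃ c : ℝ, 0 ≤ c ∧ ∀ j k : Fin n, j ≠ k →
      permAverage (fun σ => q (σ j) * q (σ k)) = c := by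
    by_cases h : ∃ j k : Fin n, j ≠ k
    · obtain ⟨j, k, hjk⟩ := h
      refine ⟨permAverage (fun σ => q (σ j) * q (σ k)), ?_, fun j' k' h' =>
        permAverage_pair q h' hjk⟩
      exact div_nonneg (Finset.sum_nonneg fun σ _ => mul_nonneg (hq _).1 (hq _).1)
        card_perm_pos.le
    · push Not at h
      exact ⟨0, le_rfl, fun j k hjk => absurd (h j k) hjk⟩
  have hd : ∀ j, permAverage (fun σ => q (σ j) * q (σ j)) ≤ 1 := by
    intro j
    refine (permAverage_mono fun σ => ?_).trans_eq (permAverage_const 1)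
    exact mul_le_one₀ (hq _).2 (hq _).1 (hq _).2
  have hexp : permAverage (fun σ => (∑ j, a j * q (σ j)) ^ 2)
      = ∑ j, ∑ k, a j * a k * permAverage (fun σ => q (σ j) * q (σ k)) := by
    simp_rw [sq, Finset.sum_mul_sum]
    rw [permAverage_sum]
    refine Finset.sum_congr rfl fun j _ => ?_
    rw [permAverage_sum]
    refine Finset.sum_congr rfl fun k _ => ?_
    rw [← permAverage_const_mul]
    congr 1; ext σ; ring
  have hterm : ∀ j k, a j * a k * permAverage (fun σ => q (σ j) * q (σ k))
      = a j * a k * c + if k = j then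
        a j ^ 2 * (permAverage (fun σ => q (σ j) * q (σ j)) - c) else 0 := by
    intro j k
    by_cases h : k = j
    · subst h; rw [if_pos rfl]; ring
    · rw [if_neg h, hc j k (Ne.symm h), add_zero]
  rw [hexp]
  simp_rw [hterm, Finset.sum_add_distrib, ← Finset.sum_mul, ← Finset.mul_sum, hsum]
  simp only [mul_zero, zero_mul, Finset.sum_const_zero, zero_add, Finset.sum_ite_eq',
    Finset.mem_univ, if_true]
  calc _ ≤ ∑ _j : Fin n, (1 : ℝ) := by
        refine Finset.sum_le_sum fun j _ => ?_
        have h1 : a j ^ 2 ≤ 1 := by rw [← sq_abs]; exact pow_le_one₀ (abs_nonneg _) (ha j)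
        have h2 := hd j
        nlinarith [sq_nonneg (a j)]
    _ = n := by simp

/-- Sampling without replacement: the deviation is a sum with centred coefficients, of second moment
at most `1 / n`. -/
theorem permAverage_abs_partialAverage_sub_le {q : Fin n → ℝ}
    (hq : ∀ j, q j ∈ Set.Icc (0 : ℝ) 1) (hn : 0 < n) {r : ℕ} (hr : r ≤ n) :
    permAverage (fun σ => |partialAverage (fun j => q (σ j)) r - r / n * ((∑ j, q j) / n)|)
      ≤ 1 / √(n : ℝ) := by
  have hn' : (0 : ℝ) < n := by exact_mod_cast hn
  set a : Fin n → ℝ := fun j => (if (j : ℕ) < r then 1 else 0) - (r : ℝ) / n with ha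
  have hrn : (r : ℝ) / n ∈ Set.Icc (0 : ℝ) 1 :=
    ⟨by positivity, div_le_one_of_le₀ (by exact_mod_cast hr) hn'.le⟩
  have ha1 : ∀ j, |a j| ≤ 1 := fun j => by
    simp only [ha]
    rw [abs_le]
    split_ifs <;> constructor <;> linarith [hrn.1, hrn.2]
  have hcard : ∑ j : Fin n, (if (j : ℕ) < r then (1 : ℝ) else 0) = r := by
    have := sum_increments (n := n) (fun k => (k : ℝ)) hr
    simpa using this
  have ha0 : ∑ j, a j = 0 := by
    simp only [ha, Finset.sum_sub_distrib, hcard]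
    simp only [Finset.sum_const, Finset.card_univ, Fintype.card_fin, nsmul_eq_mul]
    field_simp
    ring
  have hX : ∀ σ : Equiv.Perm (Fin n), partialAverage (fun j => q (σ j)) r
      - r / n * ((∑ j, q j) / n) = (∑ j, a j * q (σ j)) / n := by
    intro σ
    rw [partialAverage, ← Equiv.sum_comp σ q, mul_div_assoc', ← sub_div]
    congr 1
    rw [Finset.mul_sum, ← Finset.sum_sub_distrib]
    refine Finset.sum_congr rfl fun j _ => ?_
    simp only [ha]
    split_ifs <;> ring
  have hs : 0 < √(n : ℝ) := Real.sqrt_pos.2 hn'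
  have hss : √(n : ℝ) * √(n : ℝ) = n := Real.mul_self_sqrt hn'.le
  -- The inequality `|x| ≤ √n * x ^ 2 / 2 + 1 / (2 * √n)` passes from second to first moment in
  -- place of Cauchy–Schwarz.
  have hb : ∀ σ : Equiv.Perm (Fin n), |partialAverage (fun j => q (σ j)) r
      - r / n * ((∑ j, q j) / n)|
      ≤ √(n : ℝ) / (2 * n ^ 2) * (∑ j, a j * q (σ j)) ^ 2 + 1 / (2 * √(n : ℝ)) := by
    intro σ
    rw [hX]
    set S := ∑ j, a j * q (σ j)
    have h1 := sq_nonneg (√(n : ℝ) * |S / n| - 1)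
    have h2 : |S / n| ^ 2 = S ^ 2 / n ^ 2 := by rw [sq_abs, div_pow]
    have h3 : √(n : ℝ) / (2 * n ^ 2) * S ^ 2 + 1 / (2 * √(n : ℝ)) - |S / n|
        = (√(n : ℝ) * |S / n| - 1) ^ 2 / (2 * √(n : ℝ)) := by
      rw [sub_sq, mul_pow, h2]
      field_simp
      ring
    have h4 := div_nonneg h1 (by positivity : (0 : ℝ) ≤ 2 * √(n : ℝ))
    linarith
  calc _ ≤ permAverage (fun σ : Equiv.Perm (Fin n) =>
        √(n : ℝ) / (2 * n ^ 2) * (∑ j, a j * q (σ j)) ^ 2 + 1 / (2 * √(n : ℝ))) :=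
        permAverage_mono hb
    _ ≤ √(n : ℝ) / (2 * n ^ 2) * n + 1 / (2 * √(n : ℝ)) := by
        rw [permAverage_add, permAverage_const_mul, permAverage_const]
        gcongr
        exact permAverage_sq_le hq ha1 ha0
    _ = 1 / √(n : ℝ) := by
        field_simp
        nlinarith

end permAverage

theorem abs_exp_neg_sub_le {x y : ℝ} (hx : 0 ≤ x) (hy : 0 ≤ y) :
    |Real.exp (-x) - Real.exp (-y)| ≤ |x - y| := by
  have key : ∀ x y : ℝ, 0 ≤ x → x ≤ y → Real.exp (-x) - Real.exp (-y) ≤ y - x := by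
    intro x y hx hxy
    have h1 : Real.exp (-y) = Real.exp (-x) * Real.exp (-(y - x)) := by
      rw [← Real.exp_add]; congr 1; ring
    have h2 := Real.add_one_le_exp (-(y - x))
    have h3 : Real.exp (-x) ≤ 1 := Real.exp_le_one_iff.2 (by linarith)
    rw [h1]
    nlinarith [Real.exp_nonneg (-x)]
  rcases le_total x y with h | h
  · rw [abs_of_nonneg (sub_nonneg.2 (Real.exp_le_exp.2 (by linarith))),
      abs_of_nonpos (by linarith)]
    linarith [key x y hx h]
  · rw [abs_of_nonpos (sub_nonpos.2 (Real.exp_le_exp.2 (by linarith))),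
      abs_of_nonneg (by linarith)]
    linarith [key y x hy h]

theorem abs_riemannSum_sub_le {n : ℕ} (hn : 0 < n) {c : ℝ} (hc : 0 ≤ c) :
    |(∑ i : Fin n, Real.exp (-(c * (((i : ℕ) + 1 : ℕ) / (n : ℝ))))) / n - stepAverage c 0 1| ≤ c / n := by
  have hn' : (0 : ℝ) < n := by exact_mod_cast hn
  have hint : ∀ a b : ℝ, IntervalIntegrable (fun u => Real.exp (-(c * u))) volume a b :=
    fun a b => intervalIntegrable_exp c a b
  have h1 : stepAverage c 0 1 = ∑ i : Fin n, ∫ u in ((i : ℕ) / n : ℝ)..(((i : ℕ) + 1 : ℕ) / n : ℝ),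
      Real.exp (-(c * u)) := by
    rw [Fin.sum_univ_eq_sum_range (fun i => ∫ u in ((i : ℕ) / n : ℝ)..(((i : ℕ) + 1 : ℕ) / n : ℝ),
      Real.exp (-(c * u))) n, intervalIntegral.sum_integral_adjacent_intervals
      (a := fun i : ℕ => (i : ℝ) / n) fun k _ => hint _ _]
    simp [stepAverage, hn'.ne']
  rw [h1, Finset.sum_div, ← Finset.sum_sub_distrib]
  refine (Finset.abs_sum_le_sum_abs _ _).trans ?_
  calc _ ≤ ∑ _i : Fin n, c / (n : ℝ) ^ 2 := by
        refine Finset.sum_le_sum fun i _ => ?_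
        set a : ℝ := (i : ℕ) / n with ha
        set b : ℝ := ((i : ℕ) + 1 : ℕ) / n with hb
        have hab : b - a = 1 / n := by rw [ha, hb]; push_cast; ring
        have ha0 : 0 ≤ a := by positivity
        have hle : a ≤ b := by have : (0 : ℝ) < 1 / n := by positivity
                               linarith
        have h2 : Real.exp (-(c * b)) / n = ∫ _u in a..b, Real.exp (-(c * b)) := by
          rw [intervalIntegral.integral_const, hab, smul_eq_mul]; ring
        rw [h2, ← intervalIntegral.integral_sub (by simp) (hint _ _)]
        have h3 := intervalIntegral.norm_integral_le_of_norm_le_const (a := a) (b := b)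
          (f := fun u => Real.exp (-(c * b)) - Real.exp (-(c * u))) (C := c * (1 / n))
          fun u hu => by
            rw [Set.uIoc_of_le hle] at hu
            refine (abs_exp_neg_sub_le (mul_nonneg hc (ha0.trans hle))
              (mul_nonneg hc (ha0.trans hu.1.le))).trans ?_
            rw [← mul_sub, abs_mul, abs_of_nonneg hc, abs_of_nonneg (by linarith [hu.2])]
            exact mul_le_mul_of_nonneg_left (by linarith [hu.1]) hc
        rw [Real.norm_eq_abs, hab, abs_of_nonneg (show (0 : ℝ) ≤ 1 / n by positivity)] at h3
        refine h3.trans_eq ?_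
        ring
    _ = c / n := by
        rw [Finset.sum_const, Finset.card_univ, Fintype.card_fin, nsmul_eq_mul]
        field_simp

section sequences
variable {P : ProbabilityMeasure ℝ≥0} {N : ℕ → ℕ+} {y : ∀ k, Fin (N k) → ℝ≥0}

/-- For bounded weights, the average over the permutations factorizes asymptotically. -/
theorem abs_permAverage_bounded_sub_le {n : ℕ} (hn : 0 < n) {m q : Fin n → ℝ} {M l : ℝ}
    (hm : ∀ j, m j ∈ Set.Icc 0 M) (hq : ∀ j, q j ∈ Set.Icc (0 : ℝ) 1) (hl : 0 ≤ l) :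
    |permAverage (fun σ => (∑ i, m (σ i) * (q (σ i) *
        Real.exp (-(l * partialAverage (fun j => q (σ j)) (i + 1))))) / n)
      - (∑ j, m j * q j) / n * stepAverage (l * ((∑ j, q j) / n)) 0 1|
      ≤ M * l / √(n : ℝ) + M * l / n := by
  have hn' : (0 : ℝ) < n := by exact_mod_cast hn
  have hM : 0 ≤ M := (hm ⟨0, hn⟩).1.trans (hm ⟨0, hn⟩).2
  set C := (∑ j, q j) / n with hC
  have hC0 : 0 ≤ C := div_nonneg (Finset.sum_nonneg fun j _ => (hq j).1) hn'.le
  have hC1 : C ≤ 1 := by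
    rw [hC, div_le_one hn']
    exact (Finset.sum_le_sum fun j _ => (hq j).2).trans_eq (by simp)
  set B := (∑ j, m j * q j) / n with hB
  have hB0 : 0 ≤ B :=
    div_nonneg (Finset.sum_nonneg fun j _ => mul_nonneg (hm j).1 (hq j).1) hn'.le
  have hBM : B ≤ M := by
    rw [hB, div_le_iff₀ hn']
    refine (Finset.sum_le_sum fun j _ => (mul_le_of_le_one_right (hm j).1 (hq j).2).trans
      (hm j).2).trans_eq ?_
    simp [mul_comm]
  set R := (∑ i : Fin n, Real.exp (-(l * C * (((i : ℕ) + 1 : ℕ) / (n : ℝ))))) / n with hR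
  have h1 : |permAverage (fun σ => (∑ i, m (σ i) * (q (σ i) *
        Real.exp (-(l * partialAverage (fun j => q (σ j)) (i + 1))))) / n) - B * R|
      ≤ M * l / √(n : ℝ) := by
    -- Once the partial averages are replaced by their means, the `i`-th term depends on `σ` only
    -- through `σ i`, and the average factorizes.
    have hBR : B * R = permAverage (fun σ => (∑ i, m (σ i) * (q (σ i) *
        Real.exp (-(l * C * (((i : ℕ) + 1 : ℕ) / (n : ℝ)))))) / n) := by
      rw [permAverage_div, permAverage_sum, hR, mul_div_assoc', Finset.mul_sum]
      congr 1
      refine Finset.sum_congr rfl fun i _ => ?_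
      rw [mul_comm, hB, ← permAverage_apply (fun j => m j * q j) i, ← permAverage_const_mul]
      congr 1; ext σ; ring
    rw [hBR, ← permAverage_sub]
    refine (abs_permAverage_le _).trans ?_
    calc _ ≤ permAverage (fun σ => (∑ i : Fin n, M * l *
          |partialAverage (fun j => q (σ j)) (i + 1) - ((i : ℕ) + 1 : ℕ) / (n : ℝ) * C|) / n) := by
          refine permAverage_mono fun σ => ?_
          rw [← sub_div, abs_div, abs_of_pos hn', div_le_div_iff_of_pos_right hn',
            ← Finset.sum_sub_distrib]
          refine (Finset.abs_sum_le_sum_abs _ _).trans (Finset.sum_le_sum fun i _ => ?_)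
          rw [← mul_sub, ← mul_sub, ← mul_assoc, abs_mul,
            abs_of_nonneg (mul_nonneg (hm _).1 (hq _).1)]
          have h3 := abs_exp_neg_sub_le
            (mul_nonneg hl (partialAverage_mem (q := fun j => q (σ j)) (fun j => hq _) (i + 1)).1)
            (by positivity : 0 ≤ l * C * (((i : ℕ) + 1 : ℕ) / (n : ℝ)))
          have h4 : l * partialAverage (fun j => q (σ j)) (i + 1)
              - l * C * (((i : ℕ) + 1 : ℕ) / (n : ℝ))
              = l * (partialAverage (fun j => q (σ j)) (i + 1)
                - ((i : ℕ) + 1 : ℕ) / (n : ℝ) * C) := by ring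
          rw [h4, abs_mul, abs_of_nonneg hl] at h3
          rw [mul_assoc M]
          exact mul_le_mul ((mul_le_of_le_one_right (hm _).1 (hq _).2).trans (hm _).2) h3
            (abs_nonneg _) hM
      _ = (∑ i : Fin n, M * l * permAverage (fun σ =>
          |partialAverage (fun j => q (σ j)) (i + 1) - ((i : ℕ) + 1 : ℕ) / (n : ℝ) * C|)) / n := by
          rw [permAverage_div, permAverage_sum]
          simp_rw [permAverage_const_mul]
      _ ≤ (∑ _i : Fin n, M * l * (1 / √(n : ℝ))) / n := by
          refine div_le_div_of_nonneg_right (Finset.sum_le_sum fun i _ => ?_) hn'.le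
          exact mul_le_mul_of_nonneg_left (permAverage_abs_partialAverage_sub_le hq hn i.2)
            (mul_nonneg hM hl)
      _ = M * l / √(n : ℝ) := by
          rw [Finset.sum_const, Finset.card_univ, Fintype.card_fin, nsmul_eq_mul]
          field_simp
  have h2 : |B * R - B * stepAverage (l * C) 0 1| ≤ M * l / n := by
    rw [← mul_sub, abs_mul, abs_of_nonneg hB0, mul_div_assoc]
    refine mul_le_mul hBM ((abs_riemannSum_sub_le hn (mul_nonneg hl hC0)).trans ?_)
      (abs_nonneg _) hM
    exact div_le_div_of_nonneg_right (mul_le_of_le_one_right hl hC1) hn'.le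
  exact (abs_sub_le _ _ _).trans (add_le_add h1 h2)

theorem continuous_stepAverage_zero_one : Continuous fun c => stepAverage c 0 1 := by
  unfold stepAverage
  exact intervalIntegral.continuous_parametric_intervalIntegral_of_continuous' (by fun_prop) 0 1

/-- Reindexing by `j = σ i` takes the weights out of the permutation average, in the form that
`tendsto_weighted_average` can truncate. -/
theorem permAverage_weightedAverage {n : ℕ} (m q : Fin n → ℝ) (l : ℝ) :
    permAverage (fun σ => (∑ i, m (σ i) * (q (σ i) *
        Real.exp (-(l * partialAverage (fun j => q (σ j)) (i + 1))))) / (n : ℝ))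
      = (∑ j, m j * permAverage (fun σ => q j *
        Real.exp (-(l * partialAverage (fun j => q (σ j)) ((σ.symm j : ℕ) + 1))))) / (n : ℝ) := by
  rw [permAverage_div]
  congr 1
  simp_rw [← permAverage_const_mul]
  rw [← permAverage_sum]
  congr 1
  ext σ
  rw [← Equiv.sum_comp σ (fun j => m j * (q j *
        Real.exp (-(l * partialAverage (fun j => q (σ j)) ((σ.symm j : ℕ) + 1)))))]
  simp

theorem tendsto_permAverage_weightedAverage (hN : Tendsto N atTop atTop)
    (hint : Integrable (fun x : ℝ≥0 => (x : ℝ)) (P : Measure ℝ≥0))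
    (hsum : ∀ k, ∑ i, (y k i : ℝ) = ((N k : ℕ) : ℝ) * mean P)
    (hE : Tendsto (fun k => empirical (N k) (y k)) atTop (𝓝 P)) {t l : ℝ} (ht : 0 ≤ t)
    (hl : 0 ≤ l) :
    Tendsto (fun k => permAverage fun σ => weightedAverage (fun i => y k (σ i)) t l) atTop
      (𝓝 (∫ x : ℝ≥0, (x : ℝ) * (Real.exp (-((x : ℝ) * t)) * stepAverage (l * laplace P t) 0 1)
        ∂(P : Measure ℝ≥0))) := by
  have hq : ∀ k (j : Fin (N k)), Real.exp (-((y k j : ℝ) * t)) ∈ Set.Icc (0 : ℝ) 1 :=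
    fun k j => exp_neg_mul_mem ht _
  have hφ0 : 0 ≤ laplace P t := integral_nonneg fun x => Real.exp_nonneg _
  have hstep : |stepAverage (l * laplace P t) 0 1| ≤ Real.exp |l| := by
    refine (abs_stepAverage_le le_rfl zero_le_one (by simp)).trans (Real.exp_le_exp.2 ?_)
    rw [abs_mul, abs_of_nonneg hφ0]
    exact mul_le_of_le_one_right (abs_nonneg _) (laplace_le_one P ht)
  have h := tendsto_weighted_average hint hsum hE (K := Real.exp |l|)
    (a := fun k j => permAverage (fun σ => Real.exp (-((y k j : ℝ) * t)) *
      Real.exp (-(l * partialAverage (fun i => Real.exp (-((y k (σ i) : ℝ) * t)))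
        ((σ.symm j : ℕ) + 1)))))
    (ψ := fun x => Real.exp (-((x : ℝ) * t)) * stepAverage (l * laplace P t) 0 1)
    (fun k j => abs_permAverage_le_of_forall fun σ => ?_) (by fun_prop) (fun x => ?_) fun M => ?_
  · refine h.congr fun k => ?_
    exact (permAverage_weightedAverage (fun j => (y k j : ℝ))
      (fun j => Real.exp (-((y k j : ℝ) * t))) l).symm
  · have h1 := partialAverage_mem (q := fun i => Real.exp (-((y k (σ i) : ℝ) * t)))
      (fun i => hq k (σ i)) ((σ.symm j : ℕ) + 1)
    rw [abs_mul, abs_of_nonneg (hq k j).1, abs_of_nonneg (Real.exp_nonneg _)]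
    exact (mul_le_of_le_one_left (Real.exp_nonneg _) (hq k j).2).trans
      (exp_neg_mul_le_exp_abs h1.1 h1.2)
  · rw [abs_mul, abs_of_nonneg (Real.exp_nonneg _)]
    exact (mul_le_of_le_one_left (abs_nonneg _) (exp_neg_mul_mem ht x).2).trans hstep
  · have hmain : Tendsto (fun k => (∑ j, min (y k j : ℝ) M * Real.exp (-((y k j : ℝ) * t)))
        / ((N k : ℕ) : ℝ) * stepAverage (l * ((∑ j, Real.exp (-((y k j : ℝ) * t)))
          / ((N k : ℕ) : ℝ))) 0 1) atTop
        (𝓝 ((∫ x : ℝ≥0, min (x : ℝ) M * Real.exp (-((x : ℝ) * t)) ∂(P : Measure ℝ≥0))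
          * stepAverage (l * laplace P t) 0 1)) :=
      (tendsto_average_truncated hE M (f := fun x => Real.exp (-((x : ℝ) * t))) (by fun_prop)
        (abs_exp_neg_mul_le ht)).mul ((continuous_stepAverage_zero_one.tendsto _).comp
          ((tendsto_average_exp hE ht).const_mul l))
    rw [← integral_mul_const] at hmain
    simp_rw [mul_assoc] at hmain
    have hNt := tendsto_natCast_atTop hN
    have herr : Tendsto (fun k => (M : ℝ) * l / √((N k : ℕ) : ℝ) + (M : ℝ) * l / ((N k : ℕ) : ℝ))
        atTop (𝓝 (0 + 0)) :=
      (tendsto_const_nhds.div_atTop (Real.tendsto_sqrt_atTop.comp hNt)).add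
        (tendsto_const_nhds.div_atTop hNt)
    rw [add_zero] at herr
    refine tendsto_of_tendsto_of_dist hmain (squeeze_zero (fun _ => dist_nonneg) (fun k => ?_) herr)
    rw [dist_comm, Real.dist_eq]
    have h2 := abs_permAverage_bounded_sub_le (N k).pos (m := fun j => min (y k j : ℝ) M)
      (q := fun j => Real.exp (-((y k j : ℝ) * t))) (M := M) (l := l)
      (fun j => ⟨by positivity, min_le_right _ _⟩) (hq k) hl
    rw [permAverage_weightedAverage (fun j => min (y k j : ℝ) M)
      (fun j => Real.exp (-((y k j : ℝ) * t))) l] at h2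
    exact h2

theorem tendsto_permAverage_outFormula (hμ : 0 < mean P) (hN : Tendsto N atTop atTop)
    (hint : Integrable (fun x : ℝ≥0 => (x : ℝ)) (P : Measure ℝ≥0))
    (hsum : ∀ k, ∑ i, (y k i : ℝ) = ((N k : ℕ) : ℝ) * mean P)
    (hE : Tendsto (fun k => empirical (N k) (y k)) atTop (𝓝 P)) {t l : ℝ} (ht : 0 ≤ t)
    (hl : 0 ≤ l) :
    Tendsto (fun k => permAverage fun σ => outFormula (popularity fun i => y k (σ i))
        ((N k : ℕ) * mean P * t) (l / (N k : ℕ))) atTop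
      (𝓝 (1 / mean P * (∫ x : ℝ≥0, (x : ℝ) * (Real.exp (-((x : ℝ) * t)) *
        stepAverage (l * laplace P t) 0 1) ∂(P : Measure ℝ≥0))
          * Real.exp (-(l * (1 - laplace P t))))) := by
  have h1 : Tendsto (fun k => Real.exp (-(l * (1 - (∑ j, Real.exp (-((y k j : ℝ) * t)))
      / ((N k : ℕ) : ℝ)))) * (1 / mean P *
        permAverage fun σ => weightedAverage (fun i => y k (σ i)) t l)) atTop
      (𝓝 (Real.exp (-(l * (1 - laplace P t))) * (1 / mean P *
        ∫ x : ℝ≥0, (x : ℝ) * (Real.exp (-((x : ℝ) * t)) *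
        stepAverage (l * laplace P t) 0 1) ∂(P : Measure ℝ≥0)))) :=
    Tendsto.mul ((Real.continuous_exp.tendsto _).comp
      ((tendsto_const_nhds.sub (tendsto_average_exp hE ht)).const_mul l).neg)
      ((tendsto_permAverage_weightedAverage hN hint hsum hE ht hl).const_mul _)
  rw [mul_comm (Real.exp _)] at h1
  have herr : Tendsto (fun k => l ^ 2 / ((N k : ℕ) : ℝ)) atTop (𝓝 0) :=
    tendsto_const_nhds.div_atTop (tendsto_natCast_atTop hN)
  refine tendsto_of_tendsto_of_dist h1 (squeeze_zero (fun _ => dist_nonneg) (fun k => ?_) herr)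
  rw [dist_comm, Real.dist_eq, ← permAverage_const_mul, ← permAverage_const_mul,
    ← permAverage_sub]
  refine abs_permAverage_le_of_forall fun σ => ?_
  have h2 := abs_outFormula_popularity_sub_le (y := fun i => y k (σ i)) hμ
    (by rw [← hsum k]; exact Equiv.sum_comp σ fun i => (y k i : ℝ)) ht hl
  rw [Equiv.sum_comp σ fun i => Real.exp (-((y k i : ℝ) * t))] at h2
  exact h2

end sequences

/-! ### From deterministic to random weights -/

theorem mean_pos {P : ProbabilityMeasure ℝ≥0} (h : mean P ≠ 0) : 0 < mean P :=
  lt_of_le_of_ne (integral_nonneg fun x => x.coe_nonneg) h.symm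

theorem continuous_empirical (n : ℕ+) : Continuous (empirical n) := by
  rw [continuous_iff_continuousAt]
  intro x
  refine ProbabilityMeasure.tendsto_iff_forall_integral_tendsto.2 fun f => ?_
  simp_rw [integral_empirical]
  have : Continuous fun x : Fin n → ℝ≥0 => (∑ i, f (x i)) / ((n : ℕ) : ℝ) := by fun_prop
  exact this.tendsto x

/-- Lipschitz test functions suffice, and rescaling changes their averages by at most the Lipschitz
constant times `|c - 1|` times the mean. -/
theorem tendsto_empirical_rescale {P : ProbabilityMeasure ℝ≥0} {N : ℕ → ℕ+}
    {x : ∀ k, Fin (N k) → ℝ≥0} {c : ℕ → ℝ≥0}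
    (hE : Tendsto (fun k => empirical (N k) (x k)) atTop (𝓝 P))
    (hc : Tendsto (fun k => |(c k : ℝ) - 1| * ((∑ i, (x k i : ℝ)) / ((N k : ℕ) : ℝ))) atTop (𝓝 0)) :
    Tendsto (fun k => empirical (N k) (fun i => c k * x k i)) atTop (𝓝 P) := by
  rw [tendsto_iff_forall_lipschitz_integral_tendsto] at hE ⊢
  rintro f hfb ⟨K, hK⟩
  have h1 := hE f hfb ⟨K, hK⟩
  simp_rw [integral_empirical] at h1 ⊢
  have h2 := hc.const_mul (K : ℝ)
  rw [mul_zero] at h2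
  refine tendsto_of_tendsto_of_dist h1 (squeeze_zero (fun _ => dist_nonneg) (fun k => ?_) h2)
  have hn : (0 : ℝ) < ((N k : ℕ) : ℝ) := by exact_mod_cast (N k).pos
  rw [dist_comm, Real.dist_eq, ← sub_div, abs_div, abs_of_pos hn, div_le_iff₀ hn,
    ← Finset.sum_sub_distrib]
  refine (Finset.abs_sum_le_sum_abs _ _).trans ?_
  calc _ ≤ ∑ i, (K : ℝ) * (|(c k : ℝ) - 1| * (x k i : ℝ)) := by
        refine Finset.sum_le_sum fun i _ => ?_
        have h3 := hK.dist_le_mul (c k * x k i) (x k i)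
        rw [Real.dist_eq] at h3
        refine h3.trans_eq ?_
        rw [NNReal.dist_eq, NNReal.coe_mul, ← abs_of_nonneg (x k i).coe_nonneg, ← abs_mul,
          abs_of_nonneg (x k i).coe_nonneg]
        congr 2; ring
    _ = _ := by rw [← Finset.mul_sum, ← Finset.mul_sum]; field_simp

/-- A limit along all deterministic arrays is automatically uniform near `P`: otherwise bad vectors
of growing size, rescaled to have mean exactly `mean P`, would form a contradicting array. Outside
the neighbourhood boundedness is enough. The predicate `A` carries the ordering assumption and must
survive rescaling. -/
theorem tendsto_integral_of_LLN {Ω : ℕ+ → Type*} [∀ n, MeasurableSpace (Ω n)]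
    {μΩ : ∀ n, Measure (Ω n)} [∀ n, IsProbabilityMeasure (μΩ n)]
    {w : ∀ n : ℕ+, Ω n → Fin n → ℝ≥0} (hw : ∀ n, Measurable (w n))
    {P : ProbabilityMeasure ℝ≥0} (hLLN : LLN μΩ w P)
    {A : ∀ n : ℕ+, (Fin n → ℝ≥0) → Prop} (hA : ∀ n c x, A n x → A n fun i => c * x i)
    (hwA : ∀ n, ∀ᵐ ω ∂(μΩ n), A n (w n ω))
    {H : ∀ n : ℕ+, (Fin n → ℝ≥0) → ℝ} (hHm : ∀ n, Measurable (H n)) (hHb : ∀ n x, |H n x| ≤ 1)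
    (hHs : ∀ n c x, c ≠ 0 → H n (fun i => c * x i) = H n x) {L : ℝ}
    (hlim : ∀ (N : ℕ → ℕ+) (y : ∀ k, Fin (N k) → ℝ≥0), Tendsto N atTop atTop →
      (∀ k, A (N k) (y k)) → (∀ k, ∑ i, (y k i : ℝ) = ((N k : ℕ) : ℝ) * mean P) →
      Tendsto (fun k => empirical (N k) (y k)) atTop (𝓝 P) →
      Tendsto (fun k => H (N k) (y k)) atTop (𝓝 L)) :
    Tendsto (fun n => ∫ ω, H n (w n ω) ∂(μΩ n)) atTop (𝓝 L) := by
  let _ := TopologicalSpace.metrizableSpaceMetric (ProbabilityMeasure ℝ≥0)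
  have hμ := mean_pos hLLN.mean_ne_zero
  obtain ⟨Z, hZm, hZ0, hZE, hZM⟩ := hLLN.exists_scaling
  have key : ∀ ε > 0, ∃ δ > 0, ∃ n₀ : ℕ+, ∀ n ≥ n₀, ∀ x, A n x → dist (empirical n x) P < δ →
      |(∑ i, (x i : ℝ)) / ((n : ℕ) : ℝ) - mean P| < δ → |H n x - L| ≤ ε := by
    intro ε hε
    by_contra hcon
    push Not at hcon
    -- With `k + 2 > 1` the tolerance stays below `mean P`, so the empirical means are positive and
    -- can be normalized.
    have hδ0 : ∀ k : ℕ, 0 < mean P / (k + 2) := fun k => by positivity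
    choose N hN x hxA hxE hxM hxH using fun k : ℕ => hcon (mean P / (k + 2)) (hδ0 k) k.succPNat
    have hδ : Tendsto (fun k : ℕ => mean P / ((k : ℝ) + 2)) atTop (𝓝 0) :=
      tendsto_const_nhds.div_atTop
        (tendsto_atTop_add_const_right _ _ tendsto_natCast_atTop_atTop)
    have hNt : Tendsto N atTop atTop := by
      refine tendsto_atTop.2 fun b => ?_
      filter_upwards [eventually_ge_atTop (b : ℕ)] with k hk
      refine le_trans ?_ (hN k)
      rw [← PNat.coe_le_coe, Nat.succPNat_coe]
      omega
    have hE : Tendsto (fun k => empirical (N k) (x k)) atTop (𝓝 P) :=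
      tendsto_iff_dist_tendsto_zero.2
        (squeeze_zero (fun _ => dist_nonneg) (fun k => (hxE k).le) hδ)
    set m : ℕ → ℝ := fun k => (∑ i, (x k i : ℝ)) / ((N k : ℕ) : ℝ) with hm
    have hm0 : ∀ k, 0 < m k := fun k => by
      have h1 := (abs_lt.1 (hxM k)).1
      have h2 : mean P / (k + 2) < mean P := div_lt_self hμ (by
        have : (0 : ℝ) ≤ k := k.cast_nonneg
        linarith)
      simp only [hm]
      linarith
    set c : ℕ → ℝ≥0 := fun k => Real.toNNReal (mean P / m k) with hc
    have hcc : ∀ k, (c k : ℝ) = mean P / m k := fun k =>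
      Real.coe_toNNReal _ (div_nonneg hμ.le (hm0 k).le)
    have hc0 : ∀ k, c k ≠ 0 := fun k => (Real.toNNReal_pos.2 (div_pos hμ (hm0 k))).ne'
    have h1 := hlim N (fun k i => c k * x k i) hNt (fun k => hA _ _ _ (hxA k)) (fun k => by
        have hn : (0 : ℝ) < ((N k : ℕ) : ℝ) := by exact_mod_cast (N k).pos
        simp only [NNReal.coe_mul]
        have h2 : ∑ i, (x k i : ℝ) = m k * ((N k : ℕ) : ℝ) := by simp only [hm]; field_simp
        rw [← Finset.mul_sum, hcc, h2]
        have := (hm0 k).ne'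
        field_simp)
      (tendsto_empirical_rescale hE (squeeze_zero (fun k => by have := hm0 k; positivity)
        (fun k => by
          have h3 : |(c k : ℝ) - 1| * m k = |m k - mean P| := by
            rw [← abs_of_pos (hm0 k), ← abs_mul, abs_of_pos (hm0 k), sub_mul, hcc,
              div_mul_cancel₀ _ (hm0 k).ne', one_mul, abs_sub_comm]
          exact h3.trans_le (hxM k).le) hδ))
    simp_rw [fun k => hHs (N k) (c k) (x k) (hc0 k)] at h1
    obtain ⟨k, hk⟩ := (Metric.tendsto_nhds.1 h1 ε hε).exists
    rw [Real.dist_eq] at hk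
    exact absurd hk (not_lt.2 (hxH k).le)
  rw [Metric.tendsto_nhds]
  intro ε hε
  obtain ⟨δ, hδ, n₀, hn₀⟩ := key (ε / 3) (by positivity)
  set K := 1 + |L| with hK
  have hK0 : 0 < K := by positivity
  have hbd : ∀ s : ℝ, 0 ≤ s → |min 1 (s / δ)| ≤ 1 := fun s hs => by
    rw [abs_of_nonneg (by positivity)]; exact min_le_left _ _
  -- Truncated distances to the limits: they vanish there and equal one at distance at least `δ`, so
  -- their expectations bound the probability of the bad event, on which the error is at most `K`.
  let Ψ₁ : ProbabilityMeasure ℝ≥0 →ᵇ ℝ := BoundedContinuousFunction.ofNormedAddCommGroup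
    (fun Q => min 1 (dist Q P / δ)) (by fun_prop) 1 fun Q => hbd _ dist_nonneg
  let Ψ₂ : ℝ →ᵇ ℝ := BoundedContinuousFunction.ofNormedAddCommGroup
    (fun s => min 1 (|s - mean P| / δ)) (by fun_prop) 1 fun s => hbd _ (abs_nonneg _)
  have e1 := hZE Ψ₁
  have e2 := hZM Ψ₂
  have z1 : Ψ₁ P = 0 := by simp [Ψ₁]
  have z2 : Ψ₂ (mean P) = 0 := by simp [Ψ₂]
  have e3 := (e1.add e2).const_mul K
  rw [z1, z2, add_zero, mul_zero] at e3
  filter_upwards [(tendsto_order.1 e3).2 (ε / 3) (by positivity), eventually_ge_atTop n₀]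
    with n hn hnn
  have hxm : Measurable fun ω => fun i => Z n ω * w n ω i :=
    measurable_pi_lambda _ fun i => (hZm n).mul ((measurable_pi_apply i).comp (hw n))
  have m1 : Measurable fun ω => Ψ₁ (empirical n fun i => Z n ω * w n ω i) :=
    ((Ψ₁.continuous.comp (continuous_empirical n)).measurable).comp hxm
  have m2 : Measurable fun ω => Ψ₂ ((∑ i, (Z n ω : ℝ) * (w n ω i : ℝ)) / ((n : ℕ) : ℝ)) := by
    refine Ψ₂.continuous.measurable.comp (Measurable.div_const
      (Finset.measurable_sum _ fun i _ => ?_) _)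
    exact (measurable_coe_nnreal_real.comp (hZm n)).mul
      (measurable_coe_nnreal_real.comp ((measurable_pi_apply i).comp (hw n)))
  have i1 : Integrable (fun ω => Ψ₁ (empirical n fun i => Z n ω * w n ω i)) (μΩ n) :=
    Integrable.of_bound m1.aestronglyMeasurable 1
      (Eventually.of_forall fun ω => hbd _ dist_nonneg)
  have i2 : Integrable (fun ω => Ψ₂ ((∑ i, (Z n ω : ℝ) * (w n ω i : ℝ)) / ((n : ℕ) : ℝ))) (μΩ n) :=
    Integrable.of_bound m2.aestronglyMeasurable 1
      (Eventually.of_forall fun ω => hbd _ (abs_nonneg _))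
  have iH : Integrable (fun ω => H n (w n ω)) (μΩ n) :=
    Integrable.of_bound ((hHm n).comp (hw n)).aestronglyMeasurable 1
      (Eventually.of_forall fun ω => hHb n _)
  have hsub : ∫ ω, H n (w n ω) ∂(μΩ n) - L = ∫ ω, (H n (w n ω) - L) ∂(μΩ n) := by
    rw [integral_sub iH (integrable_const L)]; simp
  rw [Real.dist_eq, hsub, ← Real.norm_eq_abs]
  calc _ ≤ ∫ ω, (ε / 3 + K * (Ψ₁ (empirical n fun i => Z n ω * w n ω i)
        + Ψ₂ ((∑ i, (Z n ω : ℝ) * (w n ω i : ℝ)) / ((n : ℕ) : ℝ)))) ∂(μΩ n) := by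
        refine norm_integral_le_of_norm_le ((integrable_const _).add
          ((i1.add i2).const_mul K)) ?_
        filter_upwards [hZ0 n, hwA n] with ω hZω hAω
        have p1 : 0 ≤ Ψ₁ (empirical n fun i => Z n ω * w n ω i) :=
          le_min zero_le_one (div_nonneg dist_nonneg hδ.le)
        have p2 : 0 ≤ Ψ₂ ((∑ i, (Z n ω : ℝ) * (w n ω i : ℝ)) / ((n : ℕ) : ℝ)) :=
          le_min zero_le_one (div_nonneg (abs_nonneg _) hδ.le)
        have hb : |H n (w n ω) - L| ≤ K :=
          (abs_sub _ _).trans (add_le_add (hHb n _) le_rfl)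
        rw [Real.norm_eq_abs]
        by_cases h1 : dist (empirical n fun i => Z n ω * w n ω i) P < δ
        · by_cases h2 : |(∑ i, (Z n ω : ℝ) * (w n ω i : ℝ)) / ((n : ℕ) : ℝ) - mean P| < δ
          · have h3 := hn₀ n hnn (fun i => Z n ω * w n ω i) (hA _ _ _ hAω) h1 (by
              simpa only [NNReal.coe_mul] using h2)
            rw [hHs n (Z n ω) (w n ω) hZω.ne'] at h3
            have := mul_nonneg hK0.le (add_nonneg p1 p2)
            linarith
          · have h3 : Ψ₂ ((∑ i, (Z n ω : ℝ) * (w n ω i : ℝ)) / ((n : ℕ) : ℝ)) = 1 :=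
              min_eq_left ((one_le_div hδ).2 (not_lt.1 h2))
            rw [h3]
            nlinarith
        · have h3 : Ψ₁ (empirical n fun i => Z n ω * w n ω i) = 1 :=
            min_eq_left ((one_le_div hδ).2 (not_lt.1 h1))
          rw [h3]
          nlinarith
    _ = ε / 3 + K * (∫ ω, Ψ₁ (empirical n fun i => Z n ω * w n ω i) ∂(μΩ n)
        + ∫ ω, Ψ₂ ((∑ i, (Z n ω : ℝ) * (w n ω i : ℝ)) / ((n : ℕ) : ℝ)) ∂(μΩ n)) := by
        have i3 : Integrable (fun ω => Ψ₁ (empirical n fun i => Z n ω * w n ω i)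
            + Ψ₂ ((∑ i, (Z n ω : ℝ) * (w n ω i : ℝ)) / ((n : ℕ) : ℝ))) (μΩ n) := i1.add i2
        rw [integral_add (integrable_const _) (i3.const_mul K), integral_const_mul,
          integral_add i1 i2]
        simp
    _ < ε := by linarith

/-! ### Properties of the explicit formula -/

theorem popularity_smul {n : ℕ} (c : ℝ≥0) (x : Fin n → ℝ≥0) (hc : c ≠ 0) :
    popularity (fun i => c * x i) = popularity x := by
  ext i
  simp only [popularity, NNReal.coe_mul]
  rw [← Finset.mul_sum, mul_div_mul_left _ _ (NNReal.coe_ne_zero.2 hc)]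

theorem measurable_outFormula_popularity {n : ℕ} (T l : ℝ) :
    Measurable fun x : Fin n → ℝ≥0 => outFormula (popularity x) T l := by
  have hp : ∀ i, Measurable fun x : Fin n → ℝ≥0 => popularity x i := fun i => by
    unfold popularity; fun_prop
  unfold outFormula
  refine Finset.measurable_sum _ fun i _ => Measurable.mul (by fun_prop)
    (Finset.measurable_prod _ fun j _ => ?_)
  split_ifs
  · exact measurable_const
  · fun_prop

theorem abs_outFormula_popularity_le {n : ℕ} (x : Fin n → ℝ≥0) {T l : ℝ} (hT : 0 ≤ T)
    (hl : 0 ≤ l) : |outFormula (popularity x) T l| ≤ 1 := by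
  have hp := popularity_nonneg x
  have hq : ∀ j, Real.exp (-(popularity x j * T)) ≤ 1 := fun j =>
    Real.exp_le_one_iff.2 (by have := mul_nonneg (hp j) hT; linarith)
  have he : Real.exp (-l) ≤ 1 := Real.exp_le_one_iff.2 (by linarith)
  have hf : ∀ i j : Fin n, (if j ≤ i then Real.exp (-l) else Real.exp (-l) +
      (1 - Real.exp (-l)) * Real.exp (-(popularity x j * T))) ∈ Set.Icc (0 : ℝ) 1 := by
    intro i j
    have h1 := mul_nonneg (sub_nonneg.2 he) (Real.exp_nonneg (-(popularity x j * T)))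
    have h2 := mul_le_of_le_one_right (sub_nonneg.2 he) (hq j)
    split_ifs
    · exact ⟨Real.exp_nonneg _, he⟩
    · constructor <;> linarith [Real.exp_nonneg (-l)]
  unfold outFormula
  refine (Finset.abs_sum_le_sum_abs _ _).trans ?_
  calc _ ≤ ∑ i, popularity x i := by
        refine Finset.sum_le_sum fun i _ => ?_
        rw [abs_mul, abs_mul, abs_of_nonneg (hp i), Real.abs_exp, mul_assoc,
          abs_of_nonneg (Finset.prod_nonneg fun j _ => (hf i j).1)]
        exact mul_le_of_le_one_right (hp i) (mul_le_one₀ (hq i)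
          (Finset.prod_nonneg fun j _ => (hf i j).1)
          (Finset.prod_le_one (fun j _ => (hf i j).1) fun j _ => (hf i j).2))
    _ ≤ 1 := by
        unfold popularity
        rw [← Finset.sum_div]
        -- An inequality rather than an equality, because the total weight may vanish.
        exact div_self_le_one _

theorem integral_outFormula_exchangeable {Ω : Type*} [MeasurableSpace Ω] {μΩ : Measure Ω}
    [IsProbabilityMeasure μΩ] {n : ℕ} {w : Ω → Fin n → ℝ≥0} (hw : Measurable w)
    (hex : Exchangeable μΩ w) {T l : ℝ} (hT : 0 ≤ T) (hl : 0 ≤ l) :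
    ∫ ω, outFormula (popularity (w ω)) T l ∂μΩ
      = ∫ ω, permAverage (fun σ => outFormula (popularity fun i => w ω (σ i)) T l) ∂μΩ := by
  have hm := measurable_outFormula_popularity (n := n) T l
  have hwσ : ∀ σ : Equiv.Perm (Fin n), Measurable fun ω i => w ω (σ i) := fun σ =>
    measurable_pi_lambda _ fun i => (measurable_pi_apply (σ i)).comp hw
  have h1 : ∀ σ : Equiv.Perm (Fin n), ∫ ω, outFormula (popularity fun i => w ω (σ i)) T l ∂μΩ
      = ∫ ω, outFormula (popularity (w ω)) T l ∂μΩ := by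
    intro σ
    rw [← integral_map (hwσ σ).aemeasurable (f := fun x => outFormula (popularity x) T l)
      hm.aestronglyMeasurable, hex σ, integral_map hw.aemeasurable hm.aestronglyMeasurable]
  unfold permAverage
  rw [integral_div, integral_finsetSum]
  · simp_rw [h1]
    exact (permAverage_const _).symm
  · intro σ _
    exact Integrable.of_bound (hm.comp (hwσ σ)).aestronglyMeasurable 1
      (Eventually.of_forall fun ω => abs_outFormula_popularity_le _ hT hl)

/-! ### The derivative of the Laplace transform -/

/-- Difference quotients of `exp (-x * s)` on `[0, ∞)` are bounded by `x`, which is integrable;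
working within `Set.Ici 0` includes the right derivative at `0`. -/
theorem hasDerivWithinAt_laplace {P : ProbabilityMeasure ℝ≥0}
    (hint : Integrable (fun x : ℝ≥0 => (x : ℝ)) (P : Measure ℝ≥0)) {t : ℝ} (ht : 0 ≤ t) :
    HasDerivWithinAt (laplace P)
      (-∫ x : ℝ≥0, (x : ℝ) * Real.exp (-((x : ℝ) * t)) ∂(P : Measure ℝ≥0)) (Set.Ici 0) t := by
  rw [hasDerivWithinAt_iff_tendsto_slope, ← integral_neg]
  have hslope : ∀ᶠ s in 𝓝[Set.Ici 0 \ {t}] t, ∫ x : ℝ≥0,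
      slope (fun s => Real.exp (-((x : ℝ) * s))) t s ∂(P : Measure ℝ≥0)
      = slope (laplace P) t s := by
    filter_upwards [self_mem_nhdsWithin] with s hs
    simp only [slope_def_field]
    rw [integral_div, integral_sub (integrable_exp P hs.1) (integrable_exp P ht)]
    rfl
  refine Tendsto.congr' hslope (tendsto_integral_filter_of_dominated_convergence
    (fun x : ℝ≥0 => (x : ℝ)) (Eventually.of_forall fun s => ?_) ?_ hint
    (Eventually.of_forall fun x => ?_))
  · simp only [slope_def_field]
    exact Continuous.aestronglyMeasurable (by fun_prop)
  · filter_upwards [self_mem_nhdsWithin] with s hs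
    refine Eventually.of_forall fun x => ?_
    have hst : 0 < |s - t| := abs_pos.2 (sub_ne_zero.2 hs.2)
    rw [slope_def_field, norm_div, Real.norm_eq_abs, Real.norm_eq_abs, div_le_iff₀ hst]
    refine (abs_exp_neg_sub_le (mul_nonneg x.coe_nonneg hs.1)
      (mul_nonneg x.coe_nonneg ht)).trans_eq ?_
    rw [← mul_sub, abs_mul, abs_of_nonneg x.coe_nonneg]
  · have hd : HasDerivAt (fun s => Real.exp (-((x : ℝ) * s)))
        (Real.exp (-((x : ℝ) * t)) * (-((x : ℝ) * 1))) t :=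
      (((hasDerivAt_id t).const_mul (x : ℝ)).neg).exp
    have h := hasDerivWithinAt_iff_tendsto_slope.1 (hd.hasDerivWithinAt (s := Set.Ici 0))
    convert h using 2
    ring

theorem abs_derivWithin_laplace {P : ProbabilityMeasure ℝ≥0}
    (hint : Integrable (fun x : ℝ≥0 => (x : ℝ)) (P : Measure ℝ≥0)) {t : ℝ} (ht : 0 ≤ t) :
    |derivWithin (laplace P) (Set.Ici 0) t|
      = ∫ x : ℝ≥0, (x : ℝ) * Real.exp (-((x : ℝ) * t)) ∂(P : Measure ℝ≥0) := by
  rw [(hasDerivWithinAt_laplace hint ht).derivWithin (uniqueDiffOn_Ici 0 t ht), abs_neg,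
    abs_of_nonneg (integral_nonneg fun x => mul_nonneg x.coe_nonneg (Real.exp_nonneg _))]

theorem laplace_pos (P : ProbabilityMeasure ℝ≥0) {t : ℝ} (ht : 0 ≤ t) : 0 < laplace P t :=
  integral_exp_pos (integrable_exp P ht)

/-! ### The limits of the transform -/

section limits
variable {Ω : ℕ+ → Type*} [∀ n, MeasurableSpace (Ω n)]
    {μΩ : ∀ n, Measure (Ω n)} [∀ n, IsProbabilityMeasure (μΩ n)]
    {w : ∀ n : ℕ+, Ω n → Fin n → ℝ≥0} {P : ProbabilityMeasure ℝ≥0} {t l : ℝ}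

/-- Exchangeability replaces the formula by its permutation average before the transfer, so no order
condition is required of the vectors. -/
theorem tendsto_outTransform_exchangeable (hw : ∀ n, Measurable (w n)) (hLLN : LLN μΩ w P)
    (ht : 0 ≤ t) (hl : 0 ≤ l) (hex : ∀ n, Exchangeable (μΩ n) (w n)) :
    Tendsto (fun n : ℕ+ => outTransform (μΩ n) (w n) ((n : ℕ) * mean P * t) (l / (n : ℕ))) atTop
      (𝓝 (|derivWithin (laplace P) (Set.Ici 0) t| / mean P
        * (∫ x in (0 : ℝ)..1, Real.exp (-(l * laplace P t * x)))
        * Real.exp (-(l * (1 - laplace P t))))) := by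
  have hμ := mean_pos hLLN.mean_ne_zero
  have hT : ∀ n : ℕ+, 0 ≤ ((n : ℕ) : ℝ) * mean P * t := fun n => by positivity
  have hL : ∀ n : ℕ+, 0 ≤ l / ((n : ℕ) : ℝ) := fun n => by positivity
  simp_rw [fun n : ℕ+ => outTransform_eq (μΩ n) (w n) (hT n) (hL n),
    fun n : ℕ+ => integral_outFormula_exchangeable (hw n) (hex n) (hT n) (hL n)]
  have h := tendsto_integral_of_LLN hw hLLN (A := fun _ _ => True) (fun _ _ _ _ => trivial)
    (fun n => Eventually.of_forall fun _ => trivial)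
    (H := fun n x => permAverage fun σ => outFormula (popularity fun i => x (σ i))
      ((n : ℕ) * mean P * t) (l / (n : ℕ)))
    (fun n => Measurable.div_const (Finset.measurable_sum _ fun σ _ =>
      (measurable_outFormula_popularity _ _).comp
        (measurable_pi_lambda _ fun i => measurable_pi_apply (σ i))) _)
    (fun n x => abs_permAverage_le_of_forall fun σ =>
      abs_outFormula_popularity_le _ (hT n) (hL n))
    (fun n c x hc => by
      congr 1; ext σ
      rw [popularity_smul c (fun i => x (σ i)) hc])
    (fun N y hN _ hsum hE => tendsto_permAverage_outFormula hμ hN hLLN.integrable hsum hE ht hl)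
  convert h using 2
  rw [abs_derivWithin_laplace hLLN.integrable ht, stepAverage]
  simp_rw [← mul_assoc]
  rw [integral_mul_const]
  simp only [zero_add, mul_one]
  ring

theorem tendsto_outTransform_antitone (hw : ∀ n, Measurable (w n)) (hLLN : LLN μΩ w P)
    (ht : 0 ≤ t) (hl : 0 ≤ l) (hanti : ∀ n, ∀ᵐ ω ∂(μΩ n), Antitone (w n ω)) :
    Tendsto (fun n : ℕ+ => outTransform (μΩ n) (w n) ((n : ℕ) * mean P * t) (l / (n : ℕ))) atTop
      (𝓝 (1 / mean P
        * (∫ x : ℝ≥0, (x : ℝ) * Real.exp (-((x : ℝ) * t))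
            * (∫ u in (0 : ℝ)..1, Real.exp (-(l *
                ((∫ y : ℝ≥0 in Set.Ioi x, Real.exp (-((y : ℝ) * t)) ∂(P : Measure ℝ≥0))
                  + u * Real.exp (-((x : ℝ) * t)) * (P : Measure ℝ≥0).real {x}))))
            ∂(P : Measure ℝ≥0))
        * Real.exp (-(l * (1 - laplace P t))))) := by
  have hμ := mean_pos hLLN.mean_ne_zero
  have hT : ∀ n : ℕ+, 0 ≤ ((n : ℕ) : ℝ) * mean P * t := fun n => by positivity
  have hL : ∀ n : ℕ+, 0 ≤ l / ((n : ℕ) : ℝ) := fun n => by positivity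
  simp_rw [fun n : ℕ+ => outTransform_eq (μΩ n) (w n) (hT n) (hL n)]
  have h := tendsto_integral_of_LLN hw hLLN (A := fun _ x => Antitone x)
    (fun n c x hx i j hij => mul_le_mul_of_nonneg_left (hx hij) c.2) hanti
    (H := fun n x => outFormula (popularity x) ((n : ℕ) * mean P * t) (l / (n : ℕ)))
    (fun n => measurable_outFormula_popularity _ _)
    (fun n x => abs_outFormula_popularity_le _ (hT n) (hL n))
    (fun n c x hc => by simp only [popularity_smul c x hc])
    (fun N y hN hy hsum hE => tendsto_outFormula_of_weightedAverage hμ hN hsum hE ht hl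
      (tendsto_weightedAverage_antitone hN hLLN.integrable hsum hE hy ht l))
  convert h using 4
  simp_rw [← mul_assoc, stepAverage, real_tilted P ht measurableSet_Ioi,
    real_tilted_singleton P ht, ← mul_assoc]

theorem tendsto_outTransform_monotone (hw : ∀ n, Measurable (w n)) (hLLN : LLN μΩ w P)
    (ht : 0 ≤ t) (hl : 0 ≤ l) (hmono : ∀ n, ∀ᵐ ω ∂(μΩ n), Monotone (w n ω)) :
    Tendsto (fun n : ℕ+ => outTransform (μΩ n) (w n) ((n : ℕ) * mean P * t) (l / (n : ℕ))) atTop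
      (𝓝 (1 / mean P
        * (∫ x : ℝ≥0, (x : ℝ) * Real.exp (-((x : ℝ) * t))
            * (∫ u in (0 : ℝ)..1, Real.exp (-(l *
                ((∫ y : ℝ≥0 in Set.Iio x, Real.exp (-((y : ℝ) * t)) ∂(P : Measure ℝ≥0))
                  + u * Real.exp (-((x : ℝ) * t)) * (P : Measure ℝ≥0).real {x}))))
            ∂(P : Measure ℝ≥0))
        * Real.exp (-(l * (1 - laplace P t))))) := by
  have hμ := mean_pos hLLN.mean_ne_zero
  have hT : ∀ n : ℕ+, 0 ≤ ((n : ℕ) : ℝ) * mean P * t := fun n => by positivity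
  have hL : ∀ n : ℕ+, 0 ≤ l / ((n : ℕ) : ℝ) := fun n => by positivity
  simp_rw [fun n : ℕ+ => outTransform_eq (μΩ n) (w n) (hT n) (hL n)]
  have h := tendsto_integral_of_LLN hw hLLN (A := fun _ x => Monotone x)
    (fun n c x hx i j hij => mul_le_mul_of_nonneg_left (hx hij) c.2) hmono
    (H := fun n x => outFormula (popularity x) ((n : ℕ) * mean P * t) (l / (n : ℕ)))
    (fun n => measurable_outFormula_popularity _ _)
    (fun n x => abs_outFormula_popularity_le _ (hT n) (hL n))
    (fun n c x hc => by simp only [popularity_smul c x hc])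
    (fun N y hN hy hsum hE => tendsto_outFormula_of_weightedAverage hμ hN hsum hE ht hl
      (tendsto_weightedAverage_monotone hN hLLN.integrable hsum hE hy ht hl))
  convert h using 4
  simp_rw [← mul_assoc, stepAverage, real_tilted P ht measurableSet_Iio,
    real_tilted_singleton P ht, ← mul_assoc]

/-- Without an atom at `x`, the average over the jump disappears. -/
theorem integral_exp_of_measure_singleton_eq_zero {x : ℝ≥0}
    (hx : (P : Measure ℝ≥0) {x} = 0) (l a b : ℝ) :
    ∫ u in (0 : ℝ)..1, Real.exp (-(l * (a + u * b * (P : Measure ℝ≥0).real {x})))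
      = Real.exp (-(l * a)) := by
  simp [measureReal_def, hx]

end limits

theorem integral_exp_mul_exp {l φ : ℝ} (hl : 0 < l) (hφ : 0 < φ) :
    (∫ x in (0 : ℝ)..1, Real.exp (-(l * φ * x))) * Real.exp (-(l * (1 - φ)))
      = (Real.exp (-(l * (1 - φ))) - Real.exp (-l)) / (l * φ) := by
  have hc : -(l * φ) ≠ 0 := neg_ne_zero.2 (mul_pos hl hφ).ne'
  have h := intervalIntegral.integral_comp_mul_left (a := 0) (b := 1) (fun x => Real.exp x) hc
  rw [integral_exp, mul_zero, mul_one, Real.exp_zero, smul_eq_mul] at h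
  have h1 : (fun x : ℝ => Real.exp (-(l * φ * x))) = fun x => Real.exp (-(l * φ) * x) := by
    ext x; rw [neg_mul]
  have h2 : Real.exp (-l) = Real.exp (-(l * φ)) * Real.exp (-(l * (1 - φ))) := by
    rw [← Real.exp_add]; congr 1; ring
  rw [h1, h, h2]
  field_simp
  ring

end MoveToFront
end

open MoveToFront in
theorem mainTheorem2 {Ω : ℕ+ → Type*} [∀ n, MeasurableSpace (Ω n)]
    (μΩ : ∀ n, Measure (Ω n)) [∀ n, IsProbabilityMeasure (μΩ n)]
    (w : ∀ n : ℕ+, Ω n → Fin n → ℝ≥0) (hw : ∀ n, Measurable (w n))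
    (P : ProbabilityMeasure ℝ≥0) (hLLN : LLN μΩ w P)
    (t : ℝ) (ht : 0 ≤ t) (l : ℝ) (hl : 0 ≤ l) :
    -- the two expressions of `B_n` agree
    (∀ (n : ℕ+) (s r : ℝ), 0 ≤ s → 0 ≤ r →
      outTransform (μΩ n) (w n) s r = aboveTransform (μΩ n) (w n) s r) ∧
    -- exchangeable weights
    ((∀ n, Exchangeable (μΩ n) (w n)) →
      Tendsto (fun n : ℕ+ => outTransform (μΩ n) (w n) ((n : ℕ) * mean P * t) (l / (n : ℕ))) atTop
        (𝓝 (|derivWithin (laplace P) (Set.Ici 0) t| / mean P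
          * (∫ x in (0 : ℝ)..1, Real.exp (-(l * laplace P t * x)))
          * Real.exp (-(l * (1 - laplace P t))))) ∧
      (0 < l →
        Tendsto (fun n : ℕ+ => outTransform (μΩ n) (w n) ((n : ℕ) * mean P * t) (l / (n : ℕ))) atTop
          (𝓝 (|derivWithin (laplace P) (Set.Ici 0) t| / mean P
            * ((Real.exp (-(l * (1 - laplace P t))) - Real.exp (-l)) / (l * laplace P t)))))) ∧
    -- decreasing weights: general `P`, and `P` without atoms in `(0, ∞)`
    ((∀ n, ∀ᵐ ω ∂(μΩ n), Antitone (w n ω)) →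
      Tendsto (fun n : ℕ+ => outTransform (μΩ n) (w n) ((n : ℕ) * mean P * t) (l / (n : ℕ))) atTop
        (𝓝 (1 / mean P
          * (∫ x : ℝ≥0, (x : ℝ) * Real.exp (-((x : ℝ) * t))
              * (∫ u in (0 : ℝ)..1, Real.exp (-(l *
                  ((∫ y : ℝ≥0 in Set.Ioi x, Real.exp (-((y : ℝ) * t)) ∂(P : Measure ℝ≥0))
                    + u * Real.exp (-((x : ℝ) * t)) * (P : Measure ℝ≥0).real {x}))))
              ∂(P : Measure ℝ≥0))
          * Real.exp (-(l * (1 - laplace P t))))) ∧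
      ((∀ x : ℝ≥0, 0 < x → (P : Measure ℝ≥0) {x} = 0) →
        Tendsto (fun n : ℕ+ => outTransform (μΩ n) (w n) ((n : ℕ) * mean P * t) (l / (n : ℕ))) atTop
          (𝓝 (1 / mean P
            * (∫ x : ℝ≥0, (x : ℝ) * Real.exp (-((x : ℝ) * t))
                * Real.exp (-(l *
                    ∫ y : ℝ≥0 in Set.Ioi x, Real.exp (-((y : ℝ) * t)) ∂(P : Measure ℝ≥0)))
                ∂(P : Measure ℝ≥0))
            * Real.exp (-(l * (1 - laplace P t))))))) ∧
    -- increasing weights: general `P`, and `P` without atoms in `(0, ∞)`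
    ((∀ n, ∀ᵐ ω ∂(μΩ n), Monotone (w n ω)) →
      Tendsto (fun n : ℕ+ => outTransform (μΩ n) (w n) ((n : ℕ) * mean P * t) (l / (n : ℕ))) atTop
        (𝓝 (1 / mean P
          * (∫ x : ℝ≥0, (x : ℝ) * Real.exp (-((x : ℝ) * t))
              * (∫ u in (0 : ℝ)..1, Real.exp (-(l *
                  ((∫ y : ℝ≥0 in Set.Iio x, Real.exp (-((y : ℝ) * t)) ∂(P : Measure ℝ≥0))
                    + u * Real.exp (-((x : ℝ) * t)) * (P : Measure ℝ≥0).real {x}))))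
              ∂(P : Measure ℝ≥0))
          * Real.exp (-(l * (1 - laplace P t))))) ∧
      ((∀ x : ℝ≥0, 0 < x → (P : Measure ℝ≥0) {x} = 0) →
        Tendsto (fun n : ℕ+ => outTransform (μΩ n) (w n) ((n : ℕ) * mean P * t) (l / (n : ℕ))) atTop
          (𝓝 (1 / mean P
            * (∫ x : ℝ≥0, (x : ℝ) * Real.exp (-((x : ℝ) * t))
                * Real.exp (-(l *
                    ∫ y : ℝ≥0 in Set.Iic x, Real.exp (-((y : ℝ) * t)) ∂(P : Measure ℝ≥0)))
                ∂(P : Measure ℝ≥0))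
            * Real.exp (-(l * (1 - laplace P t))))))) := by

  have hc := hLLN.integrable
  refine ⟨fun n s r _ _ => outTransform_eq_aboveTransform (μΩ n) (w n) s r, fun hex => ?_,
    fun hanti => ?_, fun hmono => ?_⟩
  · have h := tendsto_outTransform_exchangeable hw hLLN ht hl hex
    refine ⟨h, fun hl0 => ?_⟩
    rwa [mul_assoc, integral_exp_mul_exp hl0 (laplace_pos P ht)] at h
  · have h := tendsto_outTransform_antitone hw hLLN ht hl hanti
    refine ⟨h, fun hP => ?_⟩
    convert h using 4
    refine integral_congr_ae (Eventually.of_forall fun x => ?_)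
    -- An atom at zero is harmless, since the factor `x` kills the integrand there.
    rcases eq_or_lt_of_le (zero_le (a := x)) with rfl | hx
    · simp
    · simp only [integral_exp_of_measure_singleton_eq_zero (hP x hx)]
  · have h := tendsto_outTransform_monotone hw hLLN ht hl hmono
    refine ⟨h, fun hP => ?_⟩
    convert h using 4
    refine integral_congr_ae (Eventually.of_forall fun x => ?_)
    rcases eq_or_lt_of_le (zero_le (a := x)) with rfl | hx
    · simp
    · simp only [integral_exp_of_measure_singleton_eq_zero (hP x hx)]
      rw [setIntegral_congr_set (Iio_ae_eq_Iic' (hP x hx))]
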